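/- Let $\mathcal{G}_+=(\Gamma_+,G)$ be a countable directed graph of groups: an undirected graph $\Gamma$ with edge reversal $e\mapsto\overline e$ and an orientation $\Gamma^1_+$, vertex groups $G_v$, edge groups $G_e=G_{\overline e}$ and monomorphisms $\alpha_e\colon G_e\to G_{r(e)}$ for $e\in\Gamma^1$, where $\Gamma$ and all $G_v$ are countable. Assume that $\mathcal{G}_+$ is row-finite (each vertex is the range of only finitely many $e\in\Gamma^1_+$) and has no sources (each vertex is the range of some $e\in\Gamma^1_+$). Let $\Sigma=\{\Sigma_e:e\in\Gamma^1_+\}$ be a set of transversals: each $\Sigma_e$ is a transversal of $G_{r(e)}/\alpha_e(G_e)$ containing the identity. Notation. - $F(\mathcal{G})$ is the fundamental groupoid: the groupoid with unit space $\Gamma^0$ generated by all $e\in\Gamma^1$ (range $r(e)$, source $s(e)$) and all $g\in G_v$, $v\in\Gamma^0$, subject to the relations of the vertex groups, $\overline e=e^{-1}$, and $\alpha_e(g)e=e\alpha_{\overline e}(g)$ for $e\in\Gamma^1$, $g\in G_e$. - $\Lambda\subseteq F(\mathcal{G})$ is the word category: the subcategory of the elements represented by words $g_1e_1\cdots g_ne_ng_{n+1}$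 with all $e_i\in\Gamma^1_+$. $\mathcal{S}_{\mathcal{G}_+}$ is its left inverse hull: the inverse semigroup of partial bijections of $\Lambda$ generated under composition by $\tau^\lambda\colon s(\lambda)\Lambda\to\lambda\Lambda$, $\nu\mapsto\lambda\nu$, and $\sigma^\lambda=(\tau^\lambda)^{-1}$, for $\lambda\in\Lambda$; its nonzero elements are the $\tau^\lambda\sigma^\mu$ with $s(\lambda)=s(\mu)$. - $E_\Sigma$ is the directed graph with vertex set $\Gamma^0$ and edges $he$ ($e\in\Gamma^1_+$, $h\in\Sigma_e$), $r(he)=r(e)$, $s(he)=s(e)$. Paths $a_1a_2\cdots$ satisfy $s(a_i)=r(a_{i+1})$. $E_\Sigma^\infty$ is the space of infinite paths, with the topology generated by the sets $pE_\Sigma^\infty$ ($p$ a finite path) and their set differences. Each $\mu\in\Lambda$ has a unique normal form $\mu=h_1e_1\cdots h_ne_ng$ with $h_i\in\Sigma_{e_i}$ and $g\in G_{s(\mu)}$, and $q(\mu)=h_1e_1\cdots h_ne_n$ is the corresponding finite path of $E_\Sigma$. Write $q(\mu)\le\alpha$ if $q(\mu)$ is an initial subpath of $\alpha$. - $W_{\mathcal{G}_+}$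 is the directed forest with vertices the cosets $\gamma G_w$ ($\gamma\in vF(\mathcal{G})w$; $v,w\in\Gamma^0$), with an edge with range $\gamma G_w$ and source $\gamma' G_{w'}$ exactly when $r(\gamma)=r(\gamma')$ and $\gamma^{-1}\gamma'\in G_weG_{w'}$ for some $e\in\Gamma^1_+$ with $r(e)=w$, $s(e)=w'$. Its boundary $\partial W_{\mathcal{G}_+}$ is the set of shift-tail equivalence classes of infinite directed paths, with the topology generated by the sets $Z(u)$ (classes of the paths with range $u$) and their set differences. $F(\mathcal{G})$ acts on it by left multiplication of cosets, the anchor map sending the class of a path in the component of $G_v$ to $v$. - $E_\Sigma^\infty$ is regarded as a subset of $\partial W_{\mathcal{G}_+}$ by identifying $h_1e_1h_2e_2\cdots$ with the class of the path through $G_{r(e_1)},\ h_1e_1G_{s(e_1)},\ h_1e_1h_2e_2G_{s(e_2)},\dots$. - For an action of a groupoid $\mathscr{G}$ on $X$ with anchor map $\tau$, $\mathscr{G}\ltimes X=\{(g,x):\tau(x)=s(g)\}$ has $s(g,x)=x$, $r(g,x)=g\cdot x$, $(h,g\cdot x)(g,x)=(hg,x)$, $(g,x)^{-1}=(g^{-1},g\cdot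 x)$, and the subspace topology from $\mathscr{G}\times X$ with $\mathscr{G}$ discrete. $\mathscr{G}|_U$ denotes the subgroupoid of the morphisms with range and source in a set of units $U$, with the subspace topology. - For an action of an inverse semigroup $S$ on $X$ by partial homeomorphisms ($s$ having domain $D_{s^*s}$), $S\ltimes X$ is the groupoid of germs $[s,x]$ with $x\in D_{s^*s}$, where $[s,x]=[t,y]$ iff $x=y$ and $se=te$ for some idempotent $e$ with $x\in D_e$. It has $s([s,x])=x$, $r([s,x])=s\cdot x$, $[s,t\cdot x][t,x]=[st,x]$, $[s,x]^{-1}=[s^*,s\cdot x]$, and the topology generated by the sets $[s,U]=\{[s,x]:x\in U\}$ with $U\subseteq D_{s^*s}$ open. Statement. There is an action of $\mathcal{S}_{\mathcal{G}_+}$ on $E_\Sigma^\infty$ by partial homeomorphisms given by $\tau^\lambda\sigma^\mu\cdot\alpha=\lambda\mu^{-1}\cdot\alpha$, with domain $\{\alpha: q(\mu)\le\alpha\}$, where $\lambda\mu^{-1}\in F(\mathcal{G})$ acts on $\alpha\in\partial W_{\mathcal{G}_+}$. Its groupoid of germs $\mathcal{S}_{\mathcal{G}_+}\ltimes E_\Sigma^\infty$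 is topologically isomorphic to the restriction $(F(\mathcal{G})\ltimes\partial W_{\mathcal{G}_+})|_{E_\Sigma^\infty}$, through an isomorphism of groupoids and homeomorphism that sends $[\tau^\lambda\sigma^\mu,\alpha]$ to $(\lambda\mu^{-1},\alpha)$. -/

import Mathlib

open CategoryTheory

/-! Convention. Groupoids and small categories are Mathlib categories in which `x ⟶ y` is the set
`x𝒢y` of morphisms with RANGE `x` and SOURCE `y`, so that the diagrammatic composite `f ≫ g` is the
product `fg`, which is defined when `s(f) = r(g)`. -/

/-- The set of all morphisms of a small category, as triples (range, source, morphism). -/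
abbrev Arr (C : Type*) [Category C] := Σ x y : C, (x ⟶ y)

/-- The map induced by a functor on the sets of all morphisms. -/
def arrMap {C D : Type*} [Category C] [Category D] (F : C ⥤ D) (f : Arr C) : Arr D :=
  ⟨F.obj f.1, F.obj f.2.1, F.map f.2.2⟩

/-- An isomorphism of topological groupoids: a homomorphism (functor) which is a homeomorphism on
the sets of morphisms. In particular it is bijective on morphisms and hence on units. -/
def IsTopologicalIso {C D : Type*} [Groupoid C] [Groupoid D] [TopologicalSpace (Arr C)]
    [TopologicalSpace (Arr D)] (F : C ⥤ D) : Prop :=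
  IsHomeomorph (arrMap F)

/-! ### Inverse semigroups, their actions, and groupoids of germs -/

/-- Inverse semigroups; `s⁻¹` is the element usually written `s*`. -/
class InvSemigroup (S : Type*) extends Semigroup S, Inv S where
  mul_inv_mul : ∀ s : S, s * s⁻¹ * s = s
  inv_mul_inv : ∀ s : S, s⁻¹ * s * s⁻¹ = s⁻¹
  inv_unique : ∀ s t : S, s * t * s = s → t * s * t = t → t = s⁻¹

namespace InvSemigroup

variable {S : Type*} [InvSemigroup S]

theorem inv_inv' (s : S) : s⁻¹⁻¹ = s :=
  (inv_unique _ _ (inv_mul_inv s) (mul_inv_mul s)).symm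

theorem idem_inv {e : S} (he : e * e = e) : e⁻¹ = e :=
  (inv_unique e e (by rw [he, he]) (by rw [he, he])).symm

theorem idem_inv_mul (s : S) : (s⁻¹ * s) * (s⁻¹ * s) = s⁻¹ * s := by
  rw [← mul_assoc, inv_mul_inv]

theorem idem_mul_inv (s : S) : (s * s⁻¹) * (s * s⁻¹) = s * s⁻¹ := by
  rw [← mul_assoc, mul_inv_mul]

theorem idem_mul {e f : S} (he : e * e = e) (hf : f * f = f) :
    (e * f) * (e * f) = e * f := by
  have h1 : f * (e * f)⁻¹ * e = (e * f)⁻¹ := by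
    apply inv_unique
    · calc e * f * (f * (e * f)⁻¹ * e) * (e * f)
          = e * (f * f) * (e * f)⁻¹ * (e * e) * f := by simp only [mul_assoc]
        _ = (e * f) * (e * f)⁻¹ * (e * f) := by rw [he, hf]; simp only [mul_assoc]
        _ = e * f := mul_inv_mul _
    · calc f * (e * f)⁻¹ * e * (e * f) * (f * (e * f)⁻¹ * e)
          = f * ((e * f)⁻¹ * ((e * e) * (f * f)) * (e * f)⁻¹) * e := by simp only [mul_assoc]
        _ = f * (e * f)⁻¹ * e := by rw [he, hf, inv_mul_inv]
  have h2 : (e * f)⁻¹ * (e * f)⁻¹ = (e * f)⁻¹ := by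
    calc (e * f)⁻¹ * (e * f)⁻¹ = (f * (e * f)⁻¹ * e) * (f * (e * f)⁻¹ * e) := by rw [h1]
      _ = f * ((e * f)⁻¹ * (e * f) * (e * f)⁻¹) * e := by simp only [mul_assoc]
      _ = (e * f)⁻¹ := by rw [inv_mul_inv, h1]
  have h3 : e * f = (e * f)⁻¹ := by
    exact (inv_inv' (e * f)).symm.trans (idem_inv h2)
  rw [h3]
  exact h2

theorem idem_comm {e f : S} (he : e * e = e) (hf : f * f = f) : e * f = f * e := by
  have h1 := idem_mul he hf
  have h2 := idem_mul hf he
  have h3 : f * e = (e * f)⁻¹ := by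
    apply inv_unique
    · calc e * f * (f * e) * (e * f) = e * (f * f) * (e * e) * f := by simp only [mul_assoc]
        _ = (e * f) * (e * f) := by rw [he, hf]; simp only [mul_assoc]
        _ = e * f := h1
    · calc f * e * (e * f) * (f * e) = f * (e * e) * (f * f) * e := by simp only [mul_assoc]
        _ = (f * e) * (f * e) := by rw [he, hf]; simp only [mul_assoc]
        _ = f * e := h2
  rw [h3, idem_inv h1]

theorem mul_inv_rev' (s t : S) : (s * t)⁻¹ = t⁻¹ * s⁻¹ := by
  have hc := idem_comm (idem_mul_inv t) (idem_inv_mul s)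
  symm
  apply inv_unique
  · calc s * t * (t⁻¹ * s⁻¹) * (s * t) = s * ((t * t⁻¹) * (s⁻¹ * s)) * t := by
          simp only [mul_assoc]
      _ = (s * s⁻¹ * s) * (t * t⁻¹ * t) := by rw [hc]; simp only [mul_assoc]
      _ = s * t := by rw [mul_inv_mul, mul_inv_mul]
  · calc t⁻¹ * s⁻¹ * (s * t) * (t⁻¹ * s⁻¹) = t⁻¹ * ((s⁻¹ * s) * (t * t⁻¹)) * s⁻¹ := by
          simp only [mul_assoc]
      _ = (t⁻¹ * t * t⁻¹) * (s⁻¹ * s * s⁻¹) := by rw [← hc]; simp only [mul_assoc]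
      _ = t⁻¹ * s⁻¹ := by rw [inv_mul_inv, inv_mul_inv]

/-- Conjugates of idempotents are idempotent. -/
theorem idem_conj (s : S) {e : S} (he : e * e = e) :
    (s⁻¹ * e * s) * (s⁻¹ * e * s) = s⁻¹ * e * s := by
  have hc := idem_comm (idem_mul_inv s) he
  calc (s⁻¹ * e * s) * (s⁻¹ * e * s) = s⁻¹ * e * ((s * s⁻¹) * e) * s := by simp only [mul_assoc]
    _ = s⁻¹ * (e * e) * (s * s⁻¹ * s) := by rw [hc]; simp only [mul_assoc]
    _ = s⁻¹ * e * s := by rw [he, mul_inv_mul]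

end InvSemigroup

/-- An action of an inverse semigroup on a space by partial homeomorphisms: `φ s` is a partial
bijection, where `φ s x = some y` means that `x` is in the domain `D_{s*s}` and `s · x = y`. The
domains are required to cover the space, so that its groupoid of germs has unit space `X`. -/
@[ext]
structure InvSemigroupAction (S X : Type*) [InvSemigroup S] [TopologicalSpace X] where
  φ : S → (X ≃. X)
  map_inv : ∀ s, φ s⁻¹ = (φ s).symm
  map_mul : ∀ s t, φ (s * t) = (φ t).trans (φ s)
  continuous : ∀ s, Continuous fun x : {x : X // (φ s x).isSome} => (φ s x.1).get x.2
  covers : ∀ x, ∃ s, (φ s x).isSome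

namespace InvSemigroupAction

variable {S X : Type*} [InvSemigroup S] [TopologicalSpace X] (A : InvSemigroupAction S X)

theorem map_mul_eq_some {s t : S} {x y z : X} (ht : A.φ t x = some y) (hs : A.φ s y = some z) :
    A.φ (s * t) x = some z := by
  rw [A.map_mul, PEquiv.trans_eq_some]
  exact ⟨y, ht, hs⟩

theorem map_inv_eq_some {s : S} {x y : X} (h : A.φ s x = some y) : A.φ s⁻¹ y = some x := by
  rw [A.map_inv, PEquiv.eq_some_iff]
  exact h

theorem idem_apply {e : S} (he : e * e = e) {x : X} (hx : (A.φ e x).isSome) :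
    A.φ e x = some x := by
  obtain ⟨y, hy⟩ := Option.isSome_iff_exists.1 hx
  have h2 : A.φ (e * e) x = some y := by rw [he]; exact hy
  rw [A.map_mul, PEquiv.trans_eq_some] at h2
  obtain ⟨z, hz, hz'⟩ := h2
  have : z = y := Option.some.inj (hz.symm.trans hy)
  subst this
  have : x = z := (A.φ e).inj hy hz'
  subst this
  exact hy

/-- The germ relation at `x`, on the elements `s` with `s · x = y`: there is an idempotent `e` with
`x ∈ D_e` and `se = te`. (Germs at `x` that are equal have equal ranges.) -/
def germSetoid (y x : X) : Setoid {s : S // A.φ s x = some y} where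
  r s t := ∃ e : S, e * e = e ∧ (A.φ e x).isSome ∧ s.1 * e = t.1 * e
  iseqv :=
    { refl := fun s => ⟨s.1⁻¹ * s.1, InvSemigroup.idem_inv_mul _, by
          rw [A.map_mul_eq_some s.2 (A.map_inv_eq_some s.2)]; rfl, rfl⟩
      symm := fun ⟨e, h1, h2, h3⟩ => ⟨e, h1, h2, h3.symm⟩
      trans := by
        rintro s t u ⟨e, he, hex, h1⟩ ⟨f, hf, hfx, h2⟩
        refine ⟨e * f, InvSemigroup.idem_mul he hf, ?_, ?_⟩
        · rw [A.map_mul_eq_some (A.idem_apply hf hfx) (A.idem_apply he hex)]; rfl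
        · calc s.1 * (e * f) = t.1 * e * f := by rw [← mul_assoc, h1]
            _ = t.1 * f * e := by rw [mul_assoc, InvSemigroup.idem_comm he hf, mul_assoc]
            _ = u.1 * (e * f) := by rw [h2, mul_assoc, InvSemigroup.idem_comm he hf] }

/-- The germs `[s, x]` with `s · x = y`. -/
def GermHom (y x : X) := Quotient (A.germSetoid y x)

def mkGerm {y x : X} (s : S) (h : A.φ s x = some y) : A.GermHom y x :=
  Quotient.mk (A.germSetoid y x) ⟨s, h⟩

theorem mkGerm_eq {y x : X} {s t : S} {hs : A.φ s x = some y} {ht : A.φ t x = some y} (e : S)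
    (he : e * e = e) (hx : A.φ e x = some x) (h : s * e = t * e) : A.mkGerm s hs = A.mkGerm t ht :=
  Quotient.sound ⟨e, he, by rw [hx]; rfl, h⟩

theorem germ_ind {y x : X} {P : A.GermHom y x → Prop} (h : ∀ s hs, P (A.mkGerm s hs)) (a) : P a :=
  Quotient.ind (fun s => h s.1 s.2) a

/-- `[s, y][t, x] = [st, x]` for `y = t · x`. -/
def germMul {z y x : X} : A.GermHom z y → A.GermHom y x → A.GermHom z x :=
  Quotient.map₂ (fun s t => ⟨s.1 * t.1, A.map_mul_eq_some t.2 s.2⟩) (by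
    rintro ⟨s, hs⟩ ⟨s', hs'⟩ ⟨e, he, hey, h1⟩ ⟨t, ht⟩ ⟨t', ht'⟩ ⟨f, hf, hfx, h2⟩
    simp only at h1 h2
    have hey' := A.idem_apply he hey
    have hfx' := A.idem_apply hf hfx
    have hk := InvSemigroup.idem_conj t he
    have hc := InvSemigroup.idem_comm hf hk
    have hc2 := InvSemigroup.idem_comm (InvSemigroup.idem_mul_inv t) he
    refine ⟨f * (t⁻¹ * e * t), InvSemigroup.idem_mul hf hk, ?_, ?_⟩
    · rw [A.map_mul_eq_some
        (A.map_mul_eq_some ht (A.map_mul_eq_some hey' (A.map_inv_eq_some ht))) hfx']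
      rfl
    · have key : ∀ u : S, u * t * (f * (t⁻¹ * e * t)) = u * e * (t * f) := fun u => by
        calc u * t * (f * (t⁻¹ * e * t)) = u * ((t * t⁻¹) * e) * t * f := by
              rw [hc]; simp only [mul_assoc]
          _ = u * e * (t * t⁻¹ * t) * f := by rw [hc2]; simp only [mul_assoc]
          _ = u * e * (t * f) := by rw [InvSemigroup.mul_inv_mul, mul_assoc]
      calc s * t * (f * (t⁻¹ * e * t)) = s * e * (t * f) := key s
        _ = s' * e * (t * f) := by rw [h1]
        _ = s' * t * (f * (t⁻¹ * e * t)) := (key s').symm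
        _ = s' * (t * f) * (t⁻¹ * e * t) := by simp only [mul_assoc]
        _ = s' * t' * (f * (t⁻¹ * e * t)) := by rw [h2]; simp only [mul_assoc])

/-- `[s, x]⁻¹ = [s*, s · x]`. -/
def germInv {y x : X} : A.GermHom y x → A.GermHom x y :=
  Quotient.map (fun s => ⟨s.1⁻¹, A.map_inv_eq_some s.2⟩) (by
    rintro ⟨s, hs⟩ ⟨t, ht⟩ ⟨e, he, hex, h⟩
    simp only at h
    have hex' := A.idem_apply he hex
    have h' : e * s⁻¹ = e * t⁻¹ := by
      have := congrArg (fun a => a⁻¹) h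
      simpa only [InvSemigroup.mul_inv_rev', InvSemigroup.idem_inv he] using this
    have hse : (s * e) * s⁻¹ = (t * e) * t⁻¹ := by
      rw [h, mul_assoc, h', ← mul_assoc]
    have key : ∀ u : S, u⁻¹ * (u * e * u⁻¹) = e * u⁻¹ := fun u => by
      calc u⁻¹ * (u * e * u⁻¹) = ((u⁻¹ * u) * e) * u⁻¹ := by simp only [mul_assoc]
        _ = e * (u⁻¹ * u * u⁻¹) := by
            rw [InvSemigroup.idem_comm (InvSemigroup.idem_inv_mul u) he]; simp only [mul_assoc]
        _ = e * u⁻¹ := by rw [InvSemigroup.inv_mul_inv]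
    refine ⟨s * e * s⁻¹, ?_, ?_, ?_⟩
    · have := InvSemigroup.idem_conj s⁻¹ he
      rwa [InvSemigroup.inv_inv'] at this
    · rw [A.map_mul_eq_some (A.map_inv_eq_some hs) (A.map_mul_eq_some hex' hs)]; rfl
    · calc s⁻¹ * (s * e * s⁻¹) = e * s⁻¹ := key s
        _ = e * t⁻¹ := h'
        _ = t⁻¹ * (t * e * t⁻¹) := (key t).symm
        _ = t⁻¹ * (s * e * s⁻¹) := by rw [hse])

/-- Some element of `S` whose domain contains `x`. -/
noncomputable def elemAt (x : X) : S := (A.covers x).choose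

theorem elemAt_apply (x : X) : A.φ ((A.elemAt x)⁻¹ * A.elemAt x) x = some x := by
  obtain ⟨y, hy⟩ := Option.isSome_iff_exists.1 (A.covers x).choose_spec
  exact A.map_mul_eq_some hy (A.map_inv_eq_some hy)

/-- The unit at `x`, i.e. the germ at `x` of any idempotent whose domain contains `x`. -/
noncomputable def germId (x : X) : A.GermHom x x :=
  A.mkGerm ((A.elemAt x)⁻¹ * A.elemAt x) (A.elemAt_apply x)

theorem germId_eq {x : X} {e : S} (he : e * e = e) (hx : A.φ e x = some x) :
    A.mkGerm e hx = A.germId x := by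
  have hk := InvSemigroup.idem_inv_mul (A.elemAt x)
  refine A.mkGerm_eq (e * ((A.elemAt x)⁻¹ * A.elemAt x)) (InvSemigroup.idem_mul he hk)
    (A.map_mul_eq_some (A.elemAt_apply x) hx) ?_
  rw [← mul_assoc, he, InvSemigroup.idem_comm he hk, ← mul_assoc, hk]

end InvSemigroupAction

/-- The groupoid of germs `S ⋉ X`, with unit space `X`. -/
def GermGroupoid {S X : Type*} [InvSemigroup S] [TopologicalSpace X]
    (_A : InvSemigroupAction S X) : Type _ := X

namespace GermGroupoid

variable {S X : Type*} [InvSemigroup S] [TopologicalSpace X] (A : InvSemigroupAction S X)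

noncomputable instance : Groupoid (GermGroupoid A) where
  Hom y x := A.GermHom y x
  id x := A.germId x
  comp a b := A.germMul a b
  inv a := A.germInv a
  id_comp := by
    intro y x a
    induction a using A.germ_ind with | h s hs => ?_
    have he := InvSemigroup.idem_inv_mul (A.elemAt y)
    have hey := A.elemAt_apply y
    refine A.mkGerm_eq (s⁻¹ * ((A.elemAt y)⁻¹ * A.elemAt y) * s) (InvSemigroup.idem_conj s he)
      (A.map_mul_eq_some hs (A.map_mul_eq_some hey (A.map_inv_eq_some hs))) ?_
    change (A.elemAt y)⁻¹ * A.elemAt y * s * (s⁻¹ * ((A.elemAt y)⁻¹ * A.elemAt y) * s) =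
      s * (s⁻¹ * ((A.elemAt y)⁻¹ * A.elemAt y) * s)
    generalize (A.elemAt y)⁻¹ * A.elemAt y = e at he
    have hc := InvSemigroup.idem_comm (InvSemigroup.idem_mul_inv s) he
    calc e * s * (s⁻¹ * e * s) = e * ((s * s⁻¹) * e) * s := by simp only [mul_assoc]
      _ = (e * e) * s * s⁻¹ * s := by rw [hc]; simp only [mul_assoc]
      _ = e * (s * s⁻¹) * s := by rw [he]; simp only [mul_assoc]
      _ = s * (s⁻¹ * e * s) := by rw [← hc]; simp only [mul_assoc]
  comp_id := by
    intro y x a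
    induction a using A.germ_ind with | h s hs => ?_
    have he := InvSemigroup.idem_inv_mul (A.elemAt x)
    refine A.mkGerm_eq ((A.elemAt x)⁻¹ * A.elemAt x) he (A.elemAt_apply x) ?_
    rw [mul_assoc, he]
  assoc := by
    intro w z y x a b c
    induction a using A.germ_ind with | h s hs => ?_
    induction b using A.germ_ind with | h t ht => ?_
    induction c using A.germ_ind with | h u hu => ?_
    change A.mkGerm (s * t * u) _ = A.mkGerm (s * (t * u)) _
    congr 1
    exact mul_assoc _ _ _
  inv_comp := by
    intro y x a
    induction a using A.germ_ind with | h s hs => ?_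
    exact A.germId_eq (InvSemigroup.idem_inv_mul s) _
  comp_inv := by
    intro y x a
    induction a using A.germ_ind with | h s hs => ?_
    exact A.germId_eq (InvSemigroup.idem_mul_inv s) _

/-- The germ `[s, x]` as a morphism, where `s · x = y`. -/
def germ {y x : X} (s : S) (h : A.φ s x = some y) : Arr (GermGroupoid A) :=
  ⟨(y : X), (x : X), A.mkGerm s h⟩

/-- The set `[s, U]` of germs. -/
def germSet (s : S) (U : Set X) : Set (Arr (GermGroupoid A)) :=
  {a | ∃ (y x : X) (h : A.φ s x = some y), x ∈ U ∧ a = germ A s h}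

/-- The topology generated by the sets `[s, U]`, with `U` open and contained in `D_{s*s}`. -/
instance : TopologicalSpace (Arr (GermGroupoid A)) :=
  TopologicalSpace.generateFrom
    {T | ∃ (s : S) (U : Set X), IsOpen U ∧ (∀ x ∈ U, (A.φ s x).isSome) ∧ T = germSet A s U}

end GermGroupoid

/-! ### Groupoid actions, transformation groupoids and restrictions -/

/-- An action of a groupoid `C` on a space `X`: a morphism `g : a ⟶ b` (range `a`, source `b`) acts
as a homeomorphism from the fibre of the anchor map over `b` onto the fibre over `a`. -/
structure GroupoidAction (C X : Type*) [Groupoid C] [TopologicalSpace X] where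
  anchor : X → C
  anchor_surjective : Function.Surjective anchor
  act : ∀ {a b : C}, (a ⟶ b) → ({x : X // anchor x = b} ≃ₜ {x : X // anchor x = a})
  act_inv : ∀ {a b : C} (g : a ⟶ b), act (Groupoid.inv g) = (act g).symm
  act_comp : ∀ {a b c : C} (g : a ⟶ b) (h : b ⟶ c), act (g ≫ h) = (act h).trans (act g)

namespace GroupoidAction

variable {C X : Type*} [Groupoid C] [TopologicalSpace X] (B : GroupoidAction C X)

/-- `g · x` is defined and equal to `y`. -/
def ActsTo {a b : C} (g : a ⟶ b) (x y : X) : Prop :=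
  ∃ h : B.anchor x = b, (B.act g ⟨x, h⟩ : X) = y

theorem act_id (a : C) (x) : B.act (𝟙 a) x = x := by
  have h := B.act_comp (𝟙 a) (𝟙 a)
  rw [Category.comp_id] at h
  have hx := congrArg (fun k => k x) h
  exact ((B.act (𝟙 a)).injective hx).symm

/-- The transformation groupoid `C ⋉ X`, with unit space `X`. -/
def Transformation (_B : GroupoidAction C X) : Type _ := X

theorem act_mul {x y z : X} {h : B.anchor z ⟶ B.anchor y} {g : B.anchor y ⟶ B.anchor x}
    (hh : (B.act h ⟨y, rfl⟩ : X) = z) (hg : (B.act g ⟨x, rfl⟩ : X) = y) :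
    (B.act (h ≫ g) ⟨x, rfl⟩ : X) = z := by
  have : B.act g ⟨x, rfl⟩ = ⟨y, rfl⟩ := Subtype.ext hg
  rw [B.act_comp, Homeomorph.trans_apply, this, hh]

theorem act_inv_apply {x y : X} {g : B.anchor y ⟶ B.anchor x}
    (hg : (B.act g ⟨x, rfl⟩ : X) = y) : (B.act (Groupoid.inv g) ⟨y, rfl⟩ : X) = x := by
  have : B.act g ⟨x, rfl⟩ = ⟨y, rfl⟩ := Subtype.ext hg
  rw [B.act_inv, ← this, Homeomorph.symm_apply_apply]

/-- The morphisms with source `x` and range `y` are the pairs `(g, x)` with `g · x = y`, and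
`(h, y)(g, x) = (hg, x)`, `(g, x)⁻¹ = (g⁻¹, g · x)`. -/
instance : Groupoid (Transformation B) where
  Hom y x := {g : B.anchor y ⟶ B.anchor x // (B.act g ⟨x, rfl⟩ : X) = y}
  id x := ⟨𝟙 (B.anchor x), by rw [B.act_id]⟩
  comp h g := ⟨h.1 ≫ g.1, B.act_mul h.2 g.2⟩
  inv g := ⟨Groupoid.inv g.1, B.act_inv_apply g.2⟩
  id_comp g := Subtype.ext (Category.id_comp g.1)
  comp_id g := Subtype.ext (Category.comp_id g.1)
  assoc f g h := Subtype.ext (Category.assoc f.1 g.1 h.1)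
  inv_comp g := Subtype.ext (Groupoid.inv_comp g.1)
  comp_inv g := Subtype.ext (Groupoid.comp_inv g.1)

/-- A morphism of `C ⋉ X` as the pair `(g, x)` in `C × X`. -/
def pair (f : Arr (Transformation B)) : Arr C × X :=
  (⟨B.anchor f.1, B.anchor f.2.1, f.2.2.1⟩, f.2.1)

/-- The subspace topology from `C × X`, where `C` is discrete. -/
instance : TopologicalSpace (Arr (Transformation B)) :=
  TopologicalSpace.induced B.pair (@instTopologicalSpaceProd _ _ ⊥ _)

end GroupoidAction

/-- The restriction of a groupoid to a set `U` of units: all morphisms with range and source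
in `U`. -/
def Restriction {C : Type*} [Groupoid C] (U : Set C) : Type _ := {x : C // x ∈ U}

namespace Restriction

variable {C : Type*} [Groupoid C] (U : Set C)

instance : Groupoid (Restriction U) where
  Hom x y := x.1 ⟶ y.1
  id x := 𝟙 x.1
  comp {x y z} f g := @CategoryStruct.comp C _ x.1 y.1 z.1 f g
  inv {x y} f := @Groupoid.inv C _ x.1 y.1 f
  id_comp {x y} f := @Category.id_comp C _ x.1 y.1 f
  comp_id {x y} f := @Category.comp_id C _ x.1 y.1 f
  assoc {w x y z} f g h := @Category.assoc C _ w.1 x.1 y.1 z.1 f g h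
  inv_comp {x y} f := @Groupoid.inv_comp C _ x.1 y.1 f
  comp_inv {x y} f := @Groupoid.comp_inv C _ x.1 y.1 f

variable {U} in
/-- The inclusion of the restriction on morphisms. -/
def incl (f : Arr (Restriction U)) : Arr C := ⟨f.1.1, f.2.1.1, f.2.2⟩

/-- The subspace topology. -/
instance [TopologicalSpace (Arr C)] : TopologicalSpace (Arr (Restriction U)) :=
  TopologicalSpace.induced incl inferInstance

end Restriction

/-! ### The left inverse hull of a left cancellative small category -/

/-- Left cancellativity: `fg = fh` implies `g = h`. -/
class LeftCancellative (C : Type*) [Category C] : Prop where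
  cancel : ∀ {x y z : C} (f : x ⟶ y) (g h : y ⟶ z), f ≫ g = f ≫ h → g = h

section Hull

variable {C : Type*} [Category C]

/-- The graph of left multiplication by `l`, i.e. the pairs `(m, lm)` with `r(m) = s(l)`. -/
inductive TauRel {x y : C} (l : x ⟶ y) : Arr C → Arr C → Prop
  | mk {z : C} (m : y ⟶ z) : TauRel l ⟨y, z, m⟩ ⟨x, z, l ≫ m⟩

theorem TauRel.right_unique {x y : C} {l : x ⟶ y} {a b c : Arr C} (h : TauRel l a b)
    (h' : TauRel l a c) : b = c := by
  cases h; cases h'; rfl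

theorem TauRel.left_unique [LeftCancellative C] {x y : C} {l : x ⟶ y} {a b c : Arr C}
    (h : TauRel l a c) (h' : TauRel l b c) : a = b := by
  cases h with
  | mk m =>
    generalize hc : (⟨x, _, l ≫ m⟩ : Arr C) = d at h'
    cases h' with
    | mk m' =>
      simp only [Sigma.mk.injEq, heq_eq_eq, true_and] at hc
      obtain ⟨rfl, hc⟩ := hc
      rw [LeftCancellative.cancel l m m' (eq_of_heq hc)]

variable [LeftCancellative C]

open Classical in
/-- `τ^l : s(l)C → lC`, `m ↦ lm`, as a partial bijection of the set of morphisms. -/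
noncomputable def tauMap {x y : C} (l : x ⟶ y) : Arr C ≃. Arr C where
  toFun a := if h : ∃ b, TauRel l a b then some h.choose else none
  invFun b := if h : ∃ a, TauRel l a b then some h.choose else none
  inv a b := by
    constructor
    · intro h
      split_ifs at h with h1
      · have hab : TauRel l a b := by
          have := h1.choose_spec
          rwa [Option.mem_some_iff.1 h] at this
        have h2 : ∃ c, TauRel l a c := ⟨b, hab⟩
        rw [dif_pos h2]
        exact congrArg some (TauRel.right_unique h2.choose_spec hab)
    · intro h
      split_ifs at h with h1
      · have hab : TauRel l a b := by
          have := h1.choose_spec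
          rwa [Option.mem_some_iff.1 h] at this
        have h2 : ∃ c, TauRel l c b := ⟨a, hab⟩
        rw [dif_pos h2]
        exact congrArg some (TauRel.left_unique h2.choose_spec hab)

theorem tauMap_eq_some {x y : C} (l : x ⟶ y) (a b : Arr C) :
    tauMap l a = some b ↔ TauRel l a b := by
  classical
  change (if h : ∃ b, TauRel l a b then some h.choose else none) = some b ↔ _
  constructor
  · intro h
    split_ifs at h with h1
    have := h1.choose_spec
    rwa [Option.some.inj h] at this
  · intro h
    have h2 : ∃ c, TauRel l a c := ⟨b, h⟩
    rw [dif_pos h2]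
    exact congrArg some (TauRel.right_unique h2.choose_spec h)

/-- Membership in the semigroup of partial bijections that is generated under composition by
all `τ^l` and `σ^l = (τ^l)⁻¹`; here `g.trans f` is `f ∘ g`, and the zero element is the empty
map. -/
inductive InHull : (Arr C ≃. Arr C) → Prop
  | tau {x y : C} (l : x ⟶ y) : InHull (tauMap l)
  | sigma {x y : C} (l : x ⟶ y) : InHull (tauMap l).symm
  | mul {f g : Arr C ≃. Arr C} : InHull f → InHull g → InHull (g.trans f)

theorem InHull.symm {f : Arr C ≃. Arr C} (hf : InHull f) : InHull f.symm := by
  induction hf with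
  | tau l => exact .sigma l
  | sigma l => rw [PEquiv.symm_symm]; exact .tau l
  | mul _ _ h1 h2 => rw [PEquiv.symm_trans_rev]; exact .mul h2 h1

variable (C) in
/-- The left inverse hull of `C`. -/
def LeftInverseHull := {f : Arr C ≃. Arr C // InHull f}

theorem pequiv_trans_symm_trans {α β : Type*} (f : α ≃. β) :
    (f.trans f.symm).trans f = f := by
  ext a b
  simp only [PEquiv.trans_eq_some, PEquiv.eq_some_iff]
  constructor
  · rintro ⟨c, ⟨d, h1, h2⟩, h3⟩
    rwa [f.inj h1 h2]
  · intro h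
    exact ⟨a, ⟨b, h, h⟩, h⟩

theorem pequiv_eq_symm {α : Type*} {f g : α ≃. α} (h1 : (f.trans g).trans f = f)
    (h2 : (g.trans f).trans g = g) : g = f.symm := by
  ext b a
  rw [PEquiv.eq_some_iff]
  constructor
  · intro h
    have h' := h
    rw [← h2] at h'
    obtain ⟨c, hc, hca⟩ := (PEquiv.trans_eq_some _ _ _ _).1 h'
    obtain ⟨d, hd, hdc⟩ := (PEquiv.trans_eq_some _ _ _ _).1 hc
    have hda : d = a := Option.some.inj (hd.symm.trans h)
    rw [hda] at hdc
    rwa [← g.inj hca h]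
  · intro h
    have h' := h
    rw [← h1] at h'
    obtain ⟨c, hc, hcb⟩ := (PEquiv.trans_eq_some _ _ _ _).1 h'
    obtain ⟨d, hd, hdc⟩ := (PEquiv.trans_eq_some _ _ _ _).1 hc
    have hdb : d = b := Option.some.inj (hd.symm.trans h)
    rw [hdb] at hdc
    rwa [← f.inj hcb h]

instance : InvSemigroup (LeftInverseHull C) where
  mul f g := ⟨g.1.trans f.1, .mul f.2 g.2⟩
  mul_assoc f g h := Subtype.ext (PEquiv.trans_assoc h.1 g.1 f.1).symm
  inv f := ⟨f.1.symm, f.2.symm⟩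
  mul_inv_mul f := Subtype.ext (by
    change f.1.trans (f.1.symm.trans f.1) = f.1
    rw [← PEquiv.trans_assoc, pequiv_trans_symm_trans])
  inv_mul_inv f := Subtype.ext (by
    change f.1.symm.trans (f.1.trans f.1.symm) = f.1.symm
    rw [← PEquiv.trans_assoc]
    exact pequiv_trans_symm_trans f.1.symm)
  inv_unique f g h1 h2 := Subtype.ext (by
    apply pequiv_eq_symm
    · rw [PEquiv.trans_assoc]; exact congrArg Subtype.val h1
    · rw [PEquiv.trans_assoc]; exact congrArg Subtype.val h2)

/-- The element `τ^l σ^m` of the left inverse hull, for `s(l) = s(m)`. -/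
noncomputable def tauSigma {x y z : C} (l : x ⟶ z) (m : y ⟶ z) : LeftInverseHull C :=
  ⟨tauMap l, .tau l⟩ * ⟨(tauMap m).symm, .sigma m⟩

end Hull

/-! ### Directed graphs of groups and the fundamental groupoid -/

/-- A directed graph of groups. `V` is the vertex set and `E` is the set of edges of the
orientation; the underlying undirected graph has, besides each `e`, its reversal `ē`, with range
`s e` and source `r e`. The edge groups are `Ge e = G_e = G_ē`, and `α e = α_e : G_e → G_{r(e)}`,
`αbar e = α_ē : G_e → G_{s(e)} = G_{r(ē)}`. -/
structure DirGraphOfGroups (V E : Type*) where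
  r : E → V
  s : E → V
  G : V → Type*
  [group : ∀ v, Group (G v)]
  Ge : E → Type*
  [groupE : ∀ e, Group (Ge e)]
  α : ∀ e, Ge e →* G (r e)
  αbar : ∀ e, Ge e →* G (s e)
  α_injective : ∀ e, Function.Injective (α e)
  αbar_injective : ∀ e, Function.Injective (αbar e)

namespace DirGraphOfGroups

variable {V E : Type*} (𝒢 : DirGraphOfGroups V E)

instance (v : V) : Group (𝒢.G v) := 𝒢.group v

instance (e : E) : Group (𝒢.Ge e) := 𝒢.groupE e

/-- Countability of the graph and of the vertex groups. -/
def IsCountable : Prop := Countable V ∧ Countable E ∧ ∀ v, Countable (𝒢.G v)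

/-- Each vertex receives finitely many edges of the orientation. -/
def RowFinite : Prop := ∀ v, {e : E | 𝒢.r e = v}.Finite

/-- Each vertex receives some edge of the orientation. -/
def NoSources : Prop := ∀ v, ∃ e, 𝒢.r e = v

/-- The generators of the fundamental groupoid: all edges (`e` and `ē`) and all elements of vertex
groups, with range first and source second. -/
inductive Gen : V → V → Type _
  | edge (e : E) : Gen (𝒢.r e) (𝒢.s e)
  | rev (e : E) : Gen (𝒢.s e) (𝒢.r e)
  | grp {v : V} (g : 𝒢.G v) : Gen v v

/-- The quiver of generators. -/
def GenQuiver (_𝒢 : DirGraphOfGroups V E) : Type _ := V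

instance : Quiver 𝒢.GenQuiver := ⟨𝒢.Gen⟩

/-- A generator as a morphism of the free groupoid on the generators. -/
def free {v w : V} (a : 𝒢.Gen v w) :
    (Quiver.FreeGroupoid.of 𝒢.GenQuiver).obj v ⟶ (Quiver.FreeGroupoid.of 𝒢.GenQuiver).obj w :=
  (Quiver.FreeGroupoid.of 𝒢.GenQuiver).map a

/-- The defining relations: those of the vertex groups, `ē = e⁻¹`, and `α_a(g) a = a α_ā(g)` for
all edges `a = e` and `a = ē`. -/
inductive Rel : HomRel (Quiver.FreeGroupoid 𝒢.GenQuiver)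
  | mul {v : V} (g h : 𝒢.G v) :
      Rel (𝒢.free (.grp g) ≫ 𝒢.free (.grp h)) (𝒢.free (.grp (g * h)))
  | rev (e : E) : Rel (𝒢.free (.rev e)) (Groupoid.inv (𝒢.free (.edge e)))
  | edge (e : E) (g : 𝒢.Ge e) :
      Rel (𝒢.free (.grp (𝒢.α e g)) ≫ 𝒢.free (.edge e))
        (𝒢.free (.edge e) ≫ 𝒢.free (.grp (𝒢.αbar e g)))
  | edge_rev (e : E) (g : 𝒢.Ge e) :
      Rel (𝒢.free (.grp (𝒢.αbar e g)) ≫ 𝒢.free (.rev e))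
        (𝒢.free (.rev e) ≫ 𝒢.free (.grp (𝒢.α e g)))

/-- The fundamental groupoid `F(𝒢)`. -/
abbrev FundGpd := CategoryTheory.Quotient 𝒢.Rel

/-- A vertex as a unit of `F(𝒢)`. -/
def vtx (v : V) : 𝒢.FundGpd := ⟨(Quiver.FreeGroupoid.of 𝒢.GenQuiver).obj v⟩

variable {𝒢} in
/-- A unit of `F(𝒢)` as a vertex. -/
def base (x : 𝒢.FundGpd) : V := x.as.as

/-- A generator as an element of `F(𝒢)`. -/
def gen {v w : V} (a : 𝒢.Gen v w) : 𝒢.vtx v ⟶ 𝒢.vtx w :=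
  (CategoryTheory.Quotient.functor 𝒢.Rel).map (𝒢.free a)

/-- An edge `e` as an element of `F(𝒢)`. -/
def edge (e : E) : 𝒢.vtx (𝒢.r e) ⟶ 𝒢.vtx (𝒢.s e) := 𝒢.gen (.edge e)

/-- An element of a vertex group as an element of `F(𝒢)`. -/
def grp {v : V} (g : 𝒢.G v) : 𝒢.vtx v ⟶ 𝒢.vtx v := 𝒢.gen (.grp g)

theorem grp_mul {v : V} (g h : 𝒢.G v) : 𝒢.grp g ≫ 𝒢.grp h = 𝒢.grp (g * h) :=
  CategoryTheory.Quotient.sound _ (Rel.mul g h)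

theorem grp_one (v : V) : 𝒢.grp (1 : 𝒢.G v) = 𝟙 (𝒢.vtx v) := by
  have h := 𝒢.grp_mul (1 : 𝒢.G v) 1
  rw [mul_one] at h
  have h2 : 𝒢.grp (1 : 𝒢.G v) ≫ 𝒢.grp (1 : 𝒢.G v) = 𝒢.grp (1 : 𝒢.G v) ≫ 𝟙 _ := by
    rw [h, Category.comp_id]
  exact (cancel_epi _).1 h2

theorem grp_mul_assoc {v : V} {y : 𝒢.FundGpd} (g h : 𝒢.G v) (f : 𝒢.vtx v ⟶ y) :
    𝒢.grp g ≫ 𝒢.grp h ≫ f = 𝒢.grp (g * h) ≫ f := by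
  rw [← Category.assoc, grp_mul]

/-! ### The word category -/

/-- The elements of `F(𝒢)` that are represented by a word `g₁ e₁ g₂ e₂ … gₙ eₙ gₙ₊₁` all of whose
edges belong to the orientation. -/
inductive IsWord : ∀ {x y : 𝒢.FundGpd}, (x ⟶ y) → Prop
  | grp {v : V} (g : 𝒢.G v) : IsWord (𝒢.grp g)
  | cons (e : E) (g : 𝒢.G (𝒢.r e)) {y : 𝒢.FundGpd} {f : 𝒢.vtx (𝒢.s e) ⟶ y} :
      IsWord f → IsWord (𝒢.grp g ≫ 𝒢.edge e ≫ f)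

variable {𝒢} in
theorem IsWord.grp_comp {v : V} (g : 𝒢.G v) {x y : 𝒢.FundGpd} {f : x ⟶ y} (hf : 𝒢.IsWord f)
    (h : x = 𝒢.vtx v) : 𝒢.IsWord (𝒢.grp g ≫ eqToHom h.symm ≫ f) := by
  cases hf with
  | @grp w g' =>
    have : w = v := congrArg base h
    subst this
    rw [eqToHom_refl, Category.id_comp, grp_mul]
    exact .grp _
  | cons e g' hf' =>
    have : 𝒢.r e = v := congrArg base h
    subst this
    rw [eqToHom_refl, Category.id_comp, grp_mul_assoc]
    exact .cons _ _ hf'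

variable {𝒢} in
theorem IsWord.comp {x y z : 𝒢.FundGpd} {f : x ⟶ y} {g : y ⟶ z} (hf : 𝒢.IsWord f)
    (hg : 𝒢.IsWord g) : 𝒢.IsWord (f ≫ g) := by
  induction hf with
  | grp h =>
    have := IsWord.grp_comp h hg rfl
    rwa [eqToHom_refl, Category.id_comp] at this
  | cons e h _ ih =>
    rw [Category.assoc, Category.assoc]
    exact .cons e h (ih hg)

/-- The word category: the subcategory of `F(𝒢)` of images of words in the orientation. -/
def WordCat (𝒢 : DirGraphOfGroups V E) : Type _ := 𝒢.FundGpd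

instance : Category 𝒢.WordCat where
  Hom x y := {f : @Quiver.Hom 𝒢.FundGpd _ x y // 𝒢.IsWord f}
  id x := ⟨@CategoryStruct.id 𝒢.FundGpd _ x, by
    have h := IsWord.grp (𝒢 := 𝒢) (v := base x) 1
    rw [grp_one] at h
    exact h⟩
  comp f g := ⟨f.1 ≫ g.1, f.2.comp g.2⟩
  id_comp f := Subtype.ext (Category.id_comp f.1)
  comp_id f := Subtype.ext (Category.comp_id f.1)
  assoc f g h := Subtype.ext (Category.assoc f.1 g.1 h.1)

theorem fund_cancel {x y z : 𝒢.FundGpd} (f : x ⟶ y) (g h : y ⟶ z) (hh : f ≫ g = f ≫ h) : g = h :=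
  (cancel_epi f).1 hh

instance : LeftCancellative 𝒢.WordCat where
  cancel f g h hh := Subtype.ext (𝒢.fund_cancel f.1 g.1 h.1 (congrArg Subtype.val hh))

/-- The element `λ μ⁻¹` of `F(𝒢)`, for words `λ`, `μ` with the same source. -/
def quot {x y z : 𝒢.WordCat} (l : x ⟶ z) (m : y ⟶ z) : @Quiver.Hom 𝒢.FundGpd _ x y :=
  l.1 ≫ Groupoid.inv m.1

/-! ### The directed forest and its boundary -/

/-- `γ` and `γ'` define the same coset of `G_w`. -/
def cosetSetoid (x : 𝒢.FundGpd) (w : V) : Setoid (x ⟶ 𝒢.vtx w) where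
  r γ γ' := ∃ g : 𝒢.G w, γ' = γ ≫ 𝒢.grp g
  iseqv :=
    { refl := fun γ => ⟨1, by rw [grp_one, Category.comp_id]⟩
      symm := by
        rintro γ _ ⟨g, rfl⟩
        exact ⟨g⁻¹, by rw [Category.assoc, grp_mul, mul_inv_cancel, grp_one, Category.comp_id]⟩
      trans := by
        rintro γ _ _ ⟨g, rfl⟩ ⟨h, rfl⟩
        exact ⟨g * h, by rw [Category.assoc, grp_mul]⟩ }

/-- The vertices `γ G_w` of the forest, with `γ ∈ x F(𝒢) w`. -/
def Forest := Σ (x : 𝒢.FundGpd) (w : V), _root_.Quotient (𝒢.cosetSetoid x w)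

/-- The coset `γ G_w`. -/
def coset {x : 𝒢.FundGpd} {w : V} (γ : x ⟶ 𝒢.vtx w) : 𝒢.Forest :=
  ⟨x, w, Quotient.mk (𝒢.cosetSetoid x w) γ⟩

/-- `ForestEdge a b`: the directed forest has an edge with range `a` and source `b`, that is,
`a = γ G_{r(e)}` and `b = δ G_{s(e)}` with `γ⁻¹δ ∈ G_{r(e)} e G_{s(e)}` for some edge `e` of the
orientation. (There is at most one edge from one vertex to another.) -/
inductive ForestEdge : 𝒢.Forest → 𝒢.Forest → Prop
  | mk {x : 𝒢.FundGpd} (e : E) (γ : x ⟶ 𝒢.vtx (𝒢.r e)) (δ : x ⟶ 𝒢.vtx (𝒢.s e))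
      (g : 𝒢.G (𝒢.r e)) (h : 𝒢.G (𝒢.s e))
      (hγ : Groupoid.inv γ ≫ δ = 𝒢.grp g ≫ 𝒢.edge e ≫ 𝒢.grp h) :
      ForestEdge (𝒢.coset γ) (𝒢.coset δ)

/-- Infinite paths `e₁e₂…` in the directed forest (`s(eᵢ) = r(eᵢ₊₁)`), as the sequences of vertices
`r(e₁), r(e₂), …`. -/
def ForestPath := {x : ℕ → 𝒢.Forest // ∀ n, 𝒢.ForestEdge (x n) (x (n + 1))}

/-- Shift-tail equivalence. -/
def shiftTail : Setoid 𝒢.ForestPath where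
  r x y := ∃ N M : ℕ, ∀ i, x.1 (N + i) = y.1 (M + i)
  iseqv :=
    { refl := fun x => ⟨0, 0, fun _ => rfl⟩
      symm := fun ⟨N, M, h⟩ => ⟨M, N, fun i => (h i).symm⟩
      trans := by
        rintro x y z ⟨N, M, h⟩ ⟨N', M', h'⟩
        refine ⟨N + N', M' + M, fun i => ?_⟩
        rw [Nat.add_assoc, h, Nat.add_assoc, ← h', Nat.add_left_comm] }

/-- The boundary of the directed forest. -/
def Boundary := _root_.Quotient 𝒢.shiftTail

/-- The point of the boundary that is represented by an infinite path. -/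
def ForestPath.toClass {𝒢 : DirGraphOfGroups V E} (x : 𝒢.ForestPath) : 𝒢.Boundary :=
  Quotient.mk 𝒢.shiftTail x

/-- `Z(u)`: the classes of the infinite paths with range `u`. -/
def cyl (u : 𝒢.Forest) : Set 𝒢.Boundary := {ξ | ∃ x : 𝒢.ForestPath, x.1 0 = u ∧ x.toClass = ξ}

/-- The topology generated by the sets `Z(u)` and their differences (equivalently, by the finite
unions, intersections and differences of these sets). -/
instance : TopologicalSpace 𝒢.Boundary :=
  TopologicalSpace.generateFrom
    ({T | ∃ u, T = 𝒢.cyl u} ∪ {T | ∃ u w, T = 𝒢.cyl u \ 𝒢.cyl w})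

/-! ### The action of the fundamental groupoid on the boundary -/

/-- `γ · γ'G_w = γγ'G_w`. -/
def forestAct {a b : 𝒢.FundGpd} (γ : a ⟶ b) (u : 𝒢.Forest) (h : u.1 = b) : 𝒢.Forest :=
  ⟨a, u.2.1, Quotient.map (sa := 𝒢.cosetSetoid u.1 u.2.1) (sb := 𝒢.cosetSetoid a u.2.1)
    (fun γ' => γ ≫ eqToHom h.symm ≫ γ')
    (by rintro γ' _ ⟨g, rfl⟩; exact ⟨g, by simp only [Category.assoc]⟩) u.2.2⟩

theorem forestAct_coset {a b : 𝒢.FundGpd} (γ : a ⟶ b) {w : V} (γ' : b ⟶ 𝒢.vtx w) :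
    𝒢.forestAct γ (𝒢.coset γ') rfl = 𝒢.coset (γ ≫ γ') := by
  change 𝒢.coset (γ ≫ eqToHom rfl ≫ γ') = _
  rw [eqToHom_refl, Category.id_comp]

theorem forest_ind {b : 𝒢.FundGpd} {P : ∀ u : 𝒢.Forest, u.1 = b → Prop}
    (h : ∀ (w : V) (γ' : b ⟶ 𝒢.vtx w), P (𝒢.coset γ') rfl) (u : 𝒢.Forest) (hu : u.1 = b) :
    P u hu := by
  obtain ⟨x, w, q⟩ := u
  obtain rfl : x = b := hu
  induction q using Quotient.ind with | _ γ' => exact h w γ'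

theorem forestAct_comp {a b c : 𝒢.FundGpd} (γ : a ⟶ b) (δ : b ⟶ c) (u : 𝒢.Forest) (h : u.1 = c) :
    𝒢.forestAct (γ ≫ δ) u h = 𝒢.forestAct γ (𝒢.forestAct δ u h) rfl := by
  induction u, h using 𝒢.forest_ind with | h w γ' => ?_
  simp only [forestAct_coset, Category.assoc]

theorem forestAct_id {a : 𝒢.FundGpd} (u : 𝒢.Forest) (h : u.1 = a) :
    𝒢.forestAct (𝟙 a) u h = u := by
  induction u, h using 𝒢.forest_ind with | h w γ' => ?_
  rw [forestAct_coset, Category.id_comp]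

variable {𝒢} in
theorem ForestEdge.fst_eq {u u' : 𝒢.Forest} (h : 𝒢.ForestEdge u u') : u'.1 = u.1 := by
  cases h; rfl

variable {𝒢} in
theorem ForestEdge.act {a b : 𝒢.FundGpd} (γ : a ⟶ b) {u u' : 𝒢.Forest} (h : 𝒢.ForestEdge u u')
    (hu : u.1 = b) (hu' : u'.1 = b) :
    𝒢.ForestEdge (𝒢.forestAct γ u hu) (𝒢.forestAct γ u' hu') := by
  cases h with
  | @mk x e γ₁ γ₂ g k hγ =>
    obtain rfl : x = b := hu
    rw [forestAct_coset, forestAct_coset]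
    refine .mk e _ _ g k ?_
    rw [← hγ]
    simp

/-- The range of a path determines the component of the forest that contains it. -/
theorem ForestPath.fst_eq {𝒢 : DirGraphOfGroups V E} (x : 𝒢.ForestPath) (n : ℕ) :
    (x.1 n).1 = (x.1 0).1 := by
  induction n with
  | zero => rfl
  | succ n ih => rw [(x.2 n).fst_eq, ih]

/-- The action on infinite paths. -/
def pathAct {a b : 𝒢.FundGpd} (γ : a ⟶ b) (x : 𝒢.ForestPath) (h : (x.1 0).1 = b) : 𝒢.ForestPath :=
  ⟨fun n => 𝒢.forestAct γ (x.1 n) ((x.fst_eq n).trans h), fun n => (x.2 n).act γ _ _⟩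

/-- The anchor map of the boundary. -/
def anchor : 𝒢.Boundary → 𝒢.FundGpd :=
  Quotient.lift (fun x : 𝒢.ForestPath => (x.1 0).1) (by
    rintro x y ⟨N, M, h⟩
    have := congrArg Sigma.fst (h 0)
    rwa [x.fst_eq, y.fst_eq] at this)

theorem forestAct_congr {a b : 𝒢.FundGpd} (γ : a ⟶ b) {u u' : 𝒢.Forest} (h : u = u')
    (hu : u.1 = b) : 𝒢.forestAct γ u hu = 𝒢.forestAct γ u' (h ▸ hu) := by
  subst h; rfl

/-- The action on the boundary: `γ · [x] = [γ · x]`. -/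
def bdAct {a b : 𝒢.FundGpd} (γ : a ⟶ b) (ξ : 𝒢.Boundary) : 𝒢.anchor ξ = b → 𝒢.Boundary :=
  Quotient.hrecOn (motive := fun ξ => 𝒢.anchor ξ = b → 𝒢.Boundary) ξ
    (fun x h => (𝒢.pathAct γ x h).toClass) (by
      intro x y hxy
      apply Function.hfunext
      · rw [show (Quotient.mk 𝒢.shiftTail x) = Quotient.mk 𝒢.shiftTail y from Quotient.sound hxy]
      · intro h h' _
        obtain ⟨N, M, hNM⟩ := hxy
        exact heq_of_eq (Quotient.sound ⟨N, M, fun i => 𝒢.forestAct_congr γ (hNM i) ((x.fst_eq _).trans h)⟩))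

theorem bdAct_class {a b : 𝒢.FundGpd} (γ : a ⟶ b) (x : 𝒢.ForestPath) (h : (x.1 0).1 = b) :
    𝒢.bdAct γ x.toClass h = (𝒢.pathAct γ x h).toClass := rfl

theorem anchor_bdAct {a b : 𝒢.FundGpd} (γ : a ⟶ b) (ξ : 𝒢.Boundary) (h : 𝒢.anchor ξ = b) :
    𝒢.anchor (𝒢.bdAct γ ξ h) = a := by
  induction ξ using Quotient.ind with | _ x => rfl

theorem bdAct_comp {a b c : 𝒢.FundGpd} (γ : a ⟶ b) (δ : b ⟶ c) (ξ : 𝒢.Boundary)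
    (h : 𝒢.anchor ξ = c) :
    𝒢.bdAct (γ ≫ δ) ξ h = 𝒢.bdAct γ (𝒢.bdAct δ ξ h) (𝒢.anchor_bdAct δ ξ h) := by
  induction ξ using Quotient.ind with | _ x => ?_
  exact congrArg ForestPath.toClass (Subtype.ext (funext fun n => 𝒢.forestAct_comp γ δ (x.1 n) ((x.fst_eq n).trans h)))

theorem bdAct_id {a : 𝒢.FundGpd} (ξ : 𝒢.Boundary) (h : 𝒢.anchor ξ = a) :
    𝒢.bdAct (𝟙 a) ξ h = ξ := by
  induction ξ using Quotient.ind with | _ x => ?_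
  exact congrArg ForestPath.toClass (Subtype.ext (funext fun n => 𝒢.forestAct_id (x.1 n) ((x.fst_eq n).trans h)))

theorem bdAct_congr {a b : 𝒢.FundGpd} {γ γ' : a ⟶ b} (hγ : γ = γ') (ξ : 𝒢.Boundary)
    (h : 𝒢.anchor ξ = b) : 𝒢.bdAct γ ξ h = 𝒢.bdAct γ' ξ h := by
  rw [hγ]

theorem bdAct_inv_bdAct {a b : 𝒢.FundGpd} (γ : a ⟶ b) (ξ : 𝒢.Boundary) (h : 𝒢.anchor ξ = b) :
    𝒢.bdAct (Groupoid.inv γ) (𝒢.bdAct γ ξ h) (𝒢.anchor_bdAct γ ξ h) = ξ := by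
  rw [← bdAct_comp, 𝒢.bdAct_congr (Groupoid.inv_comp γ), bdAct_id]

theorem bdAct_bdAct_inv {a b : 𝒢.FundGpd} (γ : a ⟶ b) (ξ : 𝒢.Boundary) (h : 𝒢.anchor ξ = a) :
    𝒢.bdAct γ (𝒢.bdAct (Groupoid.inv γ) ξ h) (𝒢.anchor_bdAct _ ξ h) = ξ := by
  rw [← bdAct_comp, 𝒢.bdAct_congr (Groupoid.comp_inv γ), bdAct_id]

theorem bdAct_mem_cyl {a b : 𝒢.FundGpd} (γ : a ⟶ b) {ξ : 𝒢.Boundary} (h : 𝒢.anchor ξ = b)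
    {u : 𝒢.Forest} (hu : u.1 = b) (hξ : ξ ∈ 𝒢.cyl u) : 𝒢.bdAct γ ξ h ∈ 𝒢.cyl (𝒢.forestAct γ u hu) := by
  obtain ⟨x, hx, rfl⟩ := hξ
  exact ⟨𝒢.pathAct γ x h, 𝒢.forestAct_congr γ hx h, rfl⟩

theorem anchor_of_mem_cyl {ξ : 𝒢.Boundary} {u : 𝒢.Forest} (hξ : ξ ∈ 𝒢.cyl u) :
    𝒢.anchor ξ = u.1 := by
  obtain ⟨x, hx, rfl⟩ := hξ
  exact congrArg Sigma.fst hx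

/-- The preimages of the sets `Z(u)` under the action of `γ` are of the same kind, or empty. -/
theorem preimage_cyl {a b : 𝒢.FundGpd} (γ : a ⟶ b) (u : 𝒢.Forest) :
    (∃ u', ∀ ξ h, 𝒢.bdAct γ ξ h ∈ 𝒢.cyl u ↔ ξ ∈ 𝒢.cyl u') ∨
      ∀ ξ h, 𝒢.bdAct γ ξ h ∉ 𝒢.cyl u := by
  by_cases hu : u.1 = a
  · left
    refine ⟨𝒢.forestAct (Groupoid.inv γ) u hu, fun ξ h => ⟨fun hm => ?_, fun hm => ?_⟩⟩
    · have := 𝒢.bdAct_mem_cyl (Groupoid.inv γ) (𝒢.anchor_bdAct γ ξ h) hu hm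
      rwa [bdAct_inv_bdAct] at this
    · have := 𝒢.bdAct_mem_cyl γ h rfl hm
      rw [← forestAct_comp] at this
      have h2 : 𝒢.forestAct (γ ≫ Groupoid.inv γ) u hu = u := by
        rw [Groupoid.comp_inv, forestAct_id]
      rwa [h2] at this
  · right
    intro ξ h hm
    exact hu ((𝒢.anchor_of_mem_cyl hm).symm.trans (𝒢.anchor_bdAct γ ξ h))

theorem isOpen_cyl (u : 𝒢.Forest) : IsOpen (𝒢.cyl u) :=
  TopologicalSpace.isOpen_generateFrom_of_mem (Or.inl ⟨u, rfl⟩)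

theorem isOpen_cyl_diff (u u' : 𝒢.Forest) : IsOpen (𝒢.cyl u \ 𝒢.cyl u') :=
  TopologicalSpace.isOpen_generateFrom_of_mem (Or.inr ⟨u, u', rfl⟩)

theorem continuous_bdAct {a b : 𝒢.FundGpd} (γ : a ⟶ b) :
    Continuous fun ξ : {ξ : 𝒢.Boundary // 𝒢.anchor ξ = b} => 𝒢.bdAct γ ξ.1 ξ.2 := by
  rw [continuous_generateFrom_iff]
  rintro T (⟨u, rfl⟩ | ⟨u, u', rfl⟩)
  · obtain ⟨w, hw⟩ | hw := 𝒢.preimage_cyl γ u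
    · convert (𝒢.isOpen_cyl w).preimage continuous_subtype_val using 1
      ext ξ; exact hw _ _
    · convert isOpen_empty using 1
      ext ξ; exact iff_of_false (hw _ _) (fun h => h)
  · obtain ⟨w, hw⟩ | hw := 𝒢.preimage_cyl γ u
    · obtain ⟨w', hw'⟩ | hw' := 𝒢.preimage_cyl γ u'
      · convert (𝒢.isOpen_cyl_diff w w').preimage continuous_subtype_val using 1
        ext ξ; exact and_congr (hw _ _) (not_congr (hw' _ _))
      · convert (𝒢.isOpen_cyl w).preimage continuous_subtype_val using 1
        ext ξ; exact (and_iff_left (hw' _ _)).trans (hw _ _)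
    · convert isOpen_empty using 1
      ext ξ; exact iff_of_false (fun h => hw _ _ h.1) (fun h => h)

variable {𝒢} in
/-- If there are no sources, then an infinite path starts at every unit of `F(𝒢)`. -/
theorem anchor_surjective (hs : 𝒢.NoSources) : Function.Surjective 𝒢.anchor := by
  intro x
  have step : ∀ u : 𝒢.Forest, ∃ u', 𝒢.ForestEdge u u' := by
    intro u
    have : ∀ (y : 𝒢.FundGpd) (w : V) (γ : y ⟶ 𝒢.vtx w), ∃ u', 𝒢.ForestEdge (𝒢.coset γ) u' := by
      intro y w γ
      obtain ⟨e, rfl⟩ := hs w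
      exact ⟨_, .mk e γ (γ ≫ 𝒢.edge e) 1 1 (by simp [grp_one])⟩
    obtain ⟨y, w, q⟩ := u
    induction q using Quotient.ind with | _ γ => exact this y w γ
  choose f hf using step
  let y : ℕ → 𝒢.Forest := fun n => f^[n] (𝒢.coset (𝟙 (𝒢.vtx (base x))))
  refine ⟨ForestPath.toClass ⟨y, fun n => ?_⟩, rfl⟩
  change 𝒢.ForestEdge (f^[n] _) (f^[n + 1] _)
  rw [Function.iterate_succ_apply']
  exact hf _

/-- The action of `F(𝒢)` on the boundary of the directed forest. -/
def boundaryAction (hs : 𝒢.NoSources) : GroupoidAction 𝒢.FundGpd 𝒢.Boundary where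
  anchor := 𝒢.anchor
  anchor_surjective := anchor_surjective hs
  act γ :=
    { toFun := fun ξ => ⟨𝒢.bdAct γ ξ.1 ξ.2, 𝒢.anchor_bdAct γ ξ.1 ξ.2⟩
      invFun := fun ξ => ⟨𝒢.bdAct (Groupoid.inv γ) ξ.1 ξ.2, 𝒢.anchor_bdAct _ ξ.1 ξ.2⟩
      left_inv := fun ξ => Subtype.ext (𝒢.bdAct_inv_bdAct γ ξ.1 ξ.2)
      right_inv := fun ξ => Subtype.ext (𝒢.bdAct_bdAct_inv γ ξ.1 ξ.2)
      continuous_toFun := (𝒢.continuous_bdAct γ).subtype_mk _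
      continuous_invFun := (𝒢.continuous_bdAct (Groupoid.inv γ)).subtype_mk _ }
  act_inv γ := by
    apply Homeomorph.ext
    intro ξ
    rfl
  act_comp γ δ := by
    apply Homeomorph.ext
    intro ξ
    exact Subtype.ext (𝒢.bdAct_comp γ δ ξ.1 ξ.2)

/-! ### Transversals, the graph `E_Σ` and its infinite paths -/

/-- A set of transversals: `S e` is a transversal of `G_{r(e)} / α_e(G_e)` that contains the
identity, for each edge `e` of the orientation. -/
structure Transversals where
  S : ∀ e, Set (𝒢.G (𝒢.r e))
  one_mem : ∀ e, 1 ∈ S e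
  isComplement : ∀ e, Subgroup.IsComplement (S e) ((𝒢.α e).range : Set (𝒢.G (𝒢.r e)))

namespace Transversals

variable {𝒢} (T : 𝒢.Transversals)

/-- The edges `he` of `E_Σ`, with `h ∈ Σ_e`; the range is `r(e)` and the source is `s(e)`. -/
inductive EEdge : V → V → Type _
  | mk (e : E) (h : T.S e) : EEdge (𝒢.r e) (𝒢.s e)

/-- The vertex set of the directed graph `E_Σ`. -/
def EGraph (_T : 𝒢.Transversals) : Type _ := V

/-- `v ⟶ w` is the set of edges of `E_Σ` with range `v` and source `w`. -/
instance : Quiver T.EGraph := ⟨T.EEdge⟩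

/-- The finite paths in `E_Σ`, as triples (range, source, path); paths of length `0` are the
vertices. -/
abbrev FinPath := Σ v w : T.EGraph, Quiver.Path v w

/-- The infinite paths `a₀a₁…` in `E_Σ`, where `aₙ` has range `vert n` and source
`vert (n + 1)`. -/
structure InfPath where
  vert : ℕ → T.EGraph
  edge : ∀ n, vert n ⟶ vert (n + 1)

variable {T}

/-- The initial subpath of length `n`, with range `vert 0` and source `vert n`. -/
def InfPath.init (a : T.InfPath) : ∀ n, Quiver.Path (a.vert 0) (a.vert n)
  | 0 => .nil
  | n + 1 => (a.init n).cons (a.edge n)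

/-- `p ≤ a`: `p` is an initial subpath of `a`. -/
def InfPath.Extends (a : T.InfPath) (p : T.FinPath) : Prop :=
  ∃ n, p = ⟨a.vert 0, a.vert n, a.init n⟩

/-- The set `p E_Σ^∞` of infinite paths that extend `p`. -/
def infCyl (p : T.FinPath) : Set T.InfPath := {a | a.Extends p}

/-- The topology generated by the sets `p E_Σ^∞` and their differences (equivalently, by the finite
unions, intersections and differences of these sets). -/
instance : TopologicalSpace T.InfPath :=
  TopologicalSpace.generateFrom
    ({U | ∃ p : T.FinPath, U = infCyl p} ∪ {U | ∃ p p₂ : T.FinPath, U = infCyl p \ infCyl p₂})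

/-- The edge `he` as an element of `F(𝒢)`. -/
def evalEdge {v w : V} : T.EEdge v w → (𝒢.vtx v ⟶ 𝒢.vtx w)
  | .mk e h => 𝒢.grp h.1 ≫ 𝒢.edge e

/-- A finite path `h₁e₁…hₙeₙ` in `E_Σ` as an element of `F(𝒢)`. -/
def eval {v : T.EGraph} : ∀ {w : T.EGraph}, Quiver.Path v w → (𝒢.vtx v ⟶ 𝒢.vtx w)
  | _, .nil => 𝟙 _
  | _, .cons p a => eval p ≫ evalEdge a

/-- `q(μ) = p`: the `Σ`-normalised form of the word `μ` is `h₁e₁…hₙeₙg` with `p = h₁e₁…hₙeₙ`. -/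
inductive IsQ : ∀ {x y : 𝒢.FundGpd}, (x ⟶ y) → T.FinPath → Prop
  | mk {v w : T.EGraph} (p : Quiver.Path v w) (g : 𝒢.G w) : IsQ (eval p ≫ 𝒢.grp g) ⟨v, w, p⟩

/-- `q(μ) ≤ a`. -/
def QLe {x y : 𝒢.WordCat} (m : x ⟶ y) (a : T.InfPath) : Prop :=
  ∃ p : T.FinPath, IsQ m.1 p ∧ a.Extends p

theorem forestEdge_init (a : T.InfPath) (n : ℕ) :
    𝒢.ForestEdge (𝒢.coset (eval (a.init n))) (𝒢.coset (eval (a.init (n + 1)))) := by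
  have : ∀ {v w w' : T.EGraph} (p : Quiver.Path v w) (b : T.EEdge w w'),
      𝒢.ForestEdge (𝒢.coset (eval p)) (𝒢.coset (eval p ≫ evalEdge b)) := by
    intro v w w' p b
    cases b with
    | mk e h =>
      refine .mk e _ _ h.1 1 ?_
      simp [evalEdge, grp_one]
  exact this (a.init n) (a.edge n)

/-- The inclusion of `E_Σ^∞` in the boundary of the directed forest: the infinite word
`h₁e₁h₂e₂…` is identified with the class of the infinite path through the vertices `G_{r(e₁)}`,
`h₁e₁G_{s(e₁)}`, `h₁e₁h₂e₂G_{s(e₂)}`, …. -/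
def InfPath.toBoundary (a : T.InfPath) : 𝒢.Boundary :=
  ForestPath.toClass ⟨fun n => 𝒢.coset (eval (a.init n)), forestEdge_init a⟩

variable (T) in
/-- `E_Σ^∞` as a set of units of the transformation groupoid `F(𝒢) ⋉ ∂W`. -/
def pathUnits (hs : 𝒢.NoSources) : Set (𝒢.boundaryAction hs).Transformation :=
  {ξ | ∃ a : T.InfPath, ξ = a.toBoundary}

/-- `A` is the action of the left inverse hull of the word category on `E_Σ^∞` that is given by
`τ^λ σ^μ · a = λμ⁻¹ · a`, with domain `{a : q(μ) ≤ a}`. (All nonzero elements of the left inverse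
hull are of the form `τ^λ σ^μ`.) -/
def IsWordAction (hs : 𝒢.NoSources)
    (A : InvSemigroupAction (LeftInverseHull 𝒢.WordCat) T.InfPath) : Prop :=
  ∀ {x y z : 𝒢.WordCat} (l : x ⟶ z) (m : y ⟶ z) (a b : T.InfPath),
    A.φ (tauSigma l m) a = some b ↔
      QLe m a ∧ (𝒢.boundaryAction hs).ActsTo (𝒢.quot l m) a.toBoundary b.toBoundary

end Transversals

end DirGraphOfGroups

/-! Near a path `a` of `E_Σ^∞`, every element `f` of the left inverse hull acts by a single element
of `F(𝒢)`. Elements of the hull commute with right multiplication: if `f` maps a word `m` with `q(m)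
≤ a` to `l`, then it maps `mn` to `ln`, and `(ln)(mn)⁻¹ = lm⁻¹`. Two words whose paths are initial
subpaths of `a` are comparable for left divisibility, so `lm⁻¹` depends only on `f` and `a`
(`quot_unique`), and `f · a` can be defined as `lm⁻¹ · a`. The relation `GermRel` records this for
every `f` in the hull, without a presentation `f = τ^λ σ^μ`. It is compatible with products and
inverses, which yields both the action and the functor `[f, a] ↦ (lm⁻¹, a)`.

The functor is faithful: if `f` and `f'` act at `a` by the same element of `F(𝒢)`, they take the
same value on some word `k` with `q(k) ≤ a`, hence agree after multiplication by the idempotent `τ^k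
σ^k` (`mul_tauSigma`). It is full: if `g · a = b` with `a` and `b` in `E_Σ^∞`, then `b` lies in
`Z(gG_w)` for `w = s(g)`, which means that `gm = p` for some word `m` and some initial subpath `p`
of `b` (`InfPath.toBoundary_mem_cyl_iff`). So `g = pm⁻¹` is the value of `τ^p σ^m` at `a`.

Since `lm⁻¹` stays constant on the trace of `Z(m)`, the functor is a homeomorphism as soon as
`E_Σ^∞` has the subspace topology of the boundary (`isInducing_toBoundary`). The substantial point
is that the trace of any `Z(γG_w)` on `E_Σ^∞` is empty or one cylinder `pE_Σ^∞`
(`preimage_toBoundary_cyl`). A path lies in the trace exactly when one of its initial subpaths has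
the form `γm` with `m` a word, so a least such subpath is needed (`exists_least_path`).

That subpath is read off from a reduced form of `γ`. As in van der Waerden's proof of the normal
form theorem, `F(𝒢)` acts on reduced words; the letters before the first reversed edge in the image
of the empty word under `γ` form the least path. The same action shows that distinct paths of `E_Σ`
define distinct cosets (`eval_injective`). -/

/-! ### Normal forms in the fundamental groupoid -/

/-- A choice of representatives `rep g` of the cosets `g f(A)`, with `g = rep g * f (cor g)` and
with the representative `1` for the coset of `1`. -/
structure CosetSection {A G : Type*} [Group A] [Group G] (f : A →* G) where
  rep : G → G
  cor : G → A
  rep_mul_cor : ∀ g, rep g * f (cor g) = g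
  rep_mul : ∀ g a, rep (g * f a) = rep g
  rep_one : rep 1 = 1

namespace CosetSection

variable {A G : Type*} [Group A] [Group G] {f : A →* G} (σ : CosetSection f)

theorem rep_eq (g : G) : σ.rep g = g * f (σ.cor g)⁻¹ := by
  rw [map_inv, eq_mul_inv_iff_mul_eq, σ.rep_mul_cor]

theorem rep_rep (g : G) : σ.rep (σ.rep g) = σ.rep g := by
  rw [σ.rep_eq g, σ.rep_mul, σ.rep_eq g]

theorem rep_mul_rep (g h : G) : σ.rep (g * σ.rep h) = σ.rep (g * h) := by
  rw [σ.rep_eq h, ← mul_assoc, σ.rep_mul]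

theorem rep_map (a : A) : σ.rep (f a) = 1 := by
  have := σ.rep_mul 1 a
  rwa [one_mul, σ.rep_one] at this

theorem cor_mul (hf : Function.Injective f) (g : G) (a : A) :
    σ.cor (g * f a) = σ.cor g * a := by
  apply hf
  have h := σ.rep_mul_cor (g * f a)
  rw [σ.rep_mul] at h
  apply mul_left_cancel (a := σ.rep g)
  rw [h, map_mul, ← mul_assoc, σ.rep_mul_cor]

theorem cor_of_rep (hf : Function.Injective f) {g : G} (hg : σ.rep g = g) : σ.cor g = 1 := by
  apply hf
  have h := σ.rep_mul_cor g
  rw [hg] at h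
  rw [map_one]
  exact mul_eq_left.1 h

/-- Cocycle identity for the element carried past a coset representative; it makes `NF.smul`
multiplicative. -/
theorem cor_mul_rep (hf : Function.Injective f) (g h : G) :
    σ.cor (g * σ.rep h) * σ.cor h = σ.cor (g * h) := by
  rw [← σ.cor_mul hf, mul_assoc, σ.rep_mul_cor]

theorem cor_map (hf : Function.Injective f) (a : A) : σ.cor (f a) = a := by
  have := σ.cor_mul hf 1 a
  rwa [one_mul, σ.cor_of_rep hf σ.rep_one, one_mul] at this

/-- The section given by a transversal that contains the identity. -/
theorem exists_of_isComplement (f : A →* G) {S : Set G} (h1 : 1 ∈ S)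
    (hS : Subgroup.IsComplement S (f.range : Set G)) :
    ∃ σ : CosetSection f, ∀ g ∈ S, σ.rep g = g := by
  have hc : ∀ g, ∃ a, f a = (hS.equiv g).2 := fun g => (hS.equiv g).2.2
  choose cor hcor using hc
  refine ⟨⟨fun g => (hS.equiv g).1, cor, fun g => ?_, fun g a => ?_, ?_⟩, fun g hg => ?_⟩
  · rw [hcor, hS.equiv_fst_mul_equiv_snd]
  · rw [hS.equiv_mul_right_of_mem (k := f a) ⟨a, rfl⟩]
  · exact congrArg Subtype.val (hS.equiv_fst_eq_self_of_mem_of_one_mem f.range.one_mem h1)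
  · exact congrArg Subtype.val (hS.equiv_fst_eq_self_of_mem_of_one_mem f.range.one_mem hg)

end CosetSection

/-! ### Reduced words and left multiplication on them -/

namespace DirGraphOfGroups

variable {V E : Type*} (𝒢 : DirGraphOfGroups V E)

/-- Representatives of the cosets of the edge groups, for both directions of each edge. -/
structure Sections where
  pos : ∀ e, CosetSection (𝒢.α e)
  neg : ∀ e, CosetSection (𝒢.αbar e)

/-- Only the representatives at the edges of the orientation are prescribed, by `T`. Those at
reversed edges do not enter `E_Σ` and are chosen arbitrarily, subject to containing `1`. -/
theorem Transversals.exists_sections {𝒢 : DirGraphOfGroups V E} (T : 𝒢.Transversals) :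
    ∃ σ : 𝒢.Sections, ∀ e, ∀ h ∈ T.S e, (σ.pos e).rep h = h := by
  choose p hp using fun e =>
    CosetSection.exists_of_isComplement (𝒢.α e) (T.one_mem e) (T.isComplement e)
  have hn : ∀ e, Nonempty (CosetSection (𝒢.αbar e)) := fun e => by
    obtain ⟨S, hS, h1⟩ := Subgroup.exists_isComplement_left (𝒢.αbar e).range 1
    exact ⟨(CosetSection.exists_of_isComplement _ h1 hS).choose⟩
  exact ⟨⟨p, fun e => (hn e).some⟩, hp⟩

/-- Words `h₁ d₁ h₂ d₂ … hₙ dₙ` with range `v`, where the `dᵢ` are edges or reversed edges. -/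
inductive NF : V → Type _
  | nil (v : V) : NF v
  | pos (e : E) (h : 𝒢.G (𝒢.r e)) (x : NF (𝒢.s e)) : NF (𝒢.r e)
  | neg (e : E) (h : 𝒢.G (𝒢.s e)) (x : NF (𝒢.r e)) : NF (𝒢.s e)

variable {𝒢}

namespace NF

variable (σ : 𝒢.Sections)

/-- Left multiplication by an element of a vertex group, modulo the group at the end. -/
def smul {v : V} (g : 𝒢.G v) (x : 𝒢.NF v) : 𝒢.NF v :=
  match x, g with
  | nil v, _ => nil v
  | pos e h x, g =>
    pos e ((σ.pos e).rep (g * h)) (smul (𝒢.αbar e ((σ.pos e).cor (g * h))) x)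
  | neg e h x, g =>
    neg e ((σ.neg e).rep (g * h)) (smul (𝒢.α e ((σ.neg e).cor (g * h))) x)

theorem smul_nil {v : V} (g : 𝒢.G v) : smul σ g (nil v) = nil v := by
  rw [smul]

theorem smul_pos (e : E) (g h : 𝒢.G (𝒢.r e)) (x : 𝒢.NF (𝒢.s e)) : smul σ g (pos e h x) =
    pos e ((σ.pos e).rep (g * h)) (smul σ (𝒢.αbar e ((σ.pos e).cor (g * h))) x) := by
  rw [smul]

theorem smul_neg (e : E) (g h : 𝒢.G (𝒢.s e)) (x : 𝒢.NF (𝒢.r e)) : smul σ g (neg e h x) =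
    neg e ((σ.neg e).rep (g * h)) (smul σ (𝒢.α e ((σ.neg e).cor (g * h))) x) := by
  rw [smul]

theorem smul_smul {v : V} (g g' : 𝒢.G v) (x : 𝒢.NF v) :
    smul σ g (smul σ g' x) = smul σ (g * g') x := by
  induction x with
  | nil => simp only [smul_nil]
  | pos e h x ih =>
    simp only [smul_pos, ih, CosetSection.rep_mul_rep, ← map_mul,
      CosetSection.cor_mul_rep _ (𝒢.α_injective e), mul_assoc]
  | neg e h x ih =>
    simp only [smul_neg, ih, CosetSection.rep_mul_rep, ← map_mul,
      CosetSection.cor_mul_rep _ (𝒢.αbar_injective e), mul_assoc]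

/-- The normalised and reduced words. -/
def Reduced : ∀ {v : V}, 𝒢.NF v → Prop
  | _, nil _ => True
  | _, pos e h x => (σ.pos e).rep h = h ∧ Reduced x ∧ ∀ y, x ≠ neg e 1 y
  | _, neg e h x => (σ.neg e).rep h = h ∧ Reduced x ∧ ∀ y, x ≠ pos e 1 y

theorem reduced_nil (v : V) : Reduced σ (nil v : 𝒢.NF v) := by rw [Reduced]; trivial

theorem reduced_pos (e : E) (h : 𝒢.G (𝒢.r e)) (x : 𝒢.NF (𝒢.s e)) : Reduced σ (pos e h x) ↔
    (σ.pos e).rep h = h ∧ Reduced σ x ∧ ∀ y, x ≠ neg e 1 y := by rw [Reduced]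

theorem reduced_neg (e : E) (h : 𝒢.G (𝒢.s e)) (x : 𝒢.NF (𝒢.r e)) : Reduced σ (neg e h x) ↔
    (σ.neg e).rep h = h ∧ Reduced σ x ∧ ∀ y, x ≠ pos e 1 y := by rw [Reduced]

variable {σ}

/-- Normalised letters are their own representatives, so nothing is carried to the next letter. -/
theorem one_smul {v : V} {x : 𝒢.NF v} (hx : Reduced σ x) : smul σ 1 x = x := by
  induction x with
  | nil => rw [smul_nil]
  | pos e h x ih =>
    rw [reduced_pos] at hx
    rw [smul_pos, one_mul, CosetSection.cor_of_rep _ (𝒢.α_injective e) hx.1, hx.1, map_one,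
      ih hx.2.1]
  | neg e h x ih =>
    rw [reduced_neg] at hx
    rw [smul_neg, one_mul, CosetSection.cor_of_rep _ (𝒢.αbar_injective e) hx.1, hx.1, map_one,
      ih hx.2.1]

theorem smul_αbar_neg (e : E) (k : 𝒢.Ge e) (y : 𝒢.NF (𝒢.r e)) :
    smul σ (𝒢.αbar e k) (neg e 1 y) = neg e 1 (smul σ (𝒢.α e k) y) := by
  rw [smul_neg, mul_one, CosetSection.rep_map, CosetSection.cor_map _ (𝒢.αbar_injective e)]

theorem smul_α_pos (e : E) (k : 𝒢.Ge e) (y : 𝒢.NF (𝒢.s e)) :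
    smul σ (𝒢.α e k) (pos e 1 y) = pos e 1 (smul σ (𝒢.αbar e k) y) := by
  rw [smul_pos, mul_one, CosetSection.rep_map, CosetSection.cor_map _ (𝒢.α_injective e)]

/-- The image of the edge group permutes the words that start with `1ē`, so if `k` produced such a
word, applying `k⁻¹` would show that `x` already was one. Hence carrying group elements to the right
creates no cancellation. -/
theorem smul_αbar_ne_neg {e : E} (k : 𝒢.Ge e) {x : 𝒢.NF (𝒢.s e)} (hx : Reduced σ x)
    (h : ∀ y, x ≠ neg e 1 y) (y : 𝒢.NF (𝒢.r e)) : smul σ (𝒢.αbar e k) x ≠ neg e 1 y := by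
  intro hy
  apply h (smul σ (𝒢.α e k⁻¹) y)
  rw [← smul_αbar_neg, ← hy, smul_smul, ← map_mul, inv_mul_cancel, map_one, one_smul hx]

theorem smul_α_ne_pos {e : E} (k : 𝒢.Ge e) {x : 𝒢.NF (𝒢.r e)} (hx : Reduced σ x)
    (h : ∀ y, x ≠ pos e 1 y) (y : 𝒢.NF (𝒢.s e)) : smul σ (𝒢.α e k) x ≠ pos e 1 y := by
  intro hy
  apply h (smul σ (𝒢.αbar e k⁻¹) y)
  rw [← smul_α_pos, ← hy, smul_smul, ← map_mul, inv_mul_cancel, map_one, one_smul hx]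

theorem Reduced.smul {v : V} (g : 𝒢.G v) {x : 𝒢.NF v} (hx : Reduced σ x) :
    Reduced σ (smul σ g x) := by
  induction x with
  | nil => rw [smul_nil]; exact hx
  | pos e h x ih =>
    rw [reduced_pos] at hx
    rw [smul_pos, reduced_pos]
    exact ⟨CosetSection.rep_rep _ _, ih _ hx.2.1, smul_αbar_ne_neg _ hx.2.1 hx.2.2⟩
  | neg e h x ih =>
    rw [reduced_neg] at hx
    rw [smul_neg, reduced_neg]
    exact ⟨CosetSection.rep_rep _ _, ih _ hx.2.1, smul_α_ne_pos _ hx.2.1 hx.2.2⟩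

open Classical in
/-- Left multiplication by `e`. -/
noncomputable def mulEdge (e : E) (x : 𝒢.NF (𝒢.s e)) : 𝒢.NF (𝒢.r e) :=
  if h : ∃ y, x = neg e 1 y then h.choose else pos e 1 x

open Classical in
/-- Left multiplication by the reversal of `e`. -/
noncomputable def mulRev (e : E) (x : 𝒢.NF (𝒢.r e)) : 𝒢.NF (𝒢.s e) :=
  if h : ∃ y, x = pos e 1 y then h.choose else neg e 1 x

theorem mulEdge_neg (e : E) (y : 𝒢.NF (𝒢.r e)) : mulEdge e (neg e 1 y) = y := by
  have h : ∃ z : 𝒢.NF (𝒢.r e), neg e 1 y = neg e 1 z := ⟨y, rfl⟩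
  rw [mulEdge, dif_pos h]
  have := h.choose_spec
  injection this with _ _ h3
  exact h3.symm

theorem mulRev_pos (e : E) (y : 𝒢.NF (𝒢.s e)) : mulRev e (pos e 1 y) = y := by
  have h : ∃ z : 𝒢.NF (𝒢.s e), pos e 1 y = pos e 1 z := ⟨y, rfl⟩
  rw [mulRev, dif_pos h]
  have := h.choose_spec
  injection this with _ _ h3
  exact h3.symm

theorem mulEdge_of_ne {e : E} {x : 𝒢.NF (𝒢.s e)} (h : ∀ y, x ≠ neg e 1 y) :
    mulEdge e x = pos e 1 x :=
  dif_neg (not_exists.2 h)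

theorem mulRev_of_ne {e : E} {x : 𝒢.NF (𝒢.r e)} (h : ∀ y, x ≠ pos e 1 y) :
    mulRev e x = neg e 1 x :=
  dif_neg (not_exists.2 h)

theorem Reduced.mulEdge {e : E} {x : 𝒢.NF (𝒢.s e)} (hx : Reduced σ x) :
    Reduced σ (mulEdge e x) := by
  by_cases h : ∃ y, x = neg e 1 y
  · obtain ⟨y, rfl⟩ := h
    rw [mulEdge_neg]
    exact ((reduced_neg _ _ _ _).1 hx).2.1
  · push Not at h
    rw [mulEdge_of_ne h, reduced_pos]
    exact ⟨CosetSection.rep_one _, hx, h⟩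

theorem Reduced.mulRev {e : E} {x : 𝒢.NF (𝒢.r e)} (hx : Reduced σ x) :
    Reduced σ (mulRev e x) := by
  by_cases h : ∃ y, x = pos e 1 y
  · obtain ⟨y, rfl⟩ := h
    rw [mulRev_pos]
    exact ((reduced_pos _ _ _ _).1 hx).2.1
  · push Not at h
    rw [mulRev_of_ne h, reduced_neg]
    exact ⟨CosetSection.rep_one _, hx, h⟩

/-- This needs reducedness: if `e` cancels the start of `1ē y`, then `y` does not start with `1e`,
so that multiplication by `ē` restores the cancelled letter instead of cancelling further. -/
theorem mulRev_mulEdge {e : E} {x : 𝒢.NF (𝒢.s e)} (hx : Reduced σ x) :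
    NF.mulRev e (NF.mulEdge e x) = x := by
  by_cases h : ∃ y, x = neg e 1 y
  · obtain ⟨y, rfl⟩ := h
    rw [mulEdge_neg, mulRev_of_ne ((reduced_neg _ _ _ _).1 hx).2.2]
  · push Not at h
    rw [mulEdge_of_ne h, mulRev_pos]

theorem mulEdge_mulRev {e : E} {x : 𝒢.NF (𝒢.r e)} (hx : Reduced σ x) :
    NF.mulEdge e (NF.mulRev e x) = x := by
  by_cases h : ∃ y, x = pos e 1 y
  · obtain ⟨y, rfl⟩ := h
    rw [mulRev_pos, mulEdge_of_ne ((reduced_pos _ _ _ _).1 hx).2.2]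
  · push Not at h
    rw [mulRev_of_ne h, mulEdge_neg]

/-- The defining relation `α_e(k) e = e α_ē(k)`, as an identity of maps on reduced words. -/
theorem smul_mulEdge {e : E} (k : 𝒢.Ge e) {x : 𝒢.NF (𝒢.s e)} (hx : Reduced σ x) :
    NF.smul σ (𝒢.α e k) (NF.mulEdge e x) = NF.mulEdge e (NF.smul σ (𝒢.αbar e k) x) := by
  by_cases h : ∃ y, x = neg e 1 y
  · obtain ⟨y, rfl⟩ := h
    rw [mulEdge_neg, smul_αbar_neg, mulEdge_neg]
  · push Not at h
    rw [mulEdge_of_ne h, smul_α_pos, mulEdge_of_ne (smul_αbar_ne_neg k hx h)]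

end NF

/-- The reduced words with range `v`. -/
abbrev RedNF (σ : 𝒢.Sections) (v : V) : Type _ := {x : 𝒢.NF v // NF.Reduced σ x}

/-- The groupoid of the bijections between the sets of reduced words. -/
def RedGpd (_σ : 𝒢.Sections) : Type _ := V

instance (σ : 𝒢.Sections) : Groupoid (RedGpd σ) where
  Hom v w := RedNF σ v ≃ RedNF σ w
  id v := Equiv.refl (RedNF σ v)
  comp f g := f.trans g
  inv f := f.symm
  inv_comp f := f.symm_trans_self
  comp_inv f := f.self_trans_symm

/-! ### The action of the fundamental groupoid on reduced words -/

namespace RedNF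

variable (σ : 𝒢.Sections)

def grpEquiv {v : V} (g : 𝒢.G v) : RedNF σ v ≃ RedNF σ v where
  toFun x := ⟨NF.smul σ g x.1, x.2.smul g⟩
  invFun x := ⟨NF.smul σ g⁻¹ x.1, x.2.smul g⁻¹⟩
  left_inv x := Subtype.ext (by dsimp only; rw [NF.smul_smul, inv_mul_cancel, NF.one_smul x.2])
  right_inv x := Subtype.ext (by dsimp only; rw [NF.smul_smul, mul_inv_cancel, NF.one_smul x.2])

noncomputable def edgeEquiv (e : E) : RedNF σ (𝒢.s e) ≃ RedNF σ (𝒢.r e) where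
  toFun x := ⟨NF.mulEdge e x.1, x.2.mulEdge⟩
  invFun x := ⟨NF.mulRev e x.1, x.2.mulRev⟩
  left_inv x := Subtype.ext (NF.mulRev_mulEdge x.2)
  right_inv x := Subtype.ext (NF.mulEdge_mulRev x.2)

theorem grpEquiv_mul {v : V} (g h : 𝒢.G v) :
    grpEquiv σ (g * h) = (grpEquiv σ h).trans (grpEquiv σ g) :=
  Equiv.ext fun x => Subtype.ext (NF.smul_smul σ g h x.1).symm

theorem edgeEquiv_grpEquiv (e : E) (k : 𝒢.Ge e) :
    (edgeEquiv σ e).trans (grpEquiv σ (𝒢.α e k)) =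
      (grpEquiv σ (𝒢.αbar e k)).trans (edgeEquiv σ e) :=
  Equiv.ext fun x => Subtype.ext (NF.smul_mulEdge k x.2)

/-- The bijections by which the inverses of the generators act. -/
noncomputable def genMap : ∀ {v w : V}, 𝒢.Gen v w → (RedNF σ v ≃ RedNF σ w)
  | _, _, .edge e => (edgeEquiv σ e).symm
  | _, _, .rev e => edgeEquiv σ e
  | _, _, .grp g => (grpEquiv σ g).symm

/-- Left multiplication by `γ : x ⟶ y` takes words at `y` to words at `x`, against the arrow.
Recording the action of `γ⁻¹` instead makes the assignment covariant for the diagrammatic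
composition. -/
noncomputable def genPrefunctor : 𝒢.GenQuiver ⥤q RedGpd σ where
  obj v := v
  map a := genMap σ a

noncomputable def freeFunctor : Quiver.FreeGroupoid 𝒢.GenQuiver ⥤ RedGpd σ :=
  Quiver.FreeGroupoid.lift (genPrefunctor σ)

theorem freeFunctor_free {v w : V} (a : 𝒢.Gen v w) :
    (freeFunctor σ).map (𝒢.free a) = genMap σ a := by
  change 𝟙 _ ≫ (genPrefunctor σ).map a = _
  rw [Category.id_comp]
  rfl

theorem map_inv' {C D : Type*} [Groupoid C] [Groupoid D] (F : C ⥤ D) {x y : C} (f : x ⟶ y) :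
    F.map (Groupoid.inv f) = Groupoid.inv (F.map f) := by
  simp only [Groupoid.inv_eq_inv, Functor.map_inv]

/-- Yields the relation for a reversed edge from the relation for the edge. -/
theorem symm_trans_eq {A B : Type*} {f : A ≃ B} {p : A ≃ A} {q : B ≃ B}
    (h : f.trans q = p.trans f) : p.symm.trans f = f.trans q.symm := by
  ext x
  have h2 := DFunLike.congr_fun h (p.symm x)
  simp only [Equiv.trans_apply, Equiv.apply_symm_apply] at h2
  rw [Equiv.trans_apply, Equiv.trans_apply, Equiv.eq_symm_apply, h2]

/-- `F(𝒢)` acts on the reduced words; the functor describes the action of the inverses. -/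
noncomputable def functor : 𝒢.FundGpd ⥤ RedGpd σ :=
  CategoryTheory.Quotient.lift 𝒢.Rel (freeFunctor σ) (by
    intro _ _ _ _ h
    cases h with
    | mul g h =>
      rw [Functor.map_comp, freeFunctor_free, freeFunctor_free, freeFunctor_free]
      exact (congrArg Equiv.symm (grpEquiv_mul σ g h)).symm
    | rev e =>
      rw [map_inv', freeFunctor_free, freeFunctor_free]
      rfl
    | edge e k =>
      rw [Functor.map_comp, Functor.map_comp, freeFunctor_free, freeFunctor_free,
        freeFunctor_free]
      exact congrArg Equiv.symm (edgeEquiv_grpEquiv σ e k)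
    | edge_rev e k =>
      rw [Functor.map_comp, Functor.map_comp, freeFunctor_free, freeFunctor_free,
        freeFunctor_free]
      exact symm_trans_eq (edgeEquiv_grpEquiv σ e k))

/-- The action of an element of `F(𝒢)` on the reduced words. -/
noncomputable def act {x y : 𝒢.FundGpd} (γ : x ⟶ y) (u : RedNF σ (base y)) : RedNF σ (base x) :=
  Equiv.symm ((functor σ).map γ) u

theorem act_comp {x y z : 𝒢.FundGpd} (γ : x ⟶ y) (δ : y ⟶ z) (u : RedNF σ (base z)) :
    act σ (γ ≫ δ) u = act σ γ (act σ δ u) := by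
  exact congrArg (fun f : RedNF σ (base x) ≃ RedNF σ (base z) => f.symm u)
    ((functor σ).map_comp γ δ)

theorem act_id {x : 𝒢.FundGpd} (u : RedNF σ (base x)) : act σ (𝟙 x) u = u := by
  exact congrArg (fun f : RedNF σ (base x) ≃ RedNF σ (base x) => f.symm u) ((functor σ).map_id x)

theorem act_gen {v w : V} (a : 𝒢.Gen v w) (u : RedNF σ w) :
    act σ (𝒢.gen a) u = (genMap σ a).symm u := by
  exact congrArg (fun f : RedNF σ v ≃ RedNF σ w => f.symm u) (freeFunctor_free σ a)

theorem act_grp {v : V} (g : 𝒢.G v) (u : RedNF σ v) :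
    (act σ (𝒢.grp g) u).1 = NF.smul σ g u.1 := by
  exact congrArg Subtype.val (act_gen σ (.grp g) u)

theorem act_edge (e : E) (u : RedNF σ (𝒢.s e)) :
    (act σ (𝒢.edge e) u).1 = NF.mulEdge e u.1 := by
  exact congrArg Subtype.val (act_gen σ (.edge e) u)

theorem act_inv_edge (e : E) (u : RedNF σ (𝒢.r e)) :
    (act σ (Groupoid.inv (𝒢.edge e)) u).1 = NF.mulRev e u.1 := by
  have h : edgeEquiv σ e (act σ (Groupoid.inv (𝒢.edge e)) u) = u :=
    (act_gen σ (.edge e) _).symm.trans ((act_comp σ (𝒢.edge e) (Groupoid.inv (𝒢.edge e)) u).symm.trans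
      ((congrArg (fun γ : 𝒢.vtx (𝒢.r e) ⟶ 𝒢.vtx (𝒢.r e) => act σ γ u)
        (Groupoid.comp_inv (𝒢.edge e))).trans (act_id σ (x := 𝒢.vtx (𝒢.r e)) u)))
  exact congrArg Subtype.val ((edgeEquiv σ e).eq_symm_apply.2 h)

end RedNF

end DirGraphOfGroups

/-! ### Words and reduced words -/

namespace DirGraphOfGroups

variable {V E : Type*} {𝒢 : DirGraphOfGroups V E}

theorem inv_grp {v : V} (g : 𝒢.G v) : Groupoid.inv (𝒢.grp g) = 𝒢.grp g⁻¹ := by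
  rw [← cancel_epi (𝒢.grp g), Groupoid.comp_inv, grp_mul, mul_inv_cancel, grp_one]

theorem grp_α_edge (e : E) (k : 𝒢.Ge e) :
    𝒢.grp (𝒢.α e k) ≫ 𝒢.edge e = 𝒢.edge e ≫ 𝒢.grp (𝒢.αbar e k) :=
  CategoryTheory.Quotient.sound _ (Rel.edge e k)

theorem inv_comp_rev {C : Type*} [Groupoid C] {x y z : C} (f : x ⟶ y) (g : y ⟶ z) :
    Groupoid.inv (f ≫ g) = Groupoid.inv g ≫ Groupoid.inv f := by
  simp only [Groupoid.inv_eq_inv, IsIso.inv_comp]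

theorem inv_inv_hom {C : Type*} [Groupoid C] {x y : C} (f : x ⟶ y) :
    Groupoid.inv (Groupoid.inv f) = f := by
  simp only [Groupoid.inv_eq_inv, IsIso.inv_inv]

theorem IsWord.id (v : V) : 𝒢.IsWord (𝟙 (𝒢.vtx v)) := by
  rw [← grp_one]
  exact .grp 1

theorem IsWord.edge (e : E) : 𝒢.IsWord (𝒢.edge e) := by
  have := IsWord.cons (𝒢 := 𝒢) e 1 (.id _)
  rwa [grp_one, Category.id_comp, Category.comp_id] at this

namespace NF

variable {σ : 𝒢.Sections}

/-- The letters before the first reversed edge. -/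
def posList : ∀ {v : V}, 𝒢.NF v → List (Σ e, 𝒢.G (𝒢.r e))
  | _, nil _ => []
  | _, pos e h x => ⟨e, h⟩ :: posList x
  | _, neg _ _ _ => []

/-- `x` does not start with a reversed edge. -/
def NonNeg : ∀ {v : V}, 𝒢.NF v → Prop
  | _, nil _ => True
  | _, pos _ _ _ => True
  | _, neg _ _ _ => False

/-- All edges of `x` are reversed, and `δ` is `x` multiplied by the inverse of a word. -/
def NegRep {y : 𝒢.FundGpd} : ∀ {w : V}, 𝒢.NF w → (𝒢.vtx w ⟶ y) → Prop
  | _, nil _, δ => 𝒢.IsWord (Groupoid.inv δ)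
  | _, pos _ _ _, _ => False
  | _, neg e h x, δ => NegRep x (𝒢.edge e ≫ 𝒢.grp h⁻¹ ≫ δ)

theorem NonNeg.ne {e : E} {x : 𝒢.NF (𝒢.s e)} (hx : NonNeg x) (y : 𝒢.NF (𝒢.r e)) :
    x ≠ neg e 1 y := by
  rintro rfl
  rwa [NonNeg] at hx

theorem NegRep.posList_eq {y : 𝒢.FundGpd} {w : V} {x : 𝒢.NF w} {δ : 𝒢.vtx w ⟶ y}
    (h : NegRep x δ) : posList x = [] := by
  cases x with
  | nil => rw [posList]
  | pos => rw [NegRep] at h; exact h.elim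
  | neg => rw [posList]

theorem NegRep.ne {y : 𝒢.FundGpd} {e : E} {x : 𝒢.NF (𝒢.r e)} {δ : 𝒢.vtx (𝒢.r e) ⟶ y}
    (h : NegRep x δ) (z : 𝒢.NF (𝒢.s e)) : x ≠ pos e 1 z := by
  rintro rfl
  rwa [NegRep] at h

/-- Inverting turns each reversed edge into an edge of the orientation, and the remaining factor is
a word by definition. -/
theorem NegRep.isWord {y : 𝒢.FundGpd} {w : V} {x : 𝒢.NF w} {δ : 𝒢.vtx w ⟶ y}
    (h : NegRep x δ) : 𝒢.IsWord (Groupoid.inv δ) := by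
  induction x with
  | nil => rwa [NegRep] at h
  | pos => rw [NegRep] at h; exact h.elim
  | neg e g x ih =>
    rw [NegRep] at h
    have := (ih h).comp ((IsWord.edge e).comp (.grp g⁻¹))
    rwa [← Category.assoc (𝒢.edge e), inv_comp_rev, Category.assoc, Groupoid.inv_comp,
      Category.comp_id] at this

theorem NegRep.smul {y : 𝒢.FundGpd} {w : V} {x : 𝒢.NF w} {δ : 𝒢.vtx w ⟶ y} (g : 𝒢.G w)
    (h : NegRep x δ) : NegRep (NF.smul σ g x) (𝒢.grp g ≫ δ) := by
  induction x with
  | nil =>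
    rw [NegRep] at h
    rw [smul_nil, NegRep, inv_comp_rev, inv_grp]
    exact h.comp (.grp _)
  | pos => rw [NegRep] at h; exact h.elim
  | neg e k x ih =>
    rw [NegRep] at h
    rw [smul_neg, NegRep]
    have := ih (𝒢.α e ((σ.neg e).cor (g * k))) h
    rw [← Category.assoc, grp_α_edge, Category.assoc, grp_mul_assoc] at this
    rw [grp_mul_assoc]
    -- The group element carried past the first letter is the one that the definition of `NegRep`
    -- requires there.
    have hk : ((σ.neg e).rep (g * k))⁻¹ * g = 𝒢.αbar e ((σ.neg e).cor (g * k)) * k⁻¹ := by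
      rw [inv_mul_eq_iff_eq_mul, ← mul_assoc, (σ.neg e).rep_mul_cor, mul_inv_cancel_right]
    rwa [hk]

/-- A word of reversed edges does not start with `1e`, so multiplication by `ē` only adds a letter.
-/
theorem NegRep.mulRev {y : 𝒢.FundGpd} {e : E} {x : 𝒢.NF (𝒢.r e)} {δ : 𝒢.vtx (𝒢.r e) ⟶ y}
    (h : NegRep x δ) : NegRep (NF.mulRev e x) (Groupoid.inv (𝒢.edge e) ≫ δ) := by
  rw [mulRev_of_ne h.ne, NegRep, inv_one, grp_one, Category.id_comp, ← Category.assoc,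
    Groupoid.comp_inv, Category.id_comp]
  exact h

theorem NegRep.of_neg {y : 𝒢.FundGpd} {e : E} {x : 𝒢.NF (𝒢.r e)} {δ : 𝒢.vtx (𝒢.s e) ⟶ y}
    (h : NegRep (neg e 1 x) δ) : NegRep x (𝒢.edge e ≫ δ) := by
  rwa [NegRep, inv_one, grp_one, Category.id_comp] at h

end NF

/-! ### Inverses of words acting on reduced words -/

namespace RedNF

variable (σ : 𝒢.Sections)

/-- The empty word at `y`. -/
def one (y : 𝒢.FundGpd) : RedNF σ (base y) := ⟨.nil _, NF.reduced_nil σ _⟩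

variable {σ}

theorem negRep_act_grp {v : V} {z : 𝒢.FundGpd} (g : 𝒢.G v) (u : RedNF σ v) (δ : 𝒢.vtx v ⟶ z)
    (h : NF.NegRep u.1 δ) : NF.NegRep (w := v) (act σ (𝒢.grp g) u).1 (𝒢.grp g ≫ δ) :=
  (congrArg (fun x => NF.NegRep x (𝒢.grp g ≫ δ)) (act_grp σ g u)).mpr (h.smul g)

theorem negRep_act_inv_edge {e : E} {z : 𝒢.FundGpd} (u : RedNF σ (𝒢.r e))
    (δ : 𝒢.vtx (𝒢.r e) ⟶ z) (h : NF.NegRep u.1 δ) :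
    NF.NegRep (w := 𝒢.s e) (act σ (Groupoid.inv (𝒢.edge e)) u).1
      (Groupoid.inv (𝒢.edge e) ≫ δ) :=
  (congrArg (fun x => NF.NegRep x (Groupoid.inv (𝒢.edge e) ≫ δ)) (act_inv_edge σ e u)).mpr
    h.mulRev

/-- `NF.NegRep` at an arbitrary unit. -/
def NegRepAt {x z : 𝒢.FundGpd} (u : RedNF σ (base x)) (δ : x ⟶ z) : Prop :=
  NF.NegRep (w := base x) u.1 δ

/-- The inverse of a word is a product of group elements and reversed edges, and neither kind of
factor leads out of the words made of reversed edges. -/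
theorem negRepAt_act_inv {x y z : 𝒢.FundGpd} {f : x ⟶ y} (hf : 𝒢.IsWord f) :
    ∀ (u : RedNF σ (base x)) (δ : x ⟶ z), NegRepAt u δ →
      NegRepAt (act σ (Groupoid.inv f) u) (Groupoid.inv f ≫ δ) := by
  induction hf with
  | grp g =>
    intro u δ h
    rw [inv_grp]
    exact negRep_act_grp _ u δ h
  | @cons e g y f hf ih =>
    intro u δ h
    have h1 := ih _ _ (negRep_act_inv_edge _ _ (negRep_act_grp g⁻¹ u δ h))
    have h2 : Groupoid.inv (𝒢.grp g ≫ 𝒢.edge e ≫ f) =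
        Groupoid.inv f ≫ Groupoid.inv (𝒢.edge e) ≫ 𝒢.grp g⁻¹ := by
      rw [inv_comp_rev, inv_comp_rev, inv_grp, Category.assoc]
    have h3 : act σ (Groupoid.inv (𝒢.grp g ≫ 𝒢.edge e ≫ f)) u = act σ (Groupoid.inv f)
        (act σ (Groupoid.inv (𝒢.edge e)) (act σ (𝒢.grp g⁻¹) u)) :=
      (congrArg (fun γ => act σ γ u) h2).trans ((act_comp σ _ _ _).trans
        (congrArg (act σ (Groupoid.inv f)) (act_comp σ _ _ _)))
    have h4 : Groupoid.inv (𝒢.grp g ≫ 𝒢.edge e ≫ f) ≫ δ =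
        Groupoid.inv f ≫ Groupoid.inv (𝒢.edge e) ≫ 𝒢.grp g⁻¹ ≫ δ := by
      rw [h2, Category.assoc, Category.assoc]
    rw [h4, h3]
    exact h1

end RedNF

/-! ### Paths of `E_Σ` acting on reduced words, and least paths -/

namespace Transversals

variable {T : 𝒢.Transversals}

/-- An edge `he` of `E_Σ` as a pair. -/
def edgeLetter {v w : V} : T.EEdge v w → Σ e, 𝒢.G (𝒢.r e)
  | .mk e h => ⟨e, h.1⟩

theorem edgeLetter_injective {u w w' : V} (a : T.EEdge u w) (a' : T.EEdge u w')
    (h : edgeLetter a = edgeLetter a') : (⟨w, a⟩ : Σ w, T.EEdge u w) = ⟨w', a'⟩ := by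
  -- The two ranges are made independent variables so that both edges can be destructed; with a
  -- common range this would require unifying `𝒢.r e` with `𝒢.r e'`.
  have key : ∀ {u u' w w' : V} (a : T.EEdge u w) (a' : T.EEdge u' w'), u = u' →
      edgeLetter a = edgeLetter a' →
      (⟨u, w, a⟩ : Σ u w, T.EEdge u w) = ⟨u', w', a'⟩ := by
    intro u u' w w' a a' _ h
    cases a with
    | mk e g =>
      cases a' with
      | mk e' g' =>
        simp only [edgeLetter, Sigma.mk.injEq] at h
        obtain ⟨rfl, h⟩ := h
        obtain rfl := Subtype.ext (eq_of_heq h)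
        rfl
  exact eq_of_heq (Sigma.mk.inj_iff.1 (key a a' rfl h)).2

/-- The list of the edges of a path in `E_Σ`. -/
def letters {v : T.EGraph} : ∀ {w : T.EGraph}, Quiver.Path v w → List (Σ e, 𝒢.G (𝒢.r e))
  | _, .nil => []
  | _, .cons p a => letters p ++ [edgeLetter a]

theorem letters_injective {v w w' : T.EGraph} (p : Quiver.Path v w) (p' : Quiver.Path v w')
    (h : letters p = letters p') :
    (⟨w, p⟩ : Σ w, Quiver.Path v w) = ⟨w', p'⟩ := by
  induction p generalizing w' with
  | nil =>
    cases p' with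
    | nil => rfl
    | cons p' a => simp [letters] at h
  | cons p a ih =>
    cases p' with
    | nil => simp [letters] at h
    | cons p' a' =>
      simp only [letters] at h
      obtain ⟨h1, h2⟩ := List.append_inj' h rfl
      have := ih p' h1
      obtain ⟨rfl, h3⟩ := Sigma.mk.inj_iff.1 this
      obtain rfl := eq_of_heq h3
      rw [List.cons.injEq] at h2
      have h4 := h2.1
      obtain ⟨rfl, h5⟩ := Sigma.mk.inj_iff.1 (edgeLetter_injective a a' h4)
      obtain rfl := eq_of_heq h5
      rfl

variable {σ : 𝒢.Sections}

theorem act_evalEdge (e : E) (h : T.S e) (u : RedNF σ (𝒢.s e)) :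
    (RedNF.act σ (evalEdge (.mk e h)) u).1 = NF.smul σ h.1 (NF.mulEdge e u.1) :=
  (congrArg Subtype.val (RedNF.act_comp σ (𝒢.grp h.1) (𝒢.edge e) u)).trans
    ((RedNF.act_grp σ _ _).trans (congrArg (NF.smul σ h.1) (RedNF.act_edge σ e u)))

theorem act_eval_cons {v w w' : T.EGraph} (p : Quiver.Path v w) (a : T.EEdge w w')
    (u : RedNF σ w') : RedNF.act σ (eval (p.cons a)) u =
      RedNF.act σ (eval p) (RedNF.act σ (evalEdge a) u) :=
  RedNF.act_comp σ (eval p) (evalEdge a) u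

/-- Elements of `Σ_e` represent themselves, so without cancellation the letter is prepended
unchanged and nothing is carried into `u`. -/
theorem act_evalEdge_of_ne (hσ : ∀ e, ∀ h ∈ T.S e, (σ.pos e).rep h = h) (e : E) (h : T.S e)
    (u : RedNF σ (𝒢.s e)) (hu : ∀ y, u.1 ≠ .neg e 1 y) :
    (RedNF.act σ (evalEdge (.mk e h)) u).1 = .pos e h.1 u.1 := by
  rw [act_evalEdge, NF.mulEdge_of_ne hu, NF.smul_pos, mul_one, hσ e h.1 h.2,
    CosetSection.cor_of_rep _ (𝒢.α_injective e) (hσ e h.1 h.2), map_one, NF.one_smul u.2]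

/-- Edges of the orientation cancel only against a reversed edge. The last edge of `p` acts first,
and after each step the word again starts with an edge of the orientation, so the letters of `p` all
survive. -/
theorem posList_act_of_nonNeg (hσ : ∀ e, ∀ h ∈ T.S e, (σ.pos e).rep h = h) {v w : T.EGraph}
    (p : Quiver.Path v w) (u : RedNF σ w) (hu : NF.NonNeg u.1) :
    NF.posList (v := v) (RedNF.act σ (eval p) u).1 = letters p ++ NF.posList u.1 := by
  induction p with
  | nil => exact congrArg (fun x => NF.posList (v := v) x.1) (RedNF.act_id σ (x := 𝒢.vtx v) u)
  | @cons w w' p a ih =>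
    refine (congrArg (fun x => NF.posList (v := v) x.1) (act_eval_cons p a u)).trans ?_
    change T.EEdge w w' at a
    cases a with
    | mk e h =>
      have h2 := act_evalEdge_of_ne hσ e h u hu.ne
      refine (ih (RedNF.act σ (evalEdge (.mk e h)) u) ?_).trans ?_
      · exact (congrArg (NF.NonNeg (v := 𝒢.r e)) h2).mpr (by simp only [NF.NonNeg])
      · refine (congrArg (fun x => letters p ++ NF.posList (v := 𝒢.r e) x) h2).trans ?_
        simp only [NF.posList, letters, edgeLetter, List.append_assoc, List.cons_append,
          List.nil_append]

/-- Cancellation of `eval p ≫ δ`, where `δ` is the inverse of a word. -/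
theorem exists_prefix (hσ : ∀ e, ∀ h ∈ T.S e, (σ.pos e).rep h = h) {v w : T.EGraph}
    {z : 𝒢.FundGpd} (p : Quiver.Path v w) (u : RedNF σ w) (δ : 𝒢.vtx w ⟶ z)
    (hu : NF.NegRep u.1 δ) :
    ∃ (w₀ : T.EGraph) (p₀ : Quiver.Path v w₀) (p₁ : Quiver.Path w₀ w), p = p₀.comp p₁ ∧
      NF.posList (v := v) (RedNF.act σ (eval p) u).1 = letters p₀ ∧
      𝒢.IsWord (Groupoid.inv (eval p₁ ≫ δ)) := by
  induction p with
  | nil =>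
    refine ⟨v, .nil, .nil, rfl, ?_, ?_⟩
    · refine (congrArg (fun x => NF.posList (v := v) x.1)
        (RedNF.act_id σ (x := 𝒢.vtx v) u)).trans ?_
      exact hu.posList_eq
    · have : eval (T := T) (.nil : Quiver.Path v v) ≫ δ = δ := Category.id_comp δ
      rw [this]
      exact hu.isWord
  | @cons w w' p a ih =>
    have hc := congrArg (fun x => NF.posList (v := v) x.1) (act_eval_cons p a u)
    change T.EEdge w w' at a
    cases a with
    | mk e h =>
      -- If the last edge of the path cancels, it goes into `p₁` and the induction continues with
      -- the shorter path. Otherwise no earlier edge can cancel, and `p₀` is the whole path.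
      by_cases hn : ∃ y, u.1 = .neg e 1 y
      · obtain ⟨y, hy⟩ := hn
        have h1 : NF.NegRep (w := 𝒢.r e) (RedNF.act σ (evalEdge (.mk e h)) u).1
            (𝒢.grp h.1 ≫ 𝒢.edge e ≫ δ) := by
          refine (congrArg (fun x => NF.NegRep (w := 𝒢.r e) x _) (act_evalEdge e h u)).mpr ?_
          have h2 : NF.NegRep (.neg e 1 y) δ := (congrArg (fun x => NF.NegRep x δ) hy).mp hu
          have h3 : NF.mulEdge e u.1 = y := (congrArg (NF.mulEdge e) hy).trans
            (NF.mulEdge_neg e y)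
          exact (congrArg (fun x => NF.NegRep (NF.smul σ h.1 x) _) h3).mpr (h2.of_neg.smul _)
        obtain ⟨w₀, p₀, p₁, rfl, hp, hw⟩ := ih _ _ h1
        refine ⟨w₀, p₀, p₁.cons (.mk e h), rfl, hc.trans hp, ?_⟩
        have h2 : eval (p₁.cons (.mk e h)) ≫ δ = eval p₁ ≫ 𝒢.grp h.1 ≫ 𝒢.edge e ≫ δ := by
          simp only [eval, evalEdge, Category.assoc]
        rw [h2]
        exact hw
      · push Not at hn
        refine ⟨_, p.cons (.mk e h), .nil, rfl, hc.trans ?_, ?_⟩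
        · have h2 := act_evalEdge_of_ne hσ e h u hn
          refine (posList_act_of_nonNeg hσ p _ ?_).trans ?_
          · exact (congrArg (NF.NonNeg (v := 𝒢.r e)) h2).mpr (by simp only [NF.NonNeg])
          · refine (congrArg (fun x => letters p ++ NF.posList (v := 𝒢.r e) x) h2).trans ?_
            simp only [NF.posList, letters, edgeLetter, hu.posList_eq]
        · have : eval (T := T) (@Quiver.Path.nil T.EGraph _ (𝒢.s e)) ≫ δ = δ :=
            Category.id_comp δ
          rw [this]
          exact hu.isWord

/-- The path is determined by its coset. -/
theorem eval_injective {v w : T.EGraph} (p p' : Quiver.Path v w) (g : 𝒢.G w)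
    (h : eval p ≫ 𝒢.grp g = eval p') : p = p' := by
  obtain ⟨σ, hσ⟩ := T.exists_sections
  have key : ∀ (q : Quiver.Path v w), NF.posList (v := v)
      (RedNF.act σ (eval q) (RedNF.one σ (𝒢.vtx w))).1 = letters q := fun q =>
    (posList_act_of_nonNeg hσ q (RedNF.one σ (𝒢.vtx w)) (by
      simp only [RedNF.one, NF.NonNeg])).trans (by simp [RedNF.one, NF.posList])
  have h1 : RedNF.act σ (𝒢.grp g) (RedNF.one σ (𝒢.vtx w)) = RedNF.one σ (𝒢.vtx w) :=
    Subtype.ext ((RedNF.act_grp σ g _).trans (NF.smul_nil σ g))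
  have h2 : RedNF.act σ (eval p') (RedNF.one σ (𝒢.vtx w)) =
      RedNF.act σ (eval p) (RedNF.one σ (𝒢.vtx w)) :=
    (congrArg (fun γ => RedNF.act σ γ (RedNF.one σ (𝒢.vtx w))) h.symm).trans
      ((RedNF.act_comp σ _ _ _).trans (congrArg _ h1))
  have h3 : letters p = letters p' :=
    ((key p).symm.trans (congrArg (fun x => NF.posList (v := v) x.1) h2.symm)).trans (key p')
  exact eq_of_heq (Sigma.mk.inj_iff.1 (letters_injective p p' h3)).2

/-- Among the expressions of `γ` as `eval p ≫ μ⁻¹`, with words `μ`, there is one with the least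
initial path `p`. -/
theorem exists_least_path {v w : T.EGraph} {z : 𝒢.FundGpd} (γ : 𝒢.vtx v ⟶ z)
    (p : Quiver.Path v w) (m : z ⟶ 𝒢.vtx w) (hm : 𝒢.IsWord m) (h : γ ≫ m = eval p) :
    ∃ (w₀ : T.EGraph) (p₀ : Quiver.Path v w₀) (m₀ : z ⟶ 𝒢.vtx w₀), 𝒢.IsWord m₀ ∧
      γ ≫ m₀ = eval p₀ ∧ ∀ (w' : T.EGraph) (p' : Quiver.Path v w') (m' : z ⟶ 𝒢.vtx w'),
        𝒢.IsWord m' → γ ≫ m' = eval p' → ∃ p₁ : Quiver.Path w₀ w', p' = p₀.comp p₁ := by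
  obtain ⟨σ, hσ⟩ := T.exists_sections
  -- The image of the empty word under `γ` does not depend on the expression `γ = p' m'⁻¹`. So the
  -- prefix `p₀` that survives cancellation is the same for all expressions.
  have key : ∀ {w' : T.EGraph} (p' : Quiver.Path v w') (m' : z ⟶ 𝒢.vtx w'), 𝒢.IsWord m' →
      γ ≫ m' = eval p' → ∃ (w₀ : T.EGraph) (p₀ : Quiver.Path v w₀) (p₁ : Quiver.Path w₀ w'),
        p' = p₀.comp p₁ ∧ NF.posList (v := v) (RedNF.act σ γ (RedNF.one σ z)).1 = letters p₀ ∧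
        𝒢.IsWord (Groupoid.inv (eval p₁ ≫ Groupoid.inv m')) := by
    intro w' p' m' hm' h'
    have h1 : NF.NegRep (.nil (base z)) (𝟙 (𝒢.vtx (base z))) := by
      have : Groupoid.inv (𝟙 (𝒢.vtx (base z))) = 𝟙 (𝒢.vtx (base z)) := by
        rw [Groupoid.inv_eq_inv, IsIso.inv_id]
      rw [NF.NegRep, this]
      exact .id (base z)
    have h2 := RedNF.negRepAt_act_inv hm' (RedNF.one σ z) (𝟙 z) h1
    rw [Category.comp_id] at h2
    obtain ⟨w₀, p₀, p₁, hp, hl, hw⟩ := exists_prefix hσ p' _ _ h2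
    refine ⟨w₀, p₀, p₁, hp, ?_, hw⟩
    rw [← hl]
    have h3 : γ = eval p' ≫ Groupoid.inv m' := by
      rw [← h', Category.assoc, Groupoid.comp_inv, Category.comp_id]
    exact congrArg (fun x => NF.posList (v := v) x.1)
      ((congrArg (fun γ => RedNF.act σ γ (RedNF.one σ z)) h3).trans (RedNF.act_comp σ _ _ _))
  obtain ⟨w₀, p₀, p₁, rfl, hl, hw⟩ := key p m hm h
  -- The word left open is `(p₁ m⁻¹)⁻¹`, in which the cancelled part `p₁` of the path is removed
  -- from `m`.
  refine ⟨w₀, p₀, _, hw, ?_, fun w' p' m' hm' h' => ?_⟩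
  · have eval_comp : ∀ {w' : T.EGraph} (q : Quiver.Path w₀ w'),
        eval (p₀.comp q) = eval p₀ ≫ eval q := by
      intro w' q
      induction q with
      | nil => exact (Category.comp_id _).symm
      | cons q a ih =>
        simp only [Quiver.Path.comp_cons, eval, ih, Category.assoc]
    rw [inv_comp_rev, inv_inv_hom, ← Category.assoc, h, eval_comp, Category.assoc,
      Groupoid.comp_inv, Category.comp_id]
  · obtain ⟨w₁, p₂, p₃, rfl, hl', -⟩ := key p' m' hm' h'
    obtain ⟨rfl, h5⟩ := Sigma.mk.inj_iff.1 (letters_injective p₀ p₂ (hl.symm.trans hl'))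
    obtain rfl := eq_of_heq h5
    exact ⟨p₃, rfl⟩

end Transversals

/-! ### The boundary and the infinite paths -/

theorem coset_comp_grp {x : 𝒢.FundGpd} {w : V} (γ : x ⟶ 𝒢.vtx w) (g : 𝒢.G w) :
    𝒢.coset (γ ≫ 𝒢.grp g) = 𝒢.coset γ := by
  have : (Quotient.mk (𝒢.cosetSetoid x w) (γ ≫ 𝒢.grp g)) = Quotient.mk _ γ :=
    (Quotient.sound (s := 𝒢.cosetSetoid x w) ⟨g, rfl⟩).symm
  rw [coset, this, coset]

theorem exists_of_coset_eq {x : 𝒢.FundGpd} {w : V} {γ δ : x ⟶ 𝒢.vtx w}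
    (h : 𝒢.coset γ = 𝒢.coset δ) : ∃ g : 𝒢.G w, δ = γ ≫ 𝒢.grp g := by
  have h1 := eq_of_heq (Sigma.mk.inj_iff.1 h).2
  have h2 := eq_of_heq (Sigma.mk.inj_iff.1 h1).2
  exact Quotient.exact h2

theorem source_eq_of_coset_eq {x y : 𝒢.FundGpd} {w w' : V} {γ : x ⟶ 𝒢.vtx w}
    {δ : y ⟶ 𝒢.vtx w'} (h : 𝒢.coset γ = 𝒢.coset δ) : w = w' :=
  congrArg (fun u : 𝒢.Forest => u.2.1) h

theorem forestEdge_comp_edge {x : 𝒢.FundGpd} (e : E) (g : 𝒢.G (𝒢.r e))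
    (γ : x ⟶ 𝒢.vtx (𝒢.r e)) :
    𝒢.ForestEdge (𝒢.coset γ) (𝒢.coset (γ ≫ 𝒢.grp g ≫ 𝒢.edge e)) := by
  refine .mk e _ _ g 1 ?_
  rw [← Category.assoc, Groupoid.inv_comp, Category.id_comp, grp_one, Category.comp_id]

theorem cyl_subset_of_forestEdge {u u' : 𝒢.Forest} (h : 𝒢.ForestEdge u u') :
    𝒢.cyl u' ⊆ 𝒢.cyl u := by
  rintro _ ⟨x, rfl, rfl⟩
  refine ⟨⟨fun n => Nat.casesOn n u x.1, fun n => ?_⟩, rfl, ?_⟩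
  · cases n with
    | zero => exact h
    | succ n => exact x.2 n
  · exact Quotient.sound ⟨1, 0, fun i => by rw [Nat.add_comm, Nat.zero_add]⟩

/-- The coset `γ G_w`, for `γ` with source `w`. -/
def cosetAt {x y : 𝒢.FundGpd} (γ : x ⟶ y) : 𝒢.Forest := 𝒢.coset (w := base y) γ

/-- Right multiplication by a group element preserves the coset, and by an edge it follows an edge
of the forest, along which cylinders decrease. -/
theorem cyl_comp_subset {x y : 𝒢.FundGpd} {m : x ⟶ y} (hm : 𝒢.IsWord m) :
    ∀ {a : 𝒢.FundGpd} (γ : a ⟶ x), 𝒢.cyl (cosetAt (γ ≫ m)) ⊆ 𝒢.cyl (cosetAt γ) := by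
  induction hm with
  | grp g =>
    intro a γ
    exact (congrArg 𝒢.cyl (coset_comp_grp γ g)).subset
  | @cons e g y f hf ih =>
    intro a γ
    have h : γ ≫ 𝒢.grp g ≫ 𝒢.edge e ≫ f = (γ ≫ 𝒢.grp g ≫ 𝒢.edge e) ≫ f := by
      simp only [Category.assoc]
    rw [h]
    exact (ih _).trans (cyl_subset_of_forestEdge (forestEdge_comp_edge e g γ))

theorem mem_cyl_of_comp_eq {a x y : 𝒢.FundGpd} {γ : a ⟶ x} {m : x ⟶ y} {δ : a ⟶ y}
    (hm : 𝒢.IsWord m) (h : γ ≫ m = δ) {ξ : 𝒢.Boundary} (hξ : ξ ∈ 𝒢.cyl (cosetAt δ)) :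
    ξ ∈ 𝒢.cyl (cosetAt γ) := by
  subst h
  exact cyl_comp_subset hm γ hξ

/-- The tails of a path have the same class. -/
theorem ForestPath.toClass_mem_cyl (x : 𝒢.ForestPath) (n : ℕ) : x.toClass ∈ 𝒢.cyl (x.1 n) :=
  ⟨⟨fun i => x.1 (n + i), fun i => x.2 (n + i)⟩, rfl,
    Quotient.sound ⟨0, n, fun i => by rw [Nat.zero_add]⟩⟩

/-! ### Normal forms of words, and cylinder sets -/

namespace Transversals

variable {T : 𝒢.Transversals}

theorem exists_mul (T : 𝒢.Transversals) (e : E) (g : 𝒢.G (𝒢.r e)) :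
    ∃ (h : T.S e) (k : 𝒢.Ge e), g = h.1 * 𝒢.α e k := by
  obtain ⟨⟨h, ⟨_, k, rfl⟩⟩, hg, -⟩ := (T.isComplement e).existsUnique g
  exact ⟨h, k, hg.symm⟩

theorem exists_grp_comp_edge (T : 𝒢.Transversals) (e : E) (g : 𝒢.G (𝒢.r e)) :
    ∃ (h : T.S e) (k : 𝒢.G (𝒢.s e)), 𝒢.grp g ≫ 𝒢.edge e = evalEdge (.mk e h) ≫ 𝒢.grp k := by
  obtain ⟨h, k, rfl⟩ := T.exists_mul e g
  exact ⟨h, 𝒢.αbar e k, by rw [← grp_mul, evalEdge, Category.assoc, Category.assoc, grp_α_edge]⟩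

theorem isWord_evalEdge {v w : V} (a : T.EEdge v w) : 𝒢.IsWord (evalEdge a) := by
  cases a with
  | mk e h => exact (IsWord.grp h.1).comp (.edge e)

theorem isWord_eval {v w : T.EGraph} (p : Quiver.Path v w) : 𝒢.IsWord (eval p) := by
  induction p with
  | nil => exact .id v
  | cons p a ih => exact ih.comp (isWord_evalEdge a)

theorem eval_comp {v w w' : T.EGraph} (p : Quiver.Path v w) (q : Quiver.Path w w') :
    eval (p.comp q) = eval p ≫ eval q := by
  induction q with
  | nil => exact (Category.comp_id _).symm
  | cons q a ih => simp only [Quiver.Path.comp_cons, eval, ih, Category.assoc]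

/-- The element `g` is moved to the right through the path, changing the transversal element at each
edge but not the edges. -/
theorem exists_grp_comp_eval {v w : T.EGraph} (p : Quiver.Path v w) (g : 𝒢.G v) :
    ∃ (q : Quiver.Path v w) (k : 𝒢.G w), 𝒢.grp g ≫ eval p = eval q ≫ 𝒢.grp k := by
  induction p with
  | nil => exact ⟨.nil, g, (Category.comp_id _).trans (Category.id_comp _).symm⟩
  | @cons w w' p a ih =>
    obtain ⟨q, k, h⟩ := ih
    change T.EEdge w w' at a
    cases a with
    | mk e s =>
      obtain ⟨s', k', h'⟩ := T.exists_grp_comp_edge e (k * s.1)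
      refine ⟨q.cons (.mk e s'), k', ?_⟩
      simp only [eval, Category.assoc]
      rw [← h', ← Category.assoc, h, ← grp_mul]
      simp only [evalEdge, Category.assoc]

theorem exists_cons_normalForm (T : 𝒢.Transversals) (e : E) (g : 𝒢.G (𝒢.r e)) {w : V}
    (p : @Quiver.Path T.EGraph _ (𝒢.s e) w) (k : 𝒢.G w) :
    ∃ (q : @Quiver.Path T.EGraph _ (𝒢.r e) w) (k' : 𝒢.G w),
      𝒢.grp g ≫ 𝒢.edge e ≫ eval p ≫ 𝒢.grp k = eval q ≫ 𝒢.grp k' := by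
  obtain ⟨h, l, h1⟩ := T.exists_grp_comp_edge e g
  obtain ⟨q, l', h2⟩ := exists_grp_comp_eval p l
  let b : @Quiver.Path T.EGraph _ (𝒢.r e) (𝒢.s e) := .cons .nil (.mk e h)
  have hb : eval b = evalEdge (.mk e h) := Category.id_comp _
  refine ⟨b.comp q, l' * k, ?_⟩
  calc 𝒢.grp g ≫ 𝒢.edge e ≫ eval p ≫ 𝒢.grp k
      = (𝒢.grp g ≫ 𝒢.edge e) ≫ eval p ≫ 𝒢.grp k := (Category.assoc _ _ _).symm
    _ = (evalEdge (.mk e h) ≫ 𝒢.grp l) ≫ eval p ≫ 𝒢.grp k := by rw [h1]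
    _ = evalEdge (.mk e h) ≫ (𝒢.grp l ≫ eval p) ≫ 𝒢.grp k := by
      rw [Category.assoc]
      exact congrArg _ (Category.assoc _ _ _).symm
    _ = evalEdge (.mk e h) ≫ (eval q ≫ 𝒢.grp l') ≫ 𝒢.grp k := by rw [h2]
    _ = (evalEdge (.mk e h) ≫ eval q) ≫ 𝒢.grp l' ≫ 𝒢.grp k := by simp only [Category.assoc]
    _ = (eval b ≫ eval q) ≫ 𝒢.grp (l' * k) := by rw [grp_mul, hb]
    _ = eval (b.comp q) ≫ 𝒢.grp (l' * k) := congrArg (· ≫ 𝒢.grp (l' * k)) (eval_comp b q).symm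

/-- The normal form of a word. -/
theorem exists_normalForm (T : 𝒢.Transversals) {x y : 𝒢.FundGpd} {m : x ⟶ y}
    (hm : 𝒢.IsWord m) :
    ∃ (p : @Quiver.Path T.EGraph _ (@base V E 𝒢 x) (@base V E 𝒢 y)) (g : 𝒢.G (@base V E 𝒢 y)),
      m = eval p ≫ 𝒢.grp g := by
  induction hm with
  | grp g => exact ⟨.nil, g, (Category.id_comp _).symm⟩
  | @cons e g y f hf ih =>
    obtain ⟨p, k, rfl⟩ := ih
    exact T.exists_cons_normalForm e g p k

/-- The edges of the forest are given by the edges of `E_Σ`. -/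
theorem exists_of_forestEdge (T : 𝒢.Transversals) {x : 𝒢.FundGpd} {w : V} (γ : x ⟶ 𝒢.vtx w)
    {u : 𝒢.Forest} (h : 𝒢.ForestEdge (𝒢.coset γ) u) :
    ∃ (w' : V) (b : T.EEdge w w'), u = 𝒢.coset (γ ≫ evalEdge b) := by
  generalize hc : 𝒢.coset γ = c at h
  cases h with
  | @mk x' e γ' δ g k hγ =>
    obtain rfl : x = x' := congrArg Sigma.fst hc
    obtain rfl : w = 𝒢.r e := source_eq_of_coset_eq hc
    obtain ⟨g', rfl⟩ := exists_of_coset_eq hc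
    obtain ⟨s, k', hs⟩ := T.exists_grp_comp_edge e (g' * g)
    refine ⟨_, .mk e s, ?_⟩
    have h1 : δ = (γ ≫ evalEdge (.mk e s)) ≫ 𝒢.grp (k' * k) := by
      have h2 : δ = (γ ≫ 𝒢.grp g') ≫ 𝒢.grp g ≫ 𝒢.edge e ≫ 𝒢.grp k := by
        rw [← hγ, ← Category.assoc, Groupoid.comp_inv, Category.id_comp]
      rw [h2, Category.assoc, grp_mul_assoc, ← Category.assoc (𝒢.grp _), hs, ← grp_mul]
      simp only [Category.assoc]
    rw [h1, coset_comp_grp]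

theorem exists_word_of_path (T : 𝒢.Transversals) {x : 𝒢.FundGpd} {w : V} (γ : x ⟶ 𝒢.vtx w)
    (y : 𝒢.ForestPath) (hy : y.1 0 = 𝒢.coset γ) (n : ℕ) :
    ∃ (w' : V) (m : 𝒢.vtx w ⟶ 𝒢.vtx w'), 𝒢.IsWord m ∧ y.1 n = 𝒢.coset (γ ≫ m) := by
  induction n with
  | zero => exact ⟨w, 𝟙 _, .id w, by rw [hy, Category.comp_id]⟩
  | succ n ih =>
    obtain ⟨w', m, hm, h⟩ := ih
    have h1 := y.2 n
    rw [h] at h1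
    obtain ⟨w'', b, hb⟩ := T.exists_of_forestEdge _ h1
    exact ⟨w'', m ≫ evalEdge b, hm.comp (isWord_evalEdge b), by rw [hb, Category.assoc]⟩

theorem InfPath.toBoundary_mem_cyl_init (a : T.InfPath) (n : ℕ) :
    a.toBoundary ∈ 𝒢.cyl (𝒢.coset (eval (a.init n))) :=
  ForestPath.toClass_mem_cyl ⟨fun n => 𝒢.coset (eval (a.init n)), forestEdge_init a⟩ n

theorem InfPath.extends_init (a : T.InfPath) (n : ℕ) : a.Extends ⟨_, _, a.init n⟩ := ⟨n, rfl⟩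

theorem InfPath.toBoundary_mem_cyl_of_extends (a : T.InfPath) {v w : T.EGraph}
    {p : Quiver.Path v w} (h : a.Extends ⟨v, w, p⟩) :
    a.toBoundary ∈ 𝒢.cyl (𝒢.coset (eval p)) := by
  obtain ⟨n, h⟩ := h
  obtain ⟨rfl, h⟩ := Sigma.mk.inj_iff.1 h
  obtain ⟨rfl, h⟩ := Sigma.mk.inj_iff.1 (eq_of_heq h)
  obtain rfl := eq_of_heq h
  exact a.toBoundary_mem_cyl_init n

/-- A path from `γG_w` in the class of `a` eventually meets the vertices of `a`. Following it up to
a common vertex multiplies `γ` by a word, and the choice of coset representative there is absorbed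
into that word. -/
theorem InfPath.toBoundary_mem_cyl_iff (a : T.InfPath) {v : T.EGraph} {w : V}
    (γ : 𝒢.vtx v ⟶ 𝒢.vtx w) : a.toBoundary ∈ 𝒢.cyl (𝒢.coset γ) ↔
      ∃ (w' : T.EGraph) (p : Quiver.Path v w') (m : 𝒢.vtx w ⟶ 𝒢.vtx w'),
        𝒢.IsWord m ∧ γ ≫ m = eval p ∧ a.Extends ⟨v, w', p⟩ := by
  constructor
  · rintro ⟨y, hy, hya⟩
    obtain ⟨N, M, h⟩ := Quotient.exact hya
    have h0 : y.1 N = 𝒢.coset (eval (a.init M)) := h 0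
    obtain ⟨w', m, hm, hN⟩ := T.exists_word_of_path γ y hy N
    rw [h0] at hN
    obtain rfl : a.vert 0 = v := congrArg (fun u : 𝒢.Forest => base u.1) hN
    obtain rfl : w' = a.vert M := (source_eq_of_coset_eq hN).symm
    obtain ⟨g, hg⟩ := exists_of_coset_eq hN.symm
    exact ⟨a.vert M, a.init M, m ≫ 𝒢.grp g, hm.comp (.grp g),
      (Category.assoc _ _ _).symm.trans hg.symm, a.extends_init M⟩
  · rintro ⟨w', p, m, hm, h, hp⟩
    exact mem_cyl_of_comp_eq hm h (a.toBoundary_mem_cyl_of_extends hp)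

theorem InfPath.extends_of_comp (a : T.InfPath) {v w w' : T.EGraph}
    (p : Quiver.Path v w) (q : Quiver.Path w w') (h : a.Extends ⟨v, w', p.comp q⟩) :
    a.Extends ⟨v, w, p⟩ := by
  induction q with
  | nil => exact h
  | cons q b ih =>
    apply ih
    obtain ⟨n, h⟩ := h
    cases n with
    | zero =>
      have := congrArg (fun s : T.FinPath => s.2.2.length) h
      simp [InfPath.init] at this
    | succ n =>
      refine ⟨n, ?_⟩
      obtain ⟨rfl, h⟩ := Sigma.mk.inj_iff.1 h
      obtain ⟨rfl, h⟩ := Sigma.mk.inj_iff.1 (eq_of_heq h)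
      have h2 := eq_of_heq h
      rw [Quiver.Path.comp_cons, InfPath.init, Quiver.Path.cons.injEq] at h2
      obtain ⟨rfl, h3, -⟩ := h2
      rw [eq_of_heq h3]

/-- If `pm = p'` with `p'` an initial subpath of `a`, then the normal form `qg` of `m` gives `(pq)g
= p'`, so `pq = p'` because a path is determined by its coset. -/
theorem InfPath.toBoundary_mem_cyl_eval (a : T.InfPath) {v w : T.EGraph}
    (p : Quiver.Path v w) : a.toBoundary ∈ 𝒢.cyl (𝒢.coset (eval p)) ↔ a.Extends ⟨v, w, p⟩ := by
  refine ⟨fun h => ?_, a.toBoundary_mem_cyl_of_extends⟩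
  obtain ⟨w', p', m, hm, hn, hp'⟩ := (a.toBoundary_mem_cyl_iff _).1 h
  obtain ⟨q, g, rfl⟩ := T.exists_normalForm hm
  refine a.extends_of_comp p q ?_
  have h1 : eval (p.comp q) ≫ 𝒢.grp g = eval p' := by
    exact (congrArg (· ≫ 𝒢.grp g) (eval_comp p q)).trans ((Category.assoc _ _ _).trans hn)
  rwa [← eval_injective _ _ g h1] at hp'

theorem InfPath.length_init (a : T.InfPath) (n : ℕ) : (a.init n).length = n := by
  induction n with
  | zero => rfl
  | succ n ih => rw [InfPath.init, Quiver.Path.length_cons, ih]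

/-- Every initial subpath of `b` is an initial subpath of `a`, necessarily of the same length. -/
theorem InfPath.toBoundary_injective :
    Function.Injective (InfPath.toBoundary : T.InfPath → 𝒢.Boundary) := by
  intro a b hab
  have h : ∀ n, (⟨b.vert 0, b.vert n, b.init n⟩ : T.FinPath) = ⟨a.vert 0, a.vert n, a.init n⟩ := by
    intro n
    have h1 := b.toBoundary_mem_cyl_init n
    rw [← hab] at h1
    obtain ⟨k, hk⟩ := (a.toBoundary_mem_cyl_eval _).1 h1
    have hl := congrArg (fun s : T.FinPath => s.2.2.length) hk
    simp only [InfPath.length_init] at hl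
    subst hl
    exact hk
  obtain ⟨va, ea⟩ := a
  obtain ⟨vb, eb⟩ := b
  obtain rfl : vb = va := funext fun n => congrArg (fun s : T.FinPath => s.2.1) (h n)
  congr 1
  funext n
  have h1 := h (n + 1)
  simp only [Sigma.mk.injEq, heq_eq_eq, true_and, InfPath.init, Quiver.Path.cons.injEq] at h1
  exact h1.2.symm

/-- Starting at `G_v`, each edge of the forest path is labelled by an edge of `E_Σ` once the
preceding labels are known, so the labels can be read off one by one. -/
theorem exists_infPath_of_mem_cyl (T : 𝒢.Transversals) {v : V} {ξ : 𝒢.Boundary}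
    (h : ξ ∈ 𝒢.cyl (𝒢.coset (𝟙 (𝒢.vtx v)))) : ∃ a : T.InfPath, a.toBoundary = ξ := by
  obtain ⟨x, hx, rfl⟩ := h
  -- The recursion carries the finite path found so far, with the fact that its coset is the `n`-th
  -- vertex; the next label depends on this representative of the coset.
  have step : ∀ (n : ℕ) (s : {s : Σ w : T.EGraph, @Quiver.Path T.EGraph _ v w //
      x.1 n = 𝒢.coset (eval s.2)}), ∃ (w' : T.EGraph) (b : s.1.1 ⟶ w'),
        x.1 (n + 1) = 𝒢.coset (eval (s.1.2.cons b)) := by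
    intro n s
    have h1 := x.2 n
    rw [s.2] at h1
    exact T.exists_of_forestEdge _ h1
  choose w b hb using step
  let seq : ∀ n, {s : Σ w : T.EGraph, @Quiver.Path T.EGraph _ v w //
      x.1 n = 𝒢.coset (eval s.2)} := fun n =>
    Nat.rec ⟨⟨v, .nil⟩, hx⟩ (fun n s => ⟨⟨w n s, s.1.2.cons (b n s)⟩, hb n s⟩) n
  let a : T.InfPath := ⟨fun n => (seq n).1.1, fun n => b n (seq n)⟩
  have ha : ∀ n, a.init n = (seq n).1.2 := by
    intro n
    induction n with
    | zero => rfl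
    | succ n ih =>
      rw [InfPath.init, ih]
  refine ⟨a, congrArg ForestPath.toClass (Subtype.ext (funext fun n => ?_))⟩
  exact (congrArg (fun p => 𝒢.coset (eval p)) (ha n)).trans (seq n).2.symm

/-- `Z(m)` is contained in `Z(G_v)` for `v = r(m)`. This is what keeps the translates `lm⁻¹ · a`
inside `E_Σ^∞`. -/
theorem exists_infPath_of_mem_cyl_word (T : 𝒢.Transversals) {x y : 𝒢.FundGpd} {m : x ⟶ y}
    (hm : 𝒢.IsWord m) {ξ : 𝒢.Boundary} (h : ξ ∈ 𝒢.cyl (cosetAt m)) :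
    ∃ a : T.InfPath, a.toBoundary = ξ :=
  T.exists_infPath_of_mem_cyl (v := base x) (mem_cyl_of_comp_eq hm (Category.id_comp m) h)

/-- The trace is the union of the cylinders of all paths `p` of the form `γm` with `m` a word, and
the least such path gives the largest cylinder. Having one cylinder matters for the sets `Z(u) \
Z(u')`: the complement of an infinite union of cylinders need not be open. -/
theorem preimage_toBoundary_cyl (T : 𝒢.Transversals) (u : 𝒢.Forest) :
    (∀ a : T.InfPath, a.toBoundary ∉ 𝒢.cyl u) ∨
      ∃ p : T.FinPath, ∀ a : T.InfPath, a.toBoundary ∈ 𝒢.cyl u ↔ a ∈ infCyl p := by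
  by_cases hu : ∃ a : T.InfPath, a.toBoundary ∈ 𝒢.cyl u
  · right
    obtain ⟨a, ha⟩ := hu
    obtain ⟨x, w, q⟩ := u
    induction q using Quotient.ind with | _ γ => ?_
    obtain ⟨_, p, m, hm, h, -⟩ := (a.toBoundary_mem_cyl_iff (v := base x) γ).1 ha
    obtain ⟨w₀, p₀, m₀, hm₀, h₀, hleast⟩ := exists_least_path γ p m hm h
    refine ⟨⟨_, w₀, p₀⟩, fun b => ⟨fun hb => ?_, fun hb => ?_⟩⟩
    · obtain ⟨_, p', m', hm', h', hp'⟩ := (b.toBoundary_mem_cyl_iff (v := base x) γ).1 hb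
      obtain ⟨p₁, rfl⟩ := hleast _ p' m' hm' h'
      exact b.extends_of_comp p₀ p₁ hp'
    · exact (b.toBoundary_mem_cyl_iff (v := base x) γ).2 ⟨w₀, p₀, m₀, hm₀, h₀, hb⟩
  · left
    exact fun a ha => hu ⟨a, ha⟩

theorem isOpen_infCyl (p : T.FinPath) : IsOpen (infCyl p) :=
  TopologicalSpace.isOpen_generateFrom_of_mem (Or.inl ⟨p, rfl⟩)

theorem isOpen_infCyl_diff (p q : T.FinPath) : IsOpen (infCyl p \ infCyl q) :=
  TopologicalSpace.isOpen_generateFrom_of_mem (Or.inr ⟨p, q, rfl⟩)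

theorem continuous_toBoundary : Continuous (InfPath.toBoundary : T.InfPath → 𝒢.Boundary) := by
  rw [continuous_generateFrom_iff]
  rintro _ (⟨u, rfl⟩ | ⟨u, u', rfl⟩)
  · obtain h | ⟨p, h⟩ := T.preimage_toBoundary_cyl u
    · rw [Set.eq_empty_of_forall_notMem (s := InfPath.toBoundary ⁻¹' 𝒢.cyl u) h]
      exact isOpen_empty
    · rw [show InfPath.toBoundary ⁻¹' 𝒢.cyl u = infCyl p from Set.ext h]
      exact isOpen_infCyl p
  · obtain h | ⟨p, h⟩ := T.preimage_toBoundary_cyl u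
    · rw [Set.eq_empty_of_forall_notMem (s := InfPath.toBoundary ⁻¹' (𝒢.cyl u \ 𝒢.cyl u'))
        fun a ha => h a ha.1]
      exact isOpen_empty
    · obtain h' | ⟨q, h'⟩ := T.preimage_toBoundary_cyl u'
      · rw [show InfPath.toBoundary ⁻¹' (𝒢.cyl u \ 𝒢.cyl u') = infCyl p from
          Set.ext fun a => (and_iff_left (h' a)).trans (h a)]
        exact isOpen_infCyl p
      · rw [show InfPath.toBoundary ⁻¹' (𝒢.cyl u \ 𝒢.cyl u') = infCyl p \ infCyl q from
          Set.ext fun a => and_congr (h a) (not_congr (h' a))]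
        exact isOpen_infCyl_diff p q

/-- Conversely to the preceding continuity, each cylinder `pE_Σ^∞` is the trace of the cylinder of
the coset of `p`, so the two families of generating sets correspond. -/
theorem isInducing_toBoundary :
    Topology.IsInducing (InfPath.toBoundary : T.InfPath → 𝒢.Boundary) := by
  refine ⟨le_antisymm continuous_toBoundary.le_induced (le_generateFrom ?_)⟩
  have h : ∀ p : T.FinPath,
      infCyl p = InfPath.toBoundary ⁻¹' 𝒢.cyl (𝒢.coset (eval p.2.2)) := fun p =>
    Set.ext fun a => (a.toBoundary_mem_cyl_eval p.2.2).symm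
  rintro _ (⟨p, rfl⟩ | ⟨p, q, rfl⟩)
  · rw [h]
    exact ⟨_, 𝒢.isOpen_cyl _, rfl⟩
  · rw [h, h]
    exact ⟨_, 𝒢.isOpen_cyl_diff _ _, rfl⟩

/-- The group element at the end of a normal form does not change the coset. The condition `q(m) ≤
a` is used below in this form, which does not mention `Σ`. -/
theorem qLe_iff {x y : 𝒢.WordCat} (m : x ⟶ y) (a : T.InfPath) :
    QLe m a ↔ a.toBoundary ∈ 𝒢.cyl (cosetAt (𝒢 := 𝒢) m.1) := by
  obtain ⟨m, hm⟩ := m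
  constructor
  · rintro ⟨p, hp, ha⟩
    change IsQ m p at hp
    cases hp with
    | mk p g =>
      refine (congrArg (a.toBoundary ∈ 𝒢.cyl ·) (coset_comp_grp (eval p) g)).mpr ?_
      exact (a.toBoundary_mem_cyl_eval p).2 ha
  · intro h
    obtain ⟨p, g, rfl⟩ := T.exists_normalForm hm
    refine ⟨⟨_, _, p⟩, .mk p g, (a.toBoundary_mem_cyl_eval p).1 ?_⟩
    exact (congrArg (a.toBoundary ∈ 𝒢.cyl ·) (coset_comp_grp (eval p) g)).mp h

end Transversals

end DirGraphOfGroups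

/-! ### The action of the left inverse hull on the infinite paths -/

section Hull

variable {C : Type*} [Category C] [LeftCancellative C]

/-- The elements of the left inverse hull commute with right multiplication. -/
theorem InHull.map_comp {f : Arr C ≃. Arr C} (hf : InHull f) : ∀ {a b : Arr C}, f a = some b →
    ∃ (x y z : C) (l : x ⟶ z) (m : y ⟶ z), a = ⟨y, z, m⟩ ∧ b = ⟨x, z, l⟩ ∧
      ∀ (w : C) (n : z ⟶ w), f ⟨y, w, m ≫ n⟩ = some ⟨x, w, l ≫ n⟩ := by
  induction hf with
  | @tau x y l =>
    intro a b h
    rw [tauMap_eq_some] at h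
    obtain ⟨m⟩ := h
    refine ⟨_, _, _, _, _, rfl, rfl, fun w n => ?_⟩
    rw [tauMap_eq_some, Category.assoc]
    exact .mk _
  | @sigma x y l =>
    intro a b h
    rw [PEquiv.eq_some_iff, tauMap_eq_some] at h
    obtain ⟨m⟩ := h
    refine ⟨_, _, _, _, _, rfl, rfl, fun w n => ?_⟩
    rw [PEquiv.eq_some_iff, tauMap_eq_some, Category.assoc]
    exact .mk _
  | mul _ _ ih ih' =>
    intro a b h
    rw [PEquiv.trans_eq_some] at h
    obtain ⟨c, h1, h2⟩ := h
    obtain ⟨x, y, z, l, m, rfl, rfl, h3⟩ := ih' h1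
    obtain ⟨x', y', z', l', m', h4, rfl, h5⟩ := ih h2
    obtain ⟨rfl, h4⟩ := Sigma.mk.inj_iff.1 h4
    obtain ⟨rfl, h4⟩ := Sigma.mk.inj_iff.1 (eq_of_heq h4)
    obtain rfl := eq_of_heq h4
    refine ⟨_, _, _, _, _, rfl, rfl, fun w n => ?_⟩
    rw [PEquiv.trans_eq_some]
    exact ⟨_, h3 w n, h5 w n⟩

theorem InHull.map_comp_hom {f : Arr C ≃. Arr C} (hf : InHull f) {x y z : C} {l : x ⟶ z}
    {m : y ⟶ z} (h : f ⟨y, z, m⟩ = some ⟨x, z, l⟩) {w : C} (n : z ⟶ w) :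
    f ⟨y, w, m ≫ n⟩ = some ⟨x, w, l ≫ n⟩ := by
  obtain ⟨x', y', z', l', m', h1, h2, h3⟩ := hf.map_comp h
  obtain ⟨rfl, h1⟩ := Sigma.mk.inj_iff.1 h1
  obtain ⟨rfl, h1⟩ := Sigma.mk.inj_iff.1 (eq_of_heq h1)
  obtain rfl := eq_of_heq h1
  obtain ⟨rfl, h2⟩ := Sigma.mk.inj_iff.1 h2
  obtain rfl := eq_of_heq (Sigma.mk.inj_iff.1 (eq_of_heq h2)).2
  exact h3 w n

theorem tauSigma_eq_some {x y z : C} (l : x ⟶ z) (m : y ⟶ z) (a b : Arr C) :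
    (tauSigma l m).1 a = some b ↔
      ∃ (w : C) (n : z ⟶ w), a = ⟨y, w, m ≫ n⟩ ∧ b = ⟨x, w, l ≫ n⟩ := by
  change ((tauMap m).symm.trans (tauMap l)) a = some b ↔ _
  rw [PEquiv.trans_eq_some]
  constructor
  · rintro ⟨c, h1, h2⟩
    rw [PEquiv.eq_some_iff, tauMap_eq_some] at h1
    rw [tauMap_eq_some] at h2
    obtain ⟨n⟩ := h2
    refine ⟨_, n, ?_, rfl⟩
    exact TauRel.right_unique h1 (.mk n)
  · rintro ⟨w, n, rfl, rfl⟩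
    refine ⟨⟨z, w, n⟩, ?_, ?_⟩
    · rw [PEquiv.eq_some_iff, tauMap_eq_some]
      exact .mk n
    · rw [tauMap_eq_some]
      exact .mk n

theorem tauSigma_apply {x y z : C} (l : x ⟶ z) (m : y ⟶ z) :
    (tauSigma l m).1 ⟨y, z, m⟩ = some ⟨x, z, l⟩ :=
  (tauSigma_eq_some l m _ _).2 ⟨z, 𝟙 z, by rw [Category.comp_id], by rw [Category.comp_id]⟩

/-- The restriction of `f` to the right ideal of `m` is determined by the value at `m`, because `f`
commutes with right multiplication. -/
theorem mul_tauSigma (f : LeftInverseHull C) {x y z : C} {l : x ⟶ z} {m : y ⟶ z}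
    (h : f.1 ⟨y, z, m⟩ = some ⟨x, z, l⟩) : f * tauSigma m m = tauSigma l m := by
  apply Subtype.ext
  ext a b
  change ((tauSigma m m).1.trans f.1) a = some b ↔ (tauSigma l m).1 a = some b
  rw [PEquiv.trans_eq_some, tauSigma_eq_some]
  constructor
  · rintro ⟨c, h1, h2⟩
    obtain ⟨w, n, rfl, rfl⟩ := (tauSigma_eq_some _ _ _ _).1 h1
    rw [f.2.map_comp_hom h n] at h2
    exact ⟨w, n, rfl, (Option.some.inj h2).symm⟩
  · rintro ⟨w, n, rfl, rfl⟩
    exact ⟨_, (tauSigma_eq_some _ _ _ _).2 ⟨w, n, rfl, rfl⟩, f.2.map_comp_hom h n⟩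

end Hull

/-! ### Elements of `F(𝒢)` moving boundary points, and quotients of words -/

namespace DirGraphOfGroups

variable {V E : Type*} {𝒢 : DirGraphOfGroups V E}

/-- `γ · ξ = η` in the boundary. -/
def Moves {x y : 𝒢.FundGpd} (γ : x ⟶ y) (ξ η : 𝒢.Boundary) : Prop :=
  ∃ h : 𝒢.anchor ξ = y, 𝒢.bdAct γ ξ h = η

namespace Moves

variable {x y z : 𝒢.FundGpd} {γ : x ⟶ y} {ξ η ζ : 𝒢.Boundary}

theorem anchor_left (h : Moves γ ξ η) : 𝒢.anchor ξ = y := h.1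

theorem anchor_right (h : Moves γ ξ η) : 𝒢.anchor η = x := by
  obtain ⟨h, rfl⟩ := h
  exact 𝒢.anchor_bdAct γ ξ h

theorem inv (h : Moves γ ξ η) : Moves (Groupoid.inv γ) η ξ := by
  refine ⟨h.anchor_right, ?_⟩
  obtain ⟨h, rfl⟩ := h
  exact 𝒢.bdAct_inv_bdAct γ ξ h

theorem comp {δ : y ⟶ z} (h : Moves γ η ζ) (h' : Moves δ ξ η) : Moves (γ ≫ δ) ξ ζ := by
  refine ⟨h'.1, ?_⟩
  rw [𝒢.bdAct_comp γ δ ξ h'.1]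
  obtain ⟨h', rfl⟩ := h'
  exact h.2

theorem id (ξ : 𝒢.Boundary) (h : 𝒢.anchor ξ = x) : Moves (𝟙 x) ξ ξ := ⟨h, 𝒢.bdAct_id ξ h⟩

theorem mem_cyl {δ : y ⟶ z} (h : Moves γ ξ η) (hξ : ξ ∈ 𝒢.cyl (cosetAt δ)) :
    η ∈ 𝒢.cyl (cosetAt (γ ≫ δ)) := by
  obtain ⟨h, rfl⟩ := h
  have := 𝒢.bdAct_mem_cyl γ h rfl hξ
  exact (congrArg (𝒢.bdAct γ ξ h ∈ 𝒢.cyl ·) (𝒢.forestAct_coset γ (w := base z) δ)).mp this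

end Moves

/-- A vertex as an object of the word category. -/
def wvtx (𝒢 : DirGraphOfGroups V E) (v : V) : 𝒢.WordCat := 𝒢.vtx v

section Groupoid

variable {C : Type*} [Groupoid C] {x y z w : C}

theorem comp_inv_comp_right (l : x ⟶ z) (m : y ⟶ z) (n : z ⟶ w) :
    (l ≫ n) ≫ Groupoid.inv (m ≫ n) = l ≫ Groupoid.inv m := by
  rw [inv_comp_rev, Category.assoc, ← Category.assoc n, Groupoid.comp_inv, Category.id_comp]

theorem comp_inv_comp_comp_inv (l : x ⟶ w) (m : y ⟶ w) (n : z ⟶ w) :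
    (l ≫ Groupoid.inv m) ≫ m ≫ Groupoid.inv n = l ≫ Groupoid.inv n := by
  rw [Category.assoc, ← Category.assoc (Groupoid.inv m), Groupoid.inv_comp, Category.id_comp]

theorem inv_comp_inv (l : x ⟶ z) (m : y ⟶ z) :
    Groupoid.inv (l ≫ Groupoid.inv m) = m ≫ Groupoid.inv l := by
  rw [inv_comp_rev, inv_inv_hom]

theorem comp_inv_comp (l : x ⟶ z) (m : y ⟶ z) : (l ≫ Groupoid.inv m) ≫ m = l := by
  rw [Category.assoc, Groupoid.inv_comp, Category.comp_id]

end Groupoid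

theorem quot_comp_right {x y z w : 𝒢.WordCat} (l : x ⟶ z) (m : y ⟶ z) (n : z ⟶ w) :
    𝒢.quot (l ≫ n) (m ≫ n) = 𝒢.quot l m :=
  comp_inv_comp_right l.1 m.1 n.1

theorem quot_comp_quot {x y z w : 𝒢.WordCat} (l : x ⟶ w) (m : y ⟶ w) (n : z ⟶ w) :
    𝒢.quot l m ≫ 𝒢.quot m n = 𝒢.quot l n :=
  comp_inv_comp_comp_inv l.1 m.1 n.1

theorem inv_quot {x y z : 𝒢.WordCat} (l : x ⟶ z) (m : y ⟶ z) :
    Groupoid.inv (𝒢.quot l m) = 𝒢.quot m l :=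
  inv_comp_inv l.1 m.1

theorem quot_swap {x y z z' : 𝒢.WordCat} {l : x ⟶ z} {m : y ⟶ z} {l' : x ⟶ z'} {m' : y ⟶ z'}
    (h : 𝒢.quot l m = 𝒢.quot l' m') : 𝒢.quot m l = 𝒢.quot m' l' := by
  rw [← inv_quot l m, h, inv_quot]

theorem quot_self {x z : 𝒢.WordCat} (l : x ⟶ z) :
    𝒢.quot l l = @CategoryStruct.id 𝒢.FundGpd _ x :=
  Groupoid.comp_inv (obj := 𝒢.FundGpd) l.1

theorem quot_comp {x y z : 𝒢.WordCat} (l : x ⟶ z) (m : y ⟶ z) : 𝒢.quot l m ≫ m.1 = l.1 :=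
  comp_inv_comp l.1 m.1

theorem quot_left_injective {x y z : 𝒢.WordCat} {l l' : x ⟶ z} {m : y ⟶ z}
    (h : 𝒢.quot l m = 𝒢.quot l' m) : l = l' :=
  Subtype.ext ((quot_comp l m).symm.trans ((congrArg (· ≫ m.1) h).trans (quot_comp l' m)))

namespace Moves

variable {x y z w : 𝒢.WordCat} {l : x ⟶ w} {m : y ⟶ w} {n : z ⟶ w} {ξ η ζ : 𝒢.Boundary}

theorem mem_cyl_quot (h : Moves (𝒢.quot l m) ξ η) (hξ : ξ ∈ 𝒢.cyl (cosetAt (𝒢 := 𝒢) m.1)) :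
    η ∈ 𝒢.cyl (cosetAt (𝒢 := 𝒢) l.1) :=
  (congrArg (fun δ => η ∈ 𝒢.cyl (cosetAt δ)) (quot_comp l m)).mp (h.mem_cyl hξ)

theorem inv_quot (h : Moves (𝒢.quot l m) ξ η) : Moves (𝒢.quot m l) η ξ :=
  (congrArg (Moves · η ξ) (DirGraphOfGroups.inv_quot l m)).mp h.inv

theorem comp_quot (h : Moves (𝒢.quot l m) η ζ) (h' : Moves (𝒢.quot m n) ξ η) :
    Moves (𝒢.quot l n) ξ ζ :=
  (congrArg (Moves · ξ ζ) (quot_comp_quot l m n)).mp (h.comp h')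

end Moves

/-! ### The element of `F(𝒢)` by which a hull element acts at a path -/

namespace Transversals

variable {T : 𝒢.Transversals}

theorem InfPath.exists_init_comp (a : T.InfPath) {n k : ℕ} (h : n ≤ k) :
    ∃ q : Quiver.Path (a.vert n) (a.vert k), a.init k = (a.init n).comp q := by
  induction k, h using Nat.le_induction with
  | base => exact ⟨.nil, rfl⟩
  | succ k _ ih =>
    obtain ⟨q, hq⟩ := ih
    exact ⟨q.cons (a.edge k), by rw [InfPath.init, hq, Quiver.Path.comp_cons]⟩

/-- Words whose paths are initial subpaths of the same infinite path are comparable. -/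
theorem InfPath.comparable (a : T.InfPath) {x y z : 𝒢.WordCat} (m : x ⟶ y) (m' : x ⟶ z)
    (h : a.toBoundary ∈ 𝒢.cyl (cosetAt (𝒢 := 𝒢) m.1))
    (h' : a.toBoundary ∈ 𝒢.cyl (cosetAt (𝒢 := 𝒢) m'.1)) :
    (∃ n : y ⟶ z, m' = m ≫ n) ∨ ∃ n : z ⟶ y, m = m' ≫ n := by
  have key : ∀ {v w w' : T.EGraph} (p : Quiver.Path v w) (p' : Quiver.Path v w') (g : 𝒢.G w)
      (g' : 𝒢.G w') (i j : ℕ), i ≤ j → (⟨v, w, p⟩ : T.FinPath) = ⟨_, _, a.init i⟩ →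
      (⟨v, w', p'⟩ : T.FinPath) = ⟨_, _, a.init j⟩ →
      ∃ n : 𝒢.vtx w ⟶ 𝒢.vtx w', 𝒢.IsWord n ∧
        eval p' ≫ 𝒢.grp g' = (eval p ≫ 𝒢.grp g) ≫ n := by
    intro v w w' p p' g g' i j hij hi hj
    obtain ⟨q, hq⟩ := a.exists_init_comp hij
    obtain ⟨rfl, hi⟩ := Sigma.mk.inj_iff.1 hi
    obtain ⟨rfl, hi⟩ := Sigma.mk.inj_iff.1 (eq_of_heq hi)
    obtain rfl := eq_of_heq hi
    obtain ⟨-, hj⟩ := Sigma.mk.inj_iff.1 hj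
    obtain ⟨rfl, hj⟩ := Sigma.mk.inj_iff.1 (eq_of_heq hj)
    obtain rfl := eq_of_heq hj
    -- The segment `q` of `a` between the two initial subpaths, corrected by the final group
    -- elements of the two normal forms.
    refine ⟨Groupoid.inv (𝒢.grp g) ≫ eval q ≫ 𝒢.grp g', ?_, ?_⟩
    · refine IsWord.comp ?_ ((isWord_eval q).comp (.grp g'))
      exact (congrArg 𝒢.IsWord (inv_grp g)).mpr (.grp _)
    · rw [hq, eval_comp]
      simp only [Category.assoc]
      congr 1
      exact (((Category.assoc _ _ _).symm.trans (congrArg (· ≫ eval q ≫ 𝒢.grp g')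
        (Groupoid.comp_inv (𝒢.grp g)))).trans (Category.id_comp _)).symm
  obtain ⟨m, hm⟩ := m
  obtain ⟨m', hm'⟩ := m'
  obtain ⟨p, g, rfl⟩ := T.exists_normalForm hm
  obtain ⟨p', g', rfl⟩ := T.exists_normalForm hm'
  have h1 := (a.toBoundary_mem_cyl_eval p).1
    ((congrArg (a.toBoundary ∈ 𝒢.cyl ·) (coset_comp_grp (eval p) g)).mp h)
  have h2 := (a.toBoundary_mem_cyl_eval p').1
    ((congrArg (a.toBoundary ∈ 𝒢.cyl ·) (coset_comp_grp (eval p') g')).mp h')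
  obtain ⟨i, hi⟩ := h1
  obtain ⟨j, hj⟩ := h2
  obtain hij | hij := Nat.le_total i j
  · left
    obtain ⟨n, hn, h3⟩ := key p p' g g' i j hij hi hj
    exact ⟨⟨n, hn⟩, Subtype.ext h3⟩
  · right
    obtain ⟨n, hn, h3⟩ := key p' p g' g j i hij hj hi
    exact ⟨⟨n, hn⟩, Subtype.ext h3⟩

/-- `f` maps some word `m` with `q(m) ≤ a` to `l`, and `g = l m⁻¹` maps `a` to `b`. -/
def GermRel (f : LeftInverseHull 𝒢.WordCat) (b a : T.InfPath)
    (g : 𝒢.vtx (b.vert 0) ⟶ 𝒢.vtx (a.vert 0)) : Prop :=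
  ∃ (z : 𝒢.WordCat) (l : 𝒢.wvtx (b.vert 0) ⟶ z) (m : 𝒢.wvtx (a.vert 0) ⟶ z),
    f.1 ⟨_, z, m⟩ = some ⟨_, z, l⟩ ∧ a.toBoundary ∈ 𝒢.cyl (cosetAt (𝒢 := 𝒢) m.1) ∧
      g = 𝒢.quot l m ∧ Moves g a.toBoundary b.toBoundary

/-- The longer of `m` and `m'` serves as `k`; extending the shorter one on the right does not change
its quotient. -/
theorem exists_common {f f' : LeftInverseHull 𝒢.WordCat} {a : T.InfPath} {x x' y z z' : 𝒢.WordCat}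
    {l : x ⟶ z} {m : y ⟶ z} {l' : x' ⟶ z'} {m' : y ⟶ z'}
    (h : f.1 ⟨y, z, m⟩ = some ⟨x, z, l⟩) (h' : f'.1 ⟨y, z', m'⟩ = some ⟨x', z', l'⟩)
    (ha : a.toBoundary ∈ 𝒢.cyl (cosetAt (𝒢 := 𝒢) m.1))
    (ha' : a.toBoundary ∈ 𝒢.cyl (cosetAt (𝒢 := 𝒢) m'.1)) :
    ∃ (w : 𝒢.WordCat) (k : y ⟶ w) (i : x ⟶ w) (i' : x' ⟶ w),
      a.toBoundary ∈ 𝒢.cyl (cosetAt (𝒢 := 𝒢) k.1) ∧ f.1 ⟨y, w, k⟩ = some ⟨x, w, i⟩ ∧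
        f'.1 ⟨y, w, k⟩ = some ⟨x', w, i'⟩ ∧ 𝒢.quot i k = 𝒢.quot l m ∧
          𝒢.quot i' k = 𝒢.quot l' m' := by
  obtain ⟨n, rfl⟩ | ⟨n, rfl⟩ := a.comparable m m' ha ha'
  · exact ⟨z', m ≫ n, l ≫ n, l', ha', f.2.map_comp_hom h n, h', quot_comp_right l m n, rfl⟩
  · exact ⟨z, m' ≫ n, l, l' ≫ n, ha, h, f'.2.map_comp_hom h' n, rfl, quot_comp_right l' m' n⟩

/-- On a common word `k` both descriptions give the value of `f` at `k`. The equality is one of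
dependent pairs because the ranges `x` and `x'` are not known to agree beforehand. -/
theorem quot_unique {f : LeftInverseHull 𝒢.WordCat} {a : T.InfPath} {x x' y z z' : 𝒢.WordCat}
    {l : x ⟶ z} {m : y ⟶ z} {l' : x' ⟶ z'} {m' : y ⟶ z'}
    (h : f.1 ⟨y, z, m⟩ = some ⟨x, z, l⟩) (h' : f.1 ⟨y, z', m'⟩ = some ⟨x', z', l'⟩)
    (ha : a.toBoundary ∈ 𝒢.cyl (cosetAt (𝒢 := 𝒢) m.1))
    (ha' : a.toBoundary ∈ 𝒢.cyl (cosetAt (𝒢 := 𝒢) m'.1)) :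
    (⟨x, 𝒢.quot l m⟩ : Σ x : 𝒢.FundGpd, @Quiver.Hom 𝒢.FundGpd _ x y) = ⟨x', 𝒢.quot l' m'⟩ := by
  obtain ⟨w, k, i, i', -, h1, h2, h3, h4⟩ := exists_common h h' ha ha'
  rw [h1] at h2
  obtain ⟨rfl, h5⟩ := Sigma.mk.inj_iff.1 (Option.some.inj h2)
  obtain rfl := eq_of_heq (Sigma.mk.inj_iff.1 (eq_of_heq h5)).2
  rw [← h3, ← h4]

namespace GermRel

variable {f f' : LeftInverseHull 𝒢.WordCat} {a b c : T.InfPath}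
  {g : 𝒢.vtx (b.vert 0) ⟶ 𝒢.vtx (a.vert 0)}

theorem moves (h : GermRel f b a g) : Moves g a.toBoundary b.toBoundary := by
  obtain ⟨_, _, _, _, _, _, h⟩ := h
  exact h

theorem unique {g' : 𝒢.vtx (b.vert 0) ⟶ 𝒢.vtx (a.vert 0)} (h : GermRel f b a g)
    (h' : GermRel f b a g') : g = g' := by
  obtain ⟨z, l, m, h1, h2, rfl, -⟩ := h
  obtain ⟨z', l', m', h1', h2', rfl, -⟩ := h'
  exact eq_of_heq (Sigma.mk.inj_iff.1 (quot_unique h1 h1' h2 h2')).2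

theorem right_unique {b' : T.InfPath} {g' : 𝒢.vtx (b'.vert 0) ⟶ 𝒢.vtx (a.vert 0)}
    (h : GermRel f b a g) (h' : GermRel f b' a g') : b = b' := by
  obtain ⟨z, l, m, h1, h2, rfl, ha, h3⟩ := h
  obtain ⟨z', l', m', h1', h2', rfl, ha', h3'⟩ := h'
  apply InfPath.toBoundary_injective
  rw [← h3, ← h3']
  exact congrArg (fun s : Σ x : 𝒢.FundGpd, x ⟶ 𝒢.vtx (a.vert 0) => 𝒢.bdAct s.2 a.toBoundary ha)
    (quot_unique h1 h1' h2 h2')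

theorem inv (h : GermRel f b a g) : GermRel f⁻¹ a b (Groupoid.inv g) := by
  obtain ⟨z, l, m, h1, h2, rfl, h3⟩ := h
  refine ⟨z, m, l, ?_, ?_, inv_quot l m, h3.inv⟩
  · change f.1.symm _ = _
    rw [PEquiv.eq_some_iff]
    exact h1
  · exact h3.mem_cyl_quot h2

/-- Near `b` both `f⁻¹` and `f'` are described on a common word `k`. With `i = f⁻¹(k)` and `i' =
f'(k)`, the product maps `i` to `i'`, and `i'i⁻¹ = (i'k⁻¹)(ki⁻¹)`. -/
theorem mul {g' : 𝒢.vtx (c.vert 0) ⟶ 𝒢.vtx (b.vert 0)} (h' : GermRel f' c b g')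
    (h : GermRel f b a g) : GermRel (f' * f) c a (g' ≫ g) := by
  have hm := h'.moves.comp h.moves
  obtain ⟨z, l, m, h1, h2, rfl, h3⟩ := h
  obtain ⟨z', l', m', h1', h2', rfl, h3'⟩ := h'
  have h4 : f⁻¹.1 ⟨_, z, l⟩ = some ⟨_, z, m⟩ := (PEquiv.eq_some_iff _).2 h1
  obtain ⟨w, k, i, i', hk, hi, hi', hq, hq'⟩ := exists_common h4 h1' (h3.mem_cyl_quot h2) h2'
  have hq2 := quot_swap hq
  refine ⟨w, i', i, ?_, ?_, ?_, hm⟩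
  · change (f.1.trans f'.1) _ = _
    rw [PEquiv.trans_eq_some]
    exact ⟨_, (PEquiv.eq_some_iff _).1 hi, hi'⟩
  · have h5 : Moves (𝒢.quot k i) a.toBoundary b.toBoundary :=
      (congrArg (Moves · a.toBoundary b.toBoundary) hq2).mpr h3
    exact h5.inv_quot.mem_cyl_quot hk
  · rw [← hq2, ← hq']
    exact quot_comp_quot i' k i

end GermRel

/-- If `k = f(m)` is the intermediate word, then the intermediate point `km⁻¹ · a` lies in `Z(k)`,
hence in `E_Σ^∞`. -/
theorem exists_germRel_mul {f f' : LeftInverseHull 𝒢.WordCat} {a c : T.InfPath}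
    {g : 𝒢.vtx (c.vert 0) ⟶ 𝒢.vtx (a.vert 0)} (h : GermRel (f' * f) c a g) :
    ∃ (b : T.InfPath) (g₁ : 𝒢.vtx (b.vert 0) ⟶ 𝒢.vtx (a.vert 0))
      (g₂ : 𝒢.vtx (c.vert 0) ⟶ 𝒢.vtx (b.vert 0)), GermRel f b a g₁ ∧ GermRel f' c b g₂ := by
  obtain ⟨z, l, m, h1, h2, rfl, h3⟩ := h
  obtain ⟨d, h4, h5⟩ := (PEquiv.trans_eq_some f.1 f'.1 _ _).1 h1
  obtain ⟨x, y, z', k, m', h6, rfl, -⟩ := f.2.map_comp h4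
  obtain ⟨rfl, h6⟩ := Sigma.mk.inj_iff.1 h6
  obtain ⟨rfl, h6⟩ := Sigma.mk.inj_iff.1 (eq_of_heq h6)
  obtain rfl := eq_of_heq h6
  have h7 : Moves (𝒢.quot k m) a.toBoundary (𝒢.bdAct (𝒢.quot k m) a.toBoundary rfl) := ⟨rfl, rfl⟩
  have h8 := h7.mem_cyl_quot h2
  obtain ⟨b, hb⟩ := T.exists_infPath_of_mem_cyl_word k.2 h8
  rw [← hb] at h7 h8
  obtain rfl : 𝒢.wvtx (b.vert 0) = x := h7.anchor_right
  refine ⟨b, 𝒢.quot k m, 𝒢.quot l k, ⟨z, k, m, h4, h2, rfl, h7⟩, ⟨z, l, k, h5, h8, rfl, ?_⟩⟩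
  exact h3.comp_quot h7.inv_quot

open Classical in
/-- The partial map of `E_Σ^∞` given by an element of the left inverse hull. -/
noncomputable def hullFun (f : LeftInverseHull 𝒢.WordCat) (a : T.InfPath) : Option T.InfPath :=
  if h : ∃ b, ∃ g : 𝒢.vtx (b.vert 0) ⟶ 𝒢.vtx (a.vert 0), GermRel f b a g then some h.choose
  else none

theorem hullFun_eq_some {f : LeftInverseHull 𝒢.WordCat} {a b : T.InfPath} :
    hullFun f a = some b ↔ ∃ g, GermRel f b a g := by
  rw [hullFun]
  constructor
  · intro h
    split_ifs at h with h1
    have h2 := h1.choose_spec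
    rwa [Option.some.inj h] at h2
  · rintro ⟨g, h⟩
    have h2 : ∃ b, ∃ g : 𝒢.vtx (b.vert 0) ⟶ 𝒢.vtx (a.vert 0), GermRel f b a g := ⟨b, g, h⟩
    rw [dif_pos h2]
    obtain ⟨g', h'⟩ := h2.choose_spec
    exact congrArg some (h'.right_unique h)

/-- The partial bijection of `E_Σ^∞` given by an element of the left inverse hull. -/
noncomputable def hullMap (f : LeftInverseHull 𝒢.WordCat) : T.InfPath ≃. T.InfPath where
  toFun := hullFun f
  invFun := hullFun f⁻¹
  inv a b := by
    change hullFun f⁻¹ b = some a ↔ hullFun f a = some b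
    rw [hullFun_eq_some, hullFun_eq_some]
    constructor
    · rintro ⟨g, h⟩
      have := h.inv
      rw [InvSemigroup.inv_inv'] at this
      exact ⟨_, this⟩
    · rintro ⟨g, h⟩
      exact ⟨_, h.inv⟩

theorem hullMap_eq_some {f : LeftInverseHull 𝒢.WordCat} {a b : T.InfPath} :
    hullMap f a = some b ↔ ∃ g, GermRel f b a g :=
  hullFun_eq_some

theorem germRel_of_moves {f : LeftInverseHull 𝒢.WordCat} {a b : T.InfPath} {x y z : 𝒢.WordCat}
    {l : x ⟶ z} {m : y ⟶ z} (h : f.1 ⟨y, z, m⟩ = some ⟨x, z, l⟩)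
    (ha : a.toBoundary ∈ 𝒢.cyl (cosetAt (𝒢 := 𝒢) m.1))
    (hm : Moves (𝒢.quot l m) a.toBoundary b.toBoundary) :
    ∃ g, GermRel f b a g ∧ (⟨_, _, g⟩ : Arr 𝒢.FundGpd) = ⟨x, y, 𝒢.quot l m⟩ := by
  obtain rfl : 𝒢.wvtx (b.vert 0) = x := hm.anchor_right
  obtain rfl : 𝒢.wvtx (a.vert 0) = y := hm.anchor_left
  exact ⟨𝒢.quot l m, ⟨z, l, m, h, ha, rfl, hm⟩, rfl⟩

/-- For fixed `l` and `m`, the paths on which `f` acts by `l m⁻¹` form an open set. -/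
theorem exists_nhd_of_germRel {f : LeftInverseHull 𝒢.WordCat} {a b : T.InfPath}
    {g : 𝒢.vtx (b.vert 0) ⟶ 𝒢.vtx (a.vert 0)} (h : GermRel f b a g) :
    ∃ U : Set T.InfPath, IsOpen U ∧ a ∈ U ∧ ∀ a' ∈ U, (∃ b' : T.InfPath,
      Moves g a'.toBoundary b'.toBoundary) ∧ ∀ b' : T.InfPath,
        Moves g a'.toBoundary b'.toBoundary → ∃ g', GermRel f b' a' g' ∧
          (⟨_, _, g'⟩ : Arr 𝒢.FundGpd) = ⟨_, _, g⟩ := by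
  obtain ⟨z, l, m, h1, h2, rfl, h3⟩ := h
  refine ⟨InfPath.toBoundary ⁻¹' 𝒢.cyl (cosetAt (𝒢 := 𝒢) m.1),
    (𝒢.isOpen_cyl _).preimage continuous_toBoundary, h2, fun a' ha' => ⟨?_, fun b' hb' => ?_⟩⟩
  · have h4 : 𝒢.anchor a'.toBoundary = 𝒢.wvtx (a.vert 0) := 𝒢.anchor_of_mem_cyl ha'
    have h5 : Moves (𝒢.quot l m) a'.toBoundary _ := ⟨h4, rfl⟩
    have h6 := h5.mem_cyl_quot ha'
    obtain ⟨b', hb'⟩ := T.exists_infPath_of_mem_cyl_word l.2 h6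
    exact ⟨b', by rwa [hb']⟩
  · exact germRel_of_moves h1 ha' hb'

/-- Near `a` the map is the action of one fixed `g` on the boundary, and `E_Σ^∞` has the induced
topology. -/
theorem continuous_hullMap (f : LeftInverseHull 𝒢.WordCat) :
    Continuous fun a : {a : T.InfPath // (hullMap f a).isSome} => (hullMap f a.1).get a.2 := by
  rw [isInducing_toBoundary.continuous_iff, continuous_iff_continuousAt]
  rintro ⟨a, ha⟩
  obtain ⟨b, hb⟩ := Option.isSome_iff_exists.1 ha
  obtain ⟨g, hg⟩ := hullMap_eq_some.1 hb
  obtain ⟨U, hU, haU, h⟩ := exists_nhd_of_germRel hg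
  have hU' : IsOpen {a : {a : T.InfPath // (hullMap f a).isSome} | a.1 ∈ U} :=
    hU.preimage continuous_subtype_val
  refine ContinuousOn.continuousAt ?_ (hU'.mem_nhds haU)
  rw [continuousOn_iff_continuous_domRestrict]
  have hm : ∀ a' : {a : {a : T.InfPath // (hullMap f a).isSome} | a.1 ∈ U},
      Moves g a'.1.1.toBoundary ((hullMap f a'.1.1).get a'.1.2).toBoundary := by
    rintro ⟨⟨a', ha'⟩, haU'⟩
    obtain ⟨⟨b', hb'⟩, h2⟩ := h a' haU'
    obtain ⟨g', hg', -⟩ := h2 b' hb'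
    have h3 := hullMap_eq_some.2 ⟨g', hg'⟩
    have h4 : (hullMap f a').get ha' = b' := Option.get_of_eq_some ha' h3
    change Moves g a'.toBoundary ((hullMap f a').get ha').toBoundary
    rwa [h4]
  have hk : Continuous fun a' : {a : {a : T.InfPath // (hullMap f a).isSome} | a.1 ∈ U} =>
      (⟨a'.1.1.toBoundary, (hm a').1⟩ : {ξ : 𝒢.Boundary // 𝒢.anchor ξ = 𝒢.vtx (a.vert 0)}) :=
    (continuous_toBoundary.comp (continuous_subtype_val.comp continuous_subtype_val)).subtype_mk _
  have hc := (𝒢.continuous_bdAct g).comp hk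
  convert hc using 1
  funext a'
  exact (hm a').2.symm

theorem hullMap_covers (a : T.InfPath) :
    ∃ f : LeftInverseHull 𝒢.WordCat, (hullMap f a).isSome := by
  refine ⟨tauSigma (𝟙 (𝒢.wvtx (a.vert 0))) (𝟙 _), Option.isSome_iff_exists.2 ⟨a, ?_⟩⟩
  refine hullMap_eq_some.2 ⟨_, _, _, _, tauSigma_apply _ _, a.toBoundary_mem_cyl_init 0, rfl, ?_⟩
  rw [quot_self]
  exact Moves.id _ rfl

/-- The action of the left inverse hull on `E_Σ^∞`. -/
noncomputable def hullAction (T : 𝒢.Transversals) :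
    InvSemigroupAction (LeftInverseHull 𝒢.WordCat) T.InfPath where
  φ := hullMap
  map_inv f := by
    ext b a
    rw [PEquiv.eq_some_iff, hullMap_eq_some, hullMap_eq_some]
    constructor
    · rintro ⟨g, h⟩
      have := h.inv
      rw [InvSemigroup.inv_inv'] at this
      exact ⟨_, this⟩
    · rintro ⟨g, h⟩
      exact ⟨_, h.inv⟩
  map_mul f f' := by
    ext a c
    rw [PEquiv.trans_eq_some, hullMap_eq_some]
    constructor
    · rintro ⟨g, h⟩
      obtain ⟨b, g₁, g₂, h1, h2⟩ := exists_germRel_mul h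
      exact ⟨b, hullMap_eq_some.2 ⟨g₁, h1⟩, hullMap_eq_some.2 ⟨g₂, h2⟩⟩
    · rintro ⟨b, h1, h2⟩
      obtain ⟨g₁, h1⟩ := hullMap_eq_some.1 h1
      obtain ⟨g₂, h2⟩ := hullMap_eq_some.1 h2
      exact ⟨_, h2.mul h1⟩
  continuous := continuous_hullMap
  covers := hullMap_covers

/-- The pairs in the graph of `τ^l σ^m` are the `(mn, ln)`, and `n` cancels in the quotient. -/
theorem germRel_tauSigma {x y z : 𝒢.WordCat} {l : x ⟶ z} {m : y ⟶ z} {a b : T.InfPath}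
    {g : 𝒢.vtx (b.vert 0) ⟶ 𝒢.vtx (a.vert 0)} (h : GermRel (tauSigma l m) b a g) :
    QLe m a ∧ (⟨_, _, g⟩ : Arr 𝒢.FundGpd) = ⟨x, y, 𝒢.quot l m⟩ := by
  obtain ⟨z', l', m', h1, h2, rfl, -⟩ := h
  -- The units are replaced by variables, so that the equalities of dependent pairs can be
  -- eliminated by substitution.
  suffices key : ∀ {x' y' : 𝒢.WordCat} (l' : x' ⟶ z') (m' : y' ⟶ z'),
      (tauSigma l m).1 ⟨y', z', m'⟩ = some ⟨x', z', l'⟩ →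
      a.toBoundary ∈ 𝒢.cyl (cosetAt (𝒢 := 𝒢) m'.1) →
      QLe m a ∧ (⟨x', y', 𝒢.quot l' m'⟩ : Arr 𝒢.FundGpd) = ⟨x, y, 𝒢.quot l m⟩ from key l' m' h1 h2
  intro x' y' l' m' h1 h2
  obtain ⟨w, n, h4, h5⟩ := (tauSigma_eq_some _ _ _ _).1 h1
  obtain ⟨rfl, h4⟩ := Sigma.mk.inj_iff.1 h4
  obtain ⟨rfl, h4⟩ := Sigma.mk.inj_iff.1 (eq_of_heq h4)
  obtain rfl := eq_of_heq h4
  obtain ⟨rfl, h5⟩ := Sigma.mk.inj_iff.1 h5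
  obtain rfl := eq_of_heq (Sigma.mk.inj_iff.1 (eq_of_heq h5)).2
  exact ⟨(qLe_iff m a).2 (cyl_comp_subset n.2 _ h2), by rw [quot_comp_right]⟩

theorem isWordAction_hullAction (T : 𝒢.Transversals) (hs : 𝒢.NoSources) :
    T.IsWordAction hs T.hullAction := by
  intro x y z l m a b
  constructor
  · intro h
    obtain ⟨g, h⟩ := hullMap_eq_some.1 h
    obtain ⟨h1, h2⟩ := germRel_tauSigma h
    refine ⟨h1, ?_⟩
    have h3 := h.moves
    have key : ∀ s t : Arr 𝒢.FundGpd, s = t → Moves s.2.2 a.toBoundary b.toBoundary →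
        Moves t.2.2 a.toBoundary b.toBoundary := by
      rintro s t rfl h
      exact h
    exact key _ _ h2 h3
  · rintro ⟨h1, h2⟩
    obtain ⟨g, hg, -⟩ := germRel_of_moves (tauSigma_apply l m) ((qLe_iff m a).1 h1) h2
    exact hullMap_eq_some.2 ⟨g, hg⟩

end Transversals

end DirGraphOfGroups

/-! ### The groupoid of germs -/

theorem arrMap_bijective {C D : Type*} [Category C] [Category D] (F : C ⥤ D)
    (hF : Function.Bijective F.obj) [F.Full] [F.Faithful] : Function.Bijective (arrMap F) := by
  constructor
  · rintro ⟨x, y, f⟩ ⟨x', y', f'⟩ h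
    obtain ⟨h1, h⟩ := Sigma.mk.inj_iff.1 h
    obtain rfl := hF.1 h1
    obtain ⟨h1, h⟩ := Sigma.mk.inj_iff.1 (eq_of_heq h)
    obtain rfl := hF.1 h1
    obtain rfl := F.map_injective (eq_of_heq h)
    rfl
  · rintro ⟨x, y, f⟩
    obtain ⟨x, rfl⟩ := hF.2 x
    obtain ⟨y, rfl⟩ := hF.2 y
    obtain ⟨f, rfl⟩ := F.map_surjective f
    exact ⟨⟨x, y, f⟩, rfl⟩

/-! ### The isomorphism of groupoids -/

namespace DirGraphOfGroups

variable {V E : Type*} {𝒢 : DirGraphOfGroups V E}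

namespace Transversals

variable {T : 𝒢.Transversals}

/-- By multiplicativity and uniqueness `gg = g`, and the only idempotents of a groupoid are the
units. -/
theorem GermRel.eq_id {e : LeftInverseHull 𝒢.WordCat} (he : e * e = e) {a : T.InfPath}
    {g : 𝒢.vtx (a.vert 0) ⟶ 𝒢.vtx (a.vert 0)} (h : GermRel e a a g) : g = 𝟙 _ := by
  have h1 := h.mul h
  rw [he] at h1
  have h2 := h1.unique h
  rw [← cancel_epi g, Category.comp_id]
  exact h2

/-- The element of `F(𝒢)` by which `f` acts near `a`. -/
noncomputable def germVal {f : LeftInverseHull 𝒢.WordCat} {a b : T.InfPath}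
    (h : T.hullAction.φ f a = some b) : 𝒢.vtx (b.vert 0) ⟶ 𝒢.vtx (a.vert 0) :=
  (hullMap_eq_some.1 h).choose

theorem germRel_germVal {f : LeftInverseHull 𝒢.WordCat} {a b : T.InfPath}
    (h : T.hullAction.φ f a = some b) : GermRel f b a (germVal h) :=
  (hullMap_eq_some.1 h).choose_spec

/-- Multiplication by an idempotent defined at `a` does not affect the element of `F(𝒢)`, so this
element depends only on the germ. -/
theorem germVal_mul_idem {f e : LeftInverseHull 𝒢.WordCat} (he : e * e = e) {a b : T.InfPath}
    (h : T.hullAction.φ f a = some b) (ha : T.hullAction.φ e a = some a) :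
    GermRel (f * e) b a (germVal h) := by
  have h1 := (germRel_germVal h).mul (germRel_germVal ha)
  rw [(germRel_germVal ha).eq_id he] at h1
  exact (congrArg (GermRel (f * e) b a) (Category.comp_id (germVal h))).mp h1

/-- The element of `F(𝒢)` by which a germ acts. -/
noncomputable def germMap (T : 𝒢.Transversals) (b a : T.InfPath) :
    T.hullAction.GermHom b a → (𝒢.vtx (b.vert 0) ⟶ 𝒢.vtx (a.vert 0)) :=
  Quotient.lift (fun s => germVal s.2) (by
    rintro ⟨s, hs⟩ ⟨t, ht⟩ ⟨e, he, hea, h⟩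
    have hea' := T.hullAction.idem_apply he hea
    have h1 := germVal_mul_idem he hs hea'
    have h2 := germVal_mul_idem he ht hea'
    change s * e = t * e at h
    rw [h] at h1
    exact h1.unique h2)

theorem germRel_germMap {f : LeftInverseHull 𝒢.WordCat} {a b : T.InfPath}
    (h : T.hullAction.φ f a = some b) :
    GermRel f b a (T.germMap b a (T.hullAction.mkGerm f h)) :=
  germRel_germVal h

theorem germMap_moves {a b : T.InfPath} (s : T.hullAction.GermHom b a) :
    Moves (T.germMap b a s) a.toBoundary b.toBoundary := by
  induction s using T.hullAction.germ_ind with | h f hf => ?_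
  exact (germRel_germMap hf).moves

theorem germMap_mul {a b c : T.InfPath} (s : T.hullAction.GermHom c b)
    (t : T.hullAction.GermHom b a) :
    T.germMap c a (T.hullAction.germMul s t) = T.germMap c b s ≫ T.germMap b a t := by
  induction s using T.hullAction.germ_ind with | h f hf => ?_
  induction t using T.hullAction.germ_ind with | h f' hf' => ?_
  exact (germRel_germMap (T.hullAction.map_mul_eq_some hf' hf)).unique
    ((germRel_germMap hf).mul (germRel_germMap hf'))

theorem germMap_id (a : T.InfPath) : T.germMap a a (T.hullAction.germId a) = 𝟙 _ :=
  (germRel_germMap (T.hullAction.elemAt_apply a)).eq_id (InvSemigroup.idem_inv_mul _)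

/-- The germs of `f` and `f'` at `a` agree if `f` and `f'` act in the same way near `a`. -/
theorem germMap_injective (b a : T.InfPath) : Function.Injective (T.germMap b a) := by
  intro s t hst
  induction s using T.hullAction.germ_ind with | h f hf => ?_
  induction t using T.hullAction.germ_ind with | h f' hf' => ?_
  have h1 := germRel_germMap hf
  have h2 := germRel_germMap hf'
  rw [hst] at h1
  generalize T.germMap b a (T.hullAction.mkGerm f' hf') = g at h1 h2
  obtain ⟨z, l, m, h1, ha, hg, -⟩ := h1
  obtain ⟨z', l', m', h1', ha', hg', -⟩ := h2
  obtain ⟨w, k, i, i', hk, hi, hi', hq, hq'⟩ := exists_common h1 h1' ha ha'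
  have hii : i = i' := quot_left_injective (hq.trans (hg.symm.trans (hg'.trans hq'.symm)))
  subst hii
  have hkk := tauSigma_apply k k
  -- The idempotent `τ^k σ^k` is defined at `a`, and multiplying either `f` or `f'` by it on the
  -- right gives `τ^i σ^k`.
  refine T.hullAction.mkGerm_eq (tauSigma k k) (mul_tauSigma _ hkk) ?_ ?_
  · refine hullMap_eq_some.2 ⟨_, w, k, k, hkk, hk, rfl, ?_⟩
    rw [quot_self]
    exact Moves.id _ rfl
  · rw [mul_tauSigma f hi, mul_tauSigma f' hi']

/-- As `a` lies in the cylinder of its range vertex, `b = g · a` lies in the cylinder of the coset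
of `g`. So `gm` is an initial subpath `p` of `b` for some word `m`, and the germ of `τ^p σ^m` at `a`
is the required one. -/
theorem exists_germ (b a : T.InfPath) (g : 𝒢.vtx (b.vert 0) ⟶ 𝒢.vtx (a.vert 0))
    (h : Moves g a.toBoundary b.toBoundary) : ∃ s, T.germMap b a s = g := by
  have h1 := h.mem_cyl (δ := 𝟙 _) (a.toBoundary_mem_cyl_init 0)
  rw [Category.comp_id] at h1
  obtain ⟨w, p, m, hm, hp, hb⟩ := (b.toBoundary_mem_cyl_iff g).1 h1
  have hg : g = eval p ≫ Groupoid.inv m := by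
    rw [← hp, Category.assoc, Groupoid.comp_inv, Category.comp_id]
  let l' : 𝒢.wvtx (b.vert 0) ⟶ 𝒢.wvtx w := ⟨eval p, isWord_eval p⟩
  let m' : 𝒢.wvtx (a.vert 0) ⟶ 𝒢.wvtx w := ⟨m, hm⟩
  have hq : g = 𝒢.quot l' m' := hg
  have h2 : Moves (𝒢.quot l' m') a.toBoundary b.toBoundary :=
    (congrArg (Moves · a.toBoundary b.toBoundary) hq).mp h
  have hb' : b.toBoundary ∈ 𝒢.cyl (cosetAt (𝒢 := 𝒢) l'.1) := b.toBoundary_mem_cyl_of_extends hb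
  have h3 : GermRel (tauSigma l' m') b a g :=
    ⟨_, l', m', tauSigma_apply l' m', h2.inv_quot.mem_cyl_quot hb', hq, h⟩
  have h4 : T.hullAction.φ (tauSigma l' m') a = some b := hullMap_eq_some.2 ⟨g, h3⟩
  exact ⟨T.hullAction.mkGerm _ h4, (germRel_germMap h4).unique h3⟩

/-- The map `[f, a] ↦ (g, a)`, where `f` acts by `g` near `a`. -/
noncomputable def germFunctor (T : 𝒢.Transversals) (hs : 𝒢.NoSources) :
    GermGroupoid T.hullAction ⥤ Restriction (T.pathUnits hs) where
  obj a := ⟨InfPath.toBoundary a, a, rfl⟩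
  map {b a} s := ⟨T.germMap b a s, (germMap_moves (b := b) (a := a) s).2⟩
  map_id a := Subtype.ext (germMap_id (T := T) a)
  map_comp {c b a} s t := Subtype.ext (germMap_mul (T := T) (c := c) (b := b) (a := a) s t)

theorem germFunctor_bijective (T : 𝒢.Transversals) (hs : 𝒢.NoSources) :
    Function.Bijective (arrMap (T.germFunctor hs)) := by
  have : (T.germFunctor hs).Faithful :=
    ⟨fun {b a} _ _ h => germMap_injective (T := T) b a (congrArg Subtype.val h)⟩
  have : (T.germFunctor hs).Full := ⟨fun {b a} g => by
    obtain ⟨s, hs⟩ := exists_germ (T := T) b a g.1 ⟨rfl, g.2⟩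
    exact ⟨s, Subtype.ext hs⟩⟩
  refine arrMap_bijective _ ⟨fun a b h => ?_, ?_⟩
  · exact InfPath.toBoundary_injective (congrArg Subtype.val h)
  · rintro ⟨_, a, rfl⟩
    exact ⟨a, rfl⟩

/-- A germ as a pair in `F(𝒢) × ∂W`. -/
theorem pair_germFunctor (T : 𝒢.Transversals) (hs : 𝒢.NoSources) {a b : T.InfPath}
    (s : T.hullAction.GermHom b a) :
    (𝒢.boundaryAction hs).pair (Restriction.incl (arrMap (T.germFunctor hs)
      (⟨b, a, s⟩ : Arr (GermGroupoid T.hullAction)))) =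
      (⟨_, _, T.germMap b a s⟩, a.toBoundary) := rfl

/-! ### Comparison of the topologies -/

theorem isOpen_domain (f : LeftInverseHull 𝒢.WordCat) :
    IsOpen {a : T.InfPath | (T.hullAction.φ f a).isSome} := by
  rw [isOpen_iff_forall_mem_open]
  intro a ha
  obtain ⟨b, hb⟩ := Option.isSome_iff_exists.1 ha
  obtain ⟨U, hU, haU, h⟩ := exists_nhd_of_germRel (germRel_germVal hb)
  refine ⟨U, fun a' ha' => ?_, hU, haU⟩
  obtain ⟨⟨b', hb'⟩, h2⟩ := h a' ha'
  obtain ⟨g', hg', -⟩ := h2 b' hb'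
  exact Option.isSome_iff_exists.2 ⟨b', hullMap_eq_some.2 ⟨g', hg'⟩⟩

/-- The generating sets require `U` to lie in the domain of `f`; intersecting with the open domain
loses no germ. -/
theorem isOpen_germSet (f : LeftInverseHull 𝒢.WordCat) {U : Set T.InfPath} (hU : IsOpen U) :
    IsOpen (GermGroupoid.germSet T.hullAction f U) := by
  have h : GermGroupoid.germSet T.hullAction f U = GermGroupoid.germSet T.hullAction f
      (U ∩ {a : T.InfPath | (T.hullAction.φ f a).isSome}) := by
    ext s
    constructor
    · rintro ⟨b, a, h, ha, rfl⟩
      exact ⟨b, a, h, ⟨ha, Option.isSome_iff_exists.2 ⟨b, h⟩⟩, rfl⟩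
    · rintro ⟨b, a, h, ha, rfl⟩
      exact ⟨b, a, h, ha.1, rfl⟩
  rw [h]
  exact TopologicalSpace.isOpen_generateFrom_of_mem
    ⟨f, _, hU.inter (isOpen_domain f), fun a ha => ha.2, rfl⟩

/-- The source of a germ. -/
def germSource (T : 𝒢.Transversals) (s : Arr (GermGroupoid T.hullAction)) : T.InfPath :=
  s.2.1

theorem continuous_germSource (T : 𝒢.Transversals) : Continuous T.germSource := by
  refine ⟨fun U hU => ?_⟩
  have h : T.germSource ⁻¹' U =
      ⋃ f, GermGroupoid.germSet T.hullAction f U := by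
    ext ⟨b, a, s⟩
    rw [Set.mem_iUnion]
    constructor
    · intro ha
      change T.hullAction.GermHom b a at s
      induction s using T.hullAction.germ_ind with | h f hf => ?_
      exact ⟨f, b, a, hf, ha, rfl⟩
    · rintro ⟨f, b', a', hf, ha, h⟩
      obtain ⟨rfl, h⟩ := Sigma.mk.inj_iff.1 h
      obtain ⟨rfl, h⟩ := Sigma.mk.inj_iff.1 (eq_of_heq h)
      exact ha
  rw [h]
  exact isOpen_iUnion fun f => isOpen_germSet f hU

/-- The element of `F(𝒢)` by which a germ acts is locally constant. -/
theorem isOpen_germMap_fiber (T : 𝒢.Transversals) (γ : Arr 𝒢.FundGpd) :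
    IsOpen {s : Arr (GermGroupoid T.hullAction) |
      (⟨_, _, T.germMap s.1 s.2.1 s.2.2⟩ : Arr 𝒢.FundGpd) = γ} := by
  rw [isOpen_iff_forall_mem_open]
  rintro ⟨b, a, s⟩ hs
  change T.hullAction.GermHom b a at s
  induction s using T.hullAction.germ_ind with | h f hf => ?_
  obtain ⟨U, hU, haU, h⟩ := exists_nhd_of_germRel (germRel_germMap hf)
  refine ⟨GermGroupoid.germSet T.hullAction f U, ?_, isOpen_germSet f hU, ⟨b, a, hf, haU, rfl⟩⟩
  rintro _ ⟨b', a', hf', ha', rfl⟩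
  obtain ⟨⟨b'', hb''⟩, h2⟩ := h a' ha'
  obtain ⟨g', hg', h3⟩ := h2 b'' hb''
  have h4 := germRel_germMap hf'
  obtain rfl := h4.right_unique hg'
  rw [← h4.unique hg'] at h3
  exact h3.trans hs

theorem continuous_germFunctor (T : 𝒢.Transversals) (hs : 𝒢.NoSources) :
    Continuous (arrMap (T.germFunctor hs)) := by
  refine continuous_induced_rng.2 (continuous_induced_rng.2 ?_)
  let _ : TopologicalSpace (Arr 𝒢.FundGpd) := ⊥
  have : DiscreteTopology (Arr 𝒢.FundGpd) := ⟨rfl⟩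
  refine Continuous.prodMk ?_ ?_
  · exact continuous_discrete_rng.2 fun γ => T.isOpen_germMap_fiber γ
  · exact continuous_toBoundary.comp T.continuous_germSource

/-- Let `γ` be the element by which `f` acts at `a`, and `O` an open set of the boundary whose trace
is `U ∩ U'`, where `f` acts by `γ` on `U'`. Each arrow in the neighbourhood given by `{γ} × O` is
`(γ, a')` with `a'` in `U ∩ U'`, hence the image of the germ of `f` at `a'`. -/
theorem isOpen_image_germSet (hs : 𝒢.NoSources) (f : LeftInverseHull 𝒢.WordCat)
    {U : Set T.InfPath} (hU : IsOpen U) :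
    IsOpen (arrMap (T.germFunctor hs) '' GermGroupoid.germSet T.hullAction f U) := by
  rw [isOpen_iff_forall_mem_open]
  rintro _ ⟨_, ⟨b, a, hf, ha, rfl⟩, rfl⟩
  obtain ⟨U', hU', haU', h⟩ := exists_nhd_of_germRel (germRel_germMap hf)
  obtain ⟨O, hO, hOU⟩ := isInducing_toBoundary.isOpen_iff.1 (hU.inter hU')
  have hmem : ∀ a' : T.InfPath, a'.toBoundary ∈ O ↔ a' ∈ U ∧ a' ∈ U' := fun a' =>
    (Set.ext_iff.1 hOU a')
  let _ : TopologicalSpace (Arr 𝒢.FundGpd) := ⊥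
  have : DiscreteTopology (Arr 𝒢.FundGpd) := ⟨rfl⟩
  let γ : Arr 𝒢.FundGpd := ⟨_, _, T.germMap b a (T.hullAction.mkGerm f hf)⟩
  refine ⟨(fun t => (𝒢.boundaryAction hs).pair (Restriction.incl t)) ⁻¹' ({γ} ×ˢ O), ?_,
    ⟨_, ⟨_, ((isOpen_discrete {γ}).prod hO), rfl⟩, rfl⟩, ⟨rfl, (hmem a).2 ⟨ha, haU'⟩⟩⟩
  intro t ht
  obtain ⟨⟨b', a', s⟩, rfl⟩ := (T.germFunctor_bijective hs).2 t
  change T.hullAction.GermHom b' a' at s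
  obtain ⟨h1, h2⟩ := ht
  have h3 : (⟨_, _, T.germMap b' a' s⟩ : Arr 𝒢.FundGpd) = γ := h1
  obtain ⟨haU, haU'⟩ := (hmem a').1 h2
  have key : ∀ δ δ' : Arr 𝒢.FundGpd, δ = δ' →
      Moves δ.2.2 (InfPath.toBoundary (T := T) a') (InfPath.toBoundary (T := T) b') →
      Moves δ'.2.2 (InfPath.toBoundary (T := T) a') (InfPath.toBoundary (T := T) b') := by
    rintro δ _ rfl h
    exact h
  obtain ⟨g', hg', h4⟩ := (h a' haU').2 b' (key _ _ h3 (germMap_moves s))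
  have hf' : T.hullAction.φ f a' = some b' := hullMap_eq_some.2 ⟨g', hg'⟩
  have h5 : T.germMap b' a' (T.hullAction.mkGerm f hf') = T.germMap b' a' s := by
    rw [(germRel_germMap hf').unique hg']
    exact eq_of_heq (Sigma.mk.inj_iff.1 (eq_of_heq (Sigma.mk.inj_iff.1 (h4.trans h3.symm)).2)).2
  refine ⟨_, ⟨b', a', hf', haU, rfl⟩, ?_⟩
  exact congrArg (fun s => arrMap (T.germFunctor hs) (⟨b', a', s⟩ : Arr (GermGroupoid T.hullAction)))
    (germMap_injective b' a' h5)

theorem isTopologicalIso_germFunctor (T : 𝒢.Transversals) (hs : 𝒢.NoSources) :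
    IsTopologicalIso (T.germFunctor hs) := by
  let e := Equiv.ofBijective _ (T.germFunctor_bijective hs)
  have he : Continuous e.symm := by
    rw [continuous_generateFrom_iff]
    rintro _ ⟨f, U, hU, -, rfl⟩
    rw [← e.image_eq_preimage_symm]
    exact isOpen_image_germSet hs f hU
  exact (Homeomorph.mk e (T.continuous_germFunctor hs) he).isHomeomorph

end Transversals

end DirGraphOfGroups

theorem mainTheorem9 {V E : Type*} (𝒢 : DirGraphOfGroups V E) (_hcount : 𝒢.IsCountable)
    (_hrow : 𝒢.RowFinite) (hs : 𝒢.NoSources) (T : 𝒢.Transversals) :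
    -- the action of the left inverse hull on the infinite path space
    ∃ A : InvSemigroupAction (LeftInverseHull 𝒢.WordCat) T.InfPath, T.IsWordAction hs A ∧
      -- the isomorphism of topological groupoids
      ∃ Θ : GermGroupoid A ⥤ Restriction (T.pathUnits hs), IsTopologicalIso Θ ∧
        -- which sends the germ of `τ^λ σ^μ` at `a` to the pair `(λμ⁻¹, a)`
        ∀ {x y z : 𝒢.WordCat} (l : x ⟶ z) (m : y ⟶ z) (a b : T.InfPath)
          (h : A.φ (tauSigma l m) a = some b),
          (𝒢.boundaryAction hs).pair
              (Restriction.incl (arrMap Θ (GermGroupoid.germ A (tauSigma l m) h))) =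
            (⟨x, y, 𝒢.quot l m⟩, a.toBoundary) := by
  refine ⟨T.hullAction, T.isWordAction_hullAction hs, T.germFunctor hs,
    T.isTopologicalIso_germFunctor hs, ?_⟩
  intro x y z l m a b h
  have h1 := (DirGraphOfGroups.Transversals.germRel_tauSigma
    (DirGraphOfGroups.Transversals.germRel_germMap h)).2
  exact (T.pair_germFunctor hs (T.hullAction.mkGerm _ h)).trans
    (congrArg (fun γ => (γ, a.toBoundary)) h1)
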